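/- **Proposition 2.1.** Let $n\ge 2$ and work over $\mathbb{Q}(q)$, with $[m]=q^{1-m}+q^{3-m}+\dots+q^{m-1}$, $[-m]=-[m]$ for $m\ge 0$, and $\left[{m\atop t}\right]=\prod_{i=0}^{t-1}[m-i]/[i+1]$ for $m\in\mathbb{Z}$, $t\ge 0$. An $SL_n$ *web* is a planar graph drawn in a disk (up to planar isotopy fixing the boundary) with oriented strands labeled by elements of $\{1,\dots,n-1\}$, and with vertices of four kinds: two strands $k,l$ fuse to a strand $k+l$; a strand $k+l$ divides into strands $k,l$; two incoming, or two outgoing, strands $k$ and $n-k$ meet at a bivalent vertex that carries a *tag* on one of its two sides. Relations are linear relations between webs with the same boundary, applied locally inside larger webs. They are written with strands labeled $0,\dots,n$: strands labeled $0$ or $n$ are deleted, a trivalent vertex with a $0$-strand becomes a point of a strand, and a trivalent vertex with an $n$-strand becomes a bivalent vertex with a tag. Write strands pointing upward from left to right. On two strands $(k,l)$ let $F^{(s)}$ be the web in which a horizontal rung labeled $s$ goes from the left strand to the right one (giving $(k-s,l+s)$), and $E^{(r)}$ the web in which a rung labeled $r$ goes from the right strand to the left one (giving $(k+r,l-r)$);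 products are read from right (bottom) to left (top), and a product is zero if one of its labels is outside $\{0,\dots,n\}$. *Reduced relations* (where the tag left by an $n$-strand is always on the side of the deleted strand), together with the relations obtained by reversing all arrows: 1. (switching a tag) moving the tag of a bivalent vertex with outgoing strands $k,n-k$ to the other side multiplies the web by $(-1)^{k(n-k)}$; 2. (canceling a pair of tags) for $1\le k\le n-1$, an incoming bivalent vertex followed by an outgoing one along a strand $k,\,n-k,\,k$, with both tags on the same side of the strand, equals a plain strand $k$; 3. ($I=H$) fusing $l$ with $m$ and then $k$ with the result equals fusing $k$ with $l$ and then the result with $m$, for $k,l,m\ge 1$, $k+l+m\le n$; 4. (bursting a digon) the digon with sides $k-1$ and $1$ on a strand $k$ equals $[k]$ times the strand, for $2\le k\le n$; 5. (bursting a square) for $2\le k\le n-1$, $E^{(1)}F^{(1)}$ on $(k,1)$ equals the web that fuses $k,1$ to $k+1$ and divides again, plus $[k-1]$ times the identity. *Relations of Cautis, Kamnitzer and Morrison*, together with all their mirror reflections and arrow reversals (performed while the $n$-strands are still drawn); here the tag left by an $n$-strand is on the side of the deleted strand if the two other strands are outgoing, and on the opposite side if they are incoming: * (2.3) switching a tag,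 as in 1; * (2.4) the digon with sides $k,l$ on a strand $k+l$ equals $\left[{k+l\atop l}\right]$ times the strand, for $k+l\le n$; * (2.5) a strand $k$ fusing with one end of a strand $l$ to $k+l$ and then dividing into $k,l$, where the two ends of $l$ are joined by a loop on one side, equals $\left[{n-k\atop l}\right]$ times the strand $k$, for $k+l\le n$; * (2.6) $I=H$ for $k+l+m<n$; * (2.7) (tag migration) the same with $k+l+m=n$, $k,l,m\ge1$, where the output is an $n$-strand; * (2.8) (tag migration) for $k,l,m\ge 1$, $k+l+m=n$, with incoming boundary strands $k+l$ (bottom left) and $k+m$ (bottom right) and outgoing boundary strand $k$ (top): dividing $k+l$ into $k,l$ and fusing $l$ with $k+m$ to an $n$-strand equals dividing $k+m$ into $m,k$ and fusing $k+l$ with $m$ to an $n$-strand, where the $n$-strand leaves to the bottom in both webs; * (2.9) (square removal) $F^{(s)}F^{(r)}=\left[{r+s\atop r}\right]F^{(r+s)}$ on $(k,l)$ with $r+s\le k\le n$, $l+r+s\le n$; * (2.10) (square switching) $E^{(r)}F^{(s)}=\sum_{t=0}^{\min(r,s)}\left[{k-l+r-s\atop t}\right]F^{(s-t)}E^{(r-t)}$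 on $(k,l)$, for $0\le k,l\le n$ and $r,s\ge 0$. Let $\tau$ be the change of tag convention: it switches the side of the tag on every bivalent vertex whose strands are oriented inward, and is extended linearly. Then the two sets of relations are equivalent up to $\tau$: for every linear combination $x$ of webs with a common boundary, $x=0$ is a consequence of the reduced relations if and only if $\tau(x)=0$ is a consequence of the Cautis–Kamnitzer–Morrison relations, and $x=0$ is a consequence of the Cautis–Kamnitzer–Morrison relations if and only if $\tau(x)=0$ is a consequence of the reduced relations. -/

import Mathlib

/-! Webs for `SL_n`, drawn in general position with respect to a height function. -/

namespace SLWeb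

noncomputable section

/-- The ground field `ℚ(q)`. -/
abbrev K : Type := RatFunc ℚ

/-- The indeterminate `q`. -/
def q : K := RatFunc.X

/-- The quantum integer `[m] = q^(1-m) + q^(3-m) + ⋯ + q^(m-3) + q^(m-1)`. -/
def qNat (m : ℕ) : K := ∑ i ∈ Finset.range m, q ^ (2 * (i : ℤ) + 1 - (m : ℤ))

/-- Quantum integers with arbitrary integer argument, `[-m] = -[m]`. -/
def qInt (m : ℤ) : K := (m.sign : K) * qNat m.natAbs

/-- The quantum binomial coefficient `[m][m-1]⋯[m-t+1] / ([t][t-1]⋯[1])`. -/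
def qBinom (m : ℤ) (t : ℕ) : K := ∏ i ∈ Finset.range t, qInt (m - (i : ℤ)) / qNat (i + 1)

/-- A strand crossing a horizontal line: its label and whether it is oriented upward. -/
structure Strand where
  label : ℕ
  isUp : Bool

/-- The same strand with its orientation reversed. -/
def Strand.dual (x : Strand) : Strand := ⟨x.label, !x.isUp⟩

/-- An upward strand labelled `k`. -/
def up (k : ℕ) : Strand := ⟨k, true⟩

/-- A downward strand labelled `k`. -/
def dn (k : ℕ) : Strand := ⟨k, false⟩

/-- A row of strands rotated by half a turn. -/
def dualRow (s : List Strand) : List Strand := (s.map Strand.dual).reverse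

/-- Elementary pieces of a diagram, read from bottom to top: local minima and maxima of a strand
and the four kinds of vertices.

`merge k l` and `split k l` are the trivalent vertices, with `k` to the left of `l`.
`tagOut k l` is a bivalent vertex at a local minimum, with two outgoing strands, labelled `k` on
the left and `l` on the right, and with its tag pointing down. `tagIn k l` is a bivalent vertex at
a local maximum, with two incoming strands, labelled `k` on the left and `l` on the right, and with
its tag pointing up. All other positions of a vertex are obtained by bending its strands. -/
inductive Gen where
  | cup (x : Strand)
  | cap (x : Strand)
  | merge (k l : ℕ)
  | split (k l : ℕ)
  | tagOut (k l : ℕ)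
  | tagIn (k l : ℕ)

/-- The strands entering an elementary piece from below. -/
def Gen.src : Gen → List Strand
  | cup _ => []
  | cap x => [x, x.dual]
  | merge k l => [up k, up l]
  | split k l => [up (k + l)]
  | tagOut _ _ => []
  | tagIn k l => [up k, up l]

/-- The strands leaving an elementary piece at the top. -/
def Gen.tgt : Gen → List Strand
  | cup x => [x, x.dual]
  | cap _ => []
  | merge k l => [up (k + l)]
  | split k l => [up k, up l]
  | tagOut k l => [up k, up l]
  | tagIn _ _ => []

/-- A horizontal slice of a diagram: one elementary piece between vertical strands. -/
structure Slice where
  left : List Strand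
  gen : Gen
  right : List Strand

/-- A diagram, as the list of its slices from bottom to top. -/
abbrev Word : Type := List Slice

/-- Put vertical strands to the left and to the right of a diagram. -/
def whisker (a : List Strand) (w : Word) (b : List Strand) : Word :=
  w.map fun σ => ⟨a ++ σ.left, σ.gen, σ.right ++ b⟩

/-- The slices fit together to a diagram with bottom boundary `s` and top boundary `t`. -/
def IsPath : List Strand → Word → List Strand → Prop
  | s, [], t => s = t
  | s, σ :: w, t =>
    s = σ.left ++ σ.gen.src ++ σ.right ∧ IsPath (σ.left ++ σ.gen.tgt ++ σ.right) w t

/-- The labels of a web are `1, …, n - 1`. -/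
def RowOK (n : ℕ) (s : List Strand) : Prop := ∀ x ∈ s, 0 < x.label ∧ x.label < n

/-- The vertices allowed in a web. -/
def Gen.OK (n : ℕ) : Gen → Prop
  | cup x => 0 < x.label ∧ x.label < n
  | cap x => 0 < x.label ∧ x.label < n
  | merge k l => 0 < k ∧ 0 < l ∧ k + l < n
  | split k l => 0 < k ∧ 0 < l ∧ k + l < n
  | tagOut k l => 0 < k ∧ 0 < l ∧ k + l = n
  | tagIn k l => 0 < k ∧ 0 < l ∧ k + l = n

/-- `w` is (a diagram of) an `SL_n` web with bottom boundary `s` and top boundary `t`. -/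
def IsWeb (n : ℕ) (s : List Strand) (w : Word) (t : List Strand) : Prop :=
  RowOK n s ∧ RowOK n t ∧
    (∀ σ ∈ w, RowOK n σ.left ∧ σ.gen.OK n ∧ RowOK n σ.right) ∧ IsPath s w t

/-- Formal linear combinations of diagrams. -/
abbrev Lin : Type := Word →₀ K

/-- A diagram as a linear combination. -/
def dg (w : Word) : Lin := Finsupp.single w 1

/-- Formal linear combinations of webs with given boundary. -/
def Hom (n : ℕ) (s t : List Strand) : Submodule K Lin :=
  Finsupp.supported K K {w | IsWeb n s w t}

/-! ### Planar isotopy -/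

/-- Nested minima, from the empty row to `s ++ dualRow s`. -/
def cups : List Strand → Word
  | [] => []
  | x :: s => ⟨[], .cup x, []⟩ :: whisker [x] (cups s) [x.dual]

/-- Nested maxima, from `dualRow s ++ s` to the empty row. -/
def caps : List Strand → Word
  | [] => []
  | x :: s => ⟨dualRow s, .cap x.dual, s⟩ :: caps s

/-- Nested minima, from the empty row to `dualRow s ++ s`. -/
def cups' : List Strand → Word
  | [] => []
  | x :: s => cups' s ++ [⟨dualRow s, .cup x.dual, s⟩]

/-- Nested maxima, from `s ++ dualRow s` to the empty row. -/
def caps' : List Strand → Word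
  | [] => []
  | x :: s => whisker [x] (caps' s) [x.dual] ++ [⟨[], .cap x, []⟩]

/-- An elementary piece rotated by half a turn in one direction. -/
def Gen.rot (g : Gen) : Word :=
  whisker (dualRow g.tgt) (cups g.src) [] ++ [⟨dualRow g.tgt, g, dualRow g.src⟩] ++
    whisker [] (caps g.tgt) (dualRow g.src)

/-- An elementary piece rotated by half a turn in the other direction. -/
def Gen.rot' (g : Gen) : Word :=
  whisker [] (cups' g.src) (dualRow g.tgt) ++ [⟨dualRow g.src, g, dualRow g.tgt⟩] ++
    whisker (dualRow g.src) (caps' g.tgt) []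

/-- The elementary planar isotopies between diagrams (those of a strict pivotal category):
exchanging the heights of two distant pieces, straightening a strand, and rotating a vertex by a
full turn (equivalently, its two rotations by half a turn agree). -/
inductive Isotopy : Lin → Prop
  | exchange (g h : Gen) (b : List Strand) :
      Isotopy (dg [⟨[], g, b ++ h.src⟩, ⟨g.tgt ++ b, h, []⟩] -
        dg [⟨g.src ++ b, h, []⟩, ⟨[], g, b ++ h.tgt⟩])
  | zigzag (x : Strand) :
      Isotopy (dg [⟨[], .cup x, [x]⟩, ⟨[x], .cap x.dual, []⟩] - dg [])
  | zigzag' (x : Strand) :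
      Isotopy (dg [⟨[x], .cup x.dual, []⟩, ⟨[], .cap x, [x]⟩] - dg [])
  | rotate (g : Gen) : Isotopy (dg g.rot - dg g.rot')

/-- Insert a linear combination of diagrams into a larger diagram: vertical strands `a` and `b` to
its left and right, the diagram `u` below and the diagram `v` above. -/
def insert (u v : Word) (a b : List Strand) : Lin →ₗ[K] Lin :=
  Finsupp.lmapDomain K K fun w => u ++ whisker a w b ++ v

/-- The linear combinations of webs from `s` to `t` that vanish as a consequence of planar isotopy
and of the relations `x = 0`, `x ∈ R`, applied locally inside larger webs. Two linear
combinations `x` and `y` of webs are equal in the spider defined by the relations `R` if `x - y`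
lies in this subspace. -/
def relations (n : ℕ) (R : Set Lin) (s t : List Strand) : Submodule K Lin :=
  Submodule.span K
    {y | y ∈ Hom n s t ∧
      ∃ (u v : Word) (a b : List Strand) (x : Lin), (Isotopy x ∨ x ∈ R) ∧ y = insert u v a b x}

/-! ### Symmetries -/

/-- Apply an operation on elementary pieces throughout a diagram; `f` acts on the vertical
strands. -/
def subst (f : List Strand → List Strand) (F : Gen → Word) (w : Word) : Word :=
  w.flatMap fun σ => whisker (f σ.left) (F σ.gen) (f σ.right)

/-- An elementary piece with all arrows reversed, in the same position. -/
def Gen.reverse : Gen → Word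
  | cup x => [⟨[], cup x.dual, []⟩]
  | cap x => [⟨[], cap x.dual, []⟩]
  | merge k l => (split l k).rot
  | split k l => (merge l k).rot
  | tagOut k l => (tagIn l k).rot
  | tagIn k l => (tagOut l k).rot

/-- Reverse all arrows of a diagram. -/
def reverse : Word → Word := subst (fun s => s.map Strand.dual) Gen.reverse

/-- Reflection of an elementary piece in a vertical line. -/
def Gen.mirror : Gen → Gen
  | cup x => cup x.dual
  | cap x => cap x.dual
  | merge k l => merge l k
  | split k l => split l k
  | tagOut k l => tagOut l k
  | tagIn k l => tagIn l k

/-- Reflection of a diagram in a vertical line. -/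
def mirror (w : Word) : Word :=
  w.map fun σ => ⟨σ.right.reverse, σ.gen.mirror, σ.left.reverse⟩

/-! ### Tags and strands labelled `0` or `n` -/

/-- The vertex `tagOut k l` with its tag on the other side (pointing up, between the strands). -/
def tagOutSwitched (k l : ℕ) : Word :=
  [⟨[], .cup (dn l), []⟩, ⟨[dn l], .tagOut l k, [up l]⟩, ⟨[], .cap (dn l), [up k, up l]⟩]

/-- The vertex `tagIn k l` with its tag on the other side (pointing down, between the strands). -/
def tagInSwitched (k l : ℕ) : Word :=
  [⟨[], .cup (dn l), [up k, up l]⟩, ⟨[dn l], .tagIn l k, [up l]⟩, ⟨[], .cap (dn l), []⟩]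

/-- The effect of `retag` on an elementary piece. -/
def Gen.retag : Gen → Word
  | tagIn k l => tagInSwitched k l
  | g => [⟨[], g, []⟩]

/-- The change of tag convention: switch the side of the tag on every bivalent vertex whose
strands are oriented inward. -/
def retag : Lin →ₗ[K] Lin := Finsupp.lmapDomain K K (subst id Gen.retag)

/-- A convention for the tag that remains when a strand labelled `n` is deleted from a vertex.
`toward`: the tag is on the side of the deleted strand.
`ckm`: the same if the two remaining strands are outgoing, and the opposite side if they are
incoming. -/
inductive Convention where
  | toward
  | ckm

/-- The vertex `merge k l`, where `k + l = n`, after deletion of the outgoing strand. -/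
def Convention.inTag : Convention → ℕ → ℕ → Word
  | toward, k, l => [⟨[], .tagIn k l, []⟩]
  | ckm, k, l => tagInSwitched k l

/-- Remove the strands labelled `0` or `n` from a row. -/
def deleteRow (n : ℕ) (s : List Strand) : List Strand :=
  s.filter fun x => decide (0 < x.label ∧ x.label < n)

/-- Remove the strands labelled `0` or `n` from an elementary piece with labels in `0, …, n`. -/
def Gen.delete (n : ℕ) (c : Convention) : Gen → Word
  | cup x => if 0 < x.label ∧ x.label < n then [⟨[], cup x, []⟩] else []
  | cap x => if 0 < x.label ∧ x.label < n then [⟨[], cap x, []⟩] else []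
  | merge k l =>
    if k = 0 ∨ l = 0 then [] else if k + l = n then c.inTag k l else [⟨[], merge k l, []⟩]
  | split k l =>
    if k = 0 ∨ l = 0 then [] else if k + l = n then [⟨[], tagOut k l, []⟩]
    else [⟨[], split k l, []⟩]
  | tagOut k l => [⟨[], tagOut k l, []⟩]
  | tagIn k l => [⟨[], tagIn k l, []⟩]

/-- Delete all strands labelled `0` or `n` from a diagram. -/
def delete (n : ℕ) (c : Convention) : Word → Word := subst (deleteRow n) (Gen.delete n c)

/-- Apply an operation on diagrams to a linear combination. -/
def lin (f : Word → Word) : Lin →ₗ[K] Lin := Finsupp.lmapDomain K K f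

/-! ### The relations

Relations are written with labels in `0, …, n`; a relator `x` stands for the relation `x = 0`. -/

/-- `merge l m`, then `merge k (l + m)`. -/
def mergeI (k l m : ℕ) : Word := [⟨[up k], .merge l m, []⟩, ⟨[], .merge k (l + m), []⟩]

/-- `merge k l`, then `merge (k + l) m`. -/
def mergeH (k l m : ℕ) : Word := [⟨[], .merge k l, [up m]⟩, ⟨[], .merge (k + l) m, []⟩]

/-- A strand labelled `k + l` opens into a digon with sides `k`, `l`. -/
def digon (k l : ℕ) : Word := [⟨[], .split k l, []⟩, ⟨[], .merge k l, []⟩]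

/-- Two upward strands `k`, `l`; a horizontal rung labelled `s` goes from the left strand to the
right one. -/
def rungR (k l s : ℕ) : Word :=
  [⟨[], .split (k - s) s, [up l]⟩, ⟨[up (k - s)], .merge s l, []⟩]

/-- Two upward strands `k`, `l`; a horizontal rung labelled `r` goes from the right strand to the
left one. -/
def rungL (k l r : ℕ) : Word :=
  [⟨[up k], .split r (l - r), []⟩, ⟨[], .merge k r, [up (l - r)]⟩]

/-- The relations of the reduced list, before reversal of arrows. -/
inductive ReducedBase (n : ℕ) : Lin → Prop
  | switchTag (k l : ℕ) (hk : 0 < k) (hl : 0 < l) (h : k + l = n) :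
      ReducedBase n (dg [⟨[], .tagOut k l, []⟩] - (-1 : K) ^ (k * l) • dg (tagOutSwitched k l))
  | cancelTags (k l : ℕ) (hk : 0 < k) (hl : 0 < l) (h : k + l = n) :
      ReducedBase n
        (dg [⟨[], .cup (dn l), [up k]⟩, ⟨[dn l], .tagIn l k, []⟩, ⟨[dn l], .tagOut l k, []⟩,
          ⟨[], .cap (dn l), [up k]⟩] - dg [])
  | iEqH (k l m : ℕ) (hk : 0 < k) (hl : 0 < l) (hm : 0 < m) (h : k + l + m ≤ n) :
      ReducedBase n (dg (mergeI k l m) - dg (mergeH k l m))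
  | burstDigon (k : ℕ) (hk : 2 ≤ k) (h : k ≤ n) :
      ReducedBase n (dg (digon (k - 1) 1) - qNat k • dg [])
  | burstSquare (k : ℕ) (hk : 2 ≤ k) (h : k + 1 ≤ n) :
      ReducedBase n
        (dg (rungR k 1 1 ++ rungL (k - 1) 2 1) -
          (dg [⟨[], .merge k 1, []⟩, ⟨[], .split k 1, []⟩] + qNat (k - 1) • dg []))

/-- The reduced list of relations: switching a tag, cancelling a pair of tags, `I = H`, bursting a
digon and bursting a square, with their arrow reversals. A deleted strand labelled `n` leaves a tag
on its side. -/
def reduced (n : ℕ) : Set Lin :=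
  {y | ∃ x, ReducedBase n x ∧
    (y = lin (delete n .toward) x ∨ y = lin (delete n .toward) (lin reverse x))}

/-- A rung labelled `s` to the right, and above it a rung labelled `r` to the left. The diagram is
zero if one of its labels lies outside `0, …, n`. -/
def ladderRL (n k l s r : ℕ) : Lin :=
  if s ≤ k ∧ l + s ≤ n ∧ r ≤ l + s ∧ k - s + r ≤ n then
    dg (rungR k l s ++ rungL (k - s) (l + s) r) else 0

/-- A rung labelled `r` to the left, and above it a rung labelled `s` to the right. The diagram is
zero if one of its labels lies outside `0, …, n`. -/
def ladderLR (n k l r s : ℕ) : Lin :=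
  if r ≤ l ∧ k + r ≤ n ∧ s ≤ k + r ∧ l - r + s ≤ n then
    dg (rungL k l r ++ rungR (k + r) (l - r) s) else 0

/-- The vertex where incoming strands `k` and `l`, with `k + l = n`, fuse to a strand labelled `n`
that leaves downward, between `k` and `l`: a diagram from `[up k, dn (k + l), up l]` to `[]`. -/
def mergeDown (k l : ℕ) : Word :=
  [⟨[], .cup (dn l), [up k, dn (k + l), up l]⟩, ⟨[dn l], .merge l k, [dn (k + l), up l]⟩,
    ⟨[dn l], .cap (up (l + k)), [up l]⟩, ⟨[], .cap (dn l), []⟩]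

/-- The defining relations of Cautis, Kamnitzer and Morrison, before mirror reflections and arrow
reversals. -/
inductive CKMBase (n : ℕ) : Lin → Prop
  | switchTag (k l : ℕ) (hk : 0 < k) (hl : 0 < l) (h : k + l = n) :
      CKMBase n (dg [⟨[], .tagOut k l, []⟩] - (-1 : K) ^ (k * l) • dg (tagOutSwitched k l))
  | removeBigon (k l : ℕ) (h : k + l ≤ n) :
      CKMBase n (dg (digon k l) - qBinom ((k : ℤ) + l) l • dg [])
  | removeBigon' (k l : ℕ) (h : k + l ≤ n) :
      CKMBase n
        (dg [⟨[up k], .cup (up l), []⟩, ⟨[], .merge k l, [dn l]⟩, ⟨[], .split k l, [dn l]⟩,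
          ⟨[up k], .cap (up l), []⟩] - qBinom ((n : ℤ) - k) l • dg [])
  | iEqH (k l m : ℕ) (h : k + l + m < n) :
      CKMBase n (dg (mergeI k l m) - dg (mergeH k l m))
  | migrateTag (k l m : ℕ) (hk : 0 < k) (hl : 0 < l) (hm : 0 < m) (h : k + l + m = n) :
      CKMBase n (dg (mergeI k l m) - dg (mergeH k l m))
  | migrateTag' (k l m : ℕ) (hk : 0 < k) (hl : 0 < l) (hm : 0 < m) (h : k + l + m = n) :
      CKMBase n
        (dg (⟨[], .split k l, [dn n, up (k + m)]⟩ :: whisker [up k] (mergeDown l (k + m)) []) -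
          dg (⟨[up (k + l), dn n], .split m k, []⟩ :: whisker [] (mergeDown (k + l) m) [up k]))
  | removeSquare (k l r s : ℕ) (hk : k ≤ n) (hrs : r + s ≤ k) (h : l + (r + s) ≤ n) :
      CKMBase n
        (dg (rungR k l r ++ rungR (k - r) (l + r) s) -
          qBinom ((r : ℤ) + s) r • dg (rungR k l (r + s)))
  | switchSquare (k l r s : ℕ) (hk : k ≤ n) (hl : l ≤ n) :
      CKMBase n
        (ladderRL n k l s r -
          ∑ t ∈ Finset.range (min r s + 1),
            qBinom ((k : ℤ) - l + r - s) t • ladderLR n k l (r - t) (s - t))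

/-- The defining relations of Cautis, Kamnitzer and Morrison with all mirror reflections and arrow
reversals, where strands labelled `0` or `n` are deleted and tags are drawn in their
convention. -/
def ckm (n : ℕ) : Set Lin :=
  {y | ∃ x, CKMBase n x ∧
    (y = lin (delete n .ckm) x ∨ y = lin (delete n .ckm) (lin mirror x) ∨
      y = lin (delete n .ckm) (lin reverse x) ∨
      y = lin (delete n .ckm) (lin reverse (lin mirror x)))}

end

end SLWeb

/-!
The two conventions for the tag left by a strand labelled `n` are treated separately from the
relations. Let `ckmWith n c` be the list of Cautis, Kamnitzer and Morrison drawn in the convention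
`c`, either their own or the one of the reduced list, `toward`, where the tag is always on the side
of the deleted strand. Then `relations_reduced_eq_ckmWith_toward` shows that the reduced list and
`ckmWith n .toward` have the same consequences, and `retag_mem_ckmWith` that the change of tag
convention carries consequences of `ckmWith n c` to consequences of the list in the other
convention. As retagging twice is isotopic to the identity (`retag_retag_sub_mem`), the theorem
follows.

*Calculations with webs.* For a set `R` of relators, `Alg n R` is an algebra in which elementary
pieces of diagrams are elements, stacking of diagrams is multiplication from bottom to top, and
`x` is a consequence of `R` if and only if its value is zero (`mem_relations_of_evL`,
`idem_mul_evL_eq_zero`). Local relations thus become equations in a ring that can be rewritten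
inside products. Planar isotopy gives the usual calculus of rotated diagrams, up to the fact that a
full rotation is an isotopy (`iso_rotW_rotW`). Reversing all arrows of a diagram is, up to isotopy,
the half turn of its image under both reflections (`iso_delete_reverse`); so for either list, the
reversed relations amount to the reflected ones, and the consequences of the reduced list are
invariant under both reflections (`ReducedBase.reflect`).

*Reduced relations from the long list.* In the convention `toward` each reduced relator is a
special case of a relator of the long list: the cancellation of tags is a loop whose label together
with that of the strand is `n`, and the bursting of a square is square switching with `r = s = 1`
(`ReducedBase.exists_eq`).

*The long list from the reduced relations.* With a cancelling pair of tags a loop becomes an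
outgoing and an incoming bivalent vertex (`cup_mul_cap_eq_tags`), and the relation `I = H` with an
output labelled `n` moves tags past vertices, which gives both tag migrations
(`split_mul_tagInSwitched`) and reduces loops to digons (`loop_eq_of_digon`). As a consequence
the square relation holds also when one of its strands is labelled `n`
(`tagOut_mul_square_mul_tagIn`). The webs made of upward strands labelled `0, …, n` then satisfy
the axioms of a `Ladder`, in which only digons and squares with rungs labelled `1` are prescribed.
As quantum integers are invertible, general digons follow by induction, the rungs of ladders are
divided powers of those labelled `1`, and square switching is the commutation formula of
`U_q(sl_2)` for divided powers (`DividedPowers.F_mul_E`). Finally, a loop labelled `l` is a ladder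
next to a strand labelled `n` (`web_loop_eq_ladder`), so its value is a case of square switching.

*Change of convention.* Only the relators for switching a tag contain tags before deletion. For
all others, retagging commutes with deletion up to the convention. Switching the tag of a vertex
with incoming strands is turned by retagging into a multiple of the same relator
(`retag_mem_of_switchTagIn`).

*Positions of relators.* A multiple of the empty diagram could be inserted in any place whatever
its boundary was meant to be, so it has to be known that no relator is a nonzero multiple of the
empty diagram, even after deletions (`NonScalar`). Most relators have vertices left that cannot
cancel (`Weighted.nonScalar_of_sizeCoeff`); for square switching with `k + l ≤ n` one evaluates all
diagrams by weights which satisfy the relation (`weight_switchSquare`).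
-/

namespace SLWeb

noncomputable section

/-! ### Rows, slices and webs -/

@[simp] theorem Strand.dual_dual (x : Strand) : x.dual.dual = x := by
  cases x; simp [Strand.dual]

@[simp] theorem Strand.dual_label (x : Strand) : x.dual.label = x.label := rfl

@[simp] theorem dual_up (k : ℕ) : (up k).dual = dn k := rfl

@[simp] theorem dual_dn (k : ℕ) : (dn k).dual = up k := rfl

@[simp] theorem dualRow_nil : dualRow [] = [] := rfl

@[simp] theorem dualRow_cons (x : Strand) (s : List Strand) :
    dualRow (x :: s) = dualRow s ++ [x.dual] := by simp [dualRow]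

@[simp] theorem dualRow_append (s t : List Strand) :
    dualRow (s ++ t) = dualRow t ++ dualRow s := by simp [dualRow]

@[simp] theorem dualRow_dualRow (s : List Strand) : dualRow (dualRow s) = s := by
  induction s with
  | nil => rfl
  | cons x s ih => simp [ih]

section RowOK

variable {n : ℕ}

@[simp] theorem rowOK_nil : RowOK n [] := by simp [RowOK]

@[simp] theorem rowOK_cons {x : Strand} {s : List Strand} :
    RowOK n (x :: s) ↔ (0 < x.label ∧ x.label < n) ∧ RowOK n s := by simp [RowOK]

@[simp] theorem rowOK_append {s t : List Strand} :
    RowOK n (s ++ t) ↔ RowOK n s ∧ RowOK n t := List.forall_mem_append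

@[simp] theorem rowOK_reverse {s : List Strand} : RowOK n s.reverse ↔ RowOK n s := by
  simp [RowOK]

@[simp] theorem rowOK_map_dual {s : List Strand} :
    RowOK n (s.map Strand.dual) ↔ RowOK n s := by
  simp [RowOK]

@[simp] theorem rowOK_dualRow {s : List Strand} : RowOK n (dualRow s) ↔ RowOK n s := by
  simp [dualRow]

@[simp] theorem rowOK_deleteRow (s : List Strand) : RowOK n (deleteRow n s) := by
  intro x hx
  simpa using (List.mem_filter.1 hx).2

theorem Gen.OK.src {g : Gen} (h : g.OK n) : RowOK n g.src := by
  cases g <;> simp_all [Gen.OK, Gen.src, up] <;> omega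

theorem Gen.OK.tgt {g : Gen} (h : g.OK n) : RowOK n g.tgt := by
  cases g <;> simp_all [Gen.OK, Gen.tgt, up] <;> omega

end RowOK

/-- The bottom boundary of a slice. -/
def Slice.src (σ : Slice) : List Strand := σ.left ++ σ.gen.src ++ σ.right

/-- The top boundary of a slice. -/
def Slice.tgt (σ : Slice) : List Strand := σ.left ++ σ.gen.tgt ++ σ.right

/-- A slice whose labels and vertex are those of an `SL_n` web. -/
def Slice.OK (n : ℕ) (σ : Slice) : Prop := RowOK n σ.left ∧ σ.gen.OK n ∧ RowOK n σ.right

theorem Slice.OK.src {n : ℕ} {σ : Slice} (h : σ.OK n) : RowOK n σ.src := by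
  simp [Slice.src, h.1, h.2.1.src, h.2.2]

theorem Slice.OK.tgt {n : ℕ} {σ : Slice} (h : σ.OK n) : RowOK n σ.tgt := by
  simp [Slice.tgt, h.1, h.2.1.tgt, h.2.2]

@[simp] theorem isPath_nil {s t : List Strand} : IsPath s [] t ↔ s = t := Iff.rfl

@[simp] theorem isPath_cons {s t : List Strand} {σ : Slice} {w : Word} :
    IsPath s (σ :: w) t ↔ s = σ.src ∧ IsPath σ.tgt w t := Iff.rfl

theorem isPath_append {s t : List Strand} {u v : Word} :
    IsPath s (u ++ v) t ↔ ∃ r, IsPath s u r ∧ IsPath r v t := by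
  induction u generalizing s with
  | nil => simp
  | cons σ u ih => simp [ih, and_assoc]

theorem IsPath.append {s r t : List Strand} {u v : Word} (hu : IsPath s u r)
    (hv : IsPath r v t) : IsPath s (u ++ v) t := isPath_append.2 ⟨r, hu, hv⟩

@[simp] theorem whisker_nil (a b : List Strand) : whisker a [] b = [] := rfl

@[simp] theorem whisker_cons (a b : List Strand) (σ : Slice) (w : Word) :
    whisker a (σ :: w) b = ⟨a ++ σ.left, σ.gen, σ.right ++ b⟩ :: whisker a w b := rfl

@[simp] theorem whisker_append (a b : List Strand) (u v : Word) :
    whisker a (u ++ v) b = whisker a u b ++ whisker a v b := by simp [whisker]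

@[simp] theorem whisker_whisker (a b a' b' : List Strand) (w : Word) :
    whisker a (whisker a' w b') b = whisker (a ++ a') w (b' ++ b) := by
  simp [whisker]

@[simp] theorem whisker_empty (w : Word) : whisker [] w [] = w := by simp [whisker]

@[simp] theorem whisker_eq_nil {a b : List Strand} {w : Word} : whisker a w b = [] ↔ w = [] := by
  simp [whisker]

theorem IsPath.whisker {s t : List Strand} {w : Word} (a b : List Strand) (h : IsPath s w t) :
    IsPath (a ++ s ++ b) (whisker a w b) (a ++ t ++ b) := by
  induction w generalizing s with
  | nil => simp_all
  | cons σ w ih =>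
    rw [isPath_cons] at h
    rw [whisker_cons, isPath_cons]
    refine ⟨by simp [h.1, Slice.src], ?_⟩
    simpa [Slice.tgt] using ih h.2

theorem IsPath.unique {s t t' : List Strand} {w : Word} (h : IsPath s w t)
    (h' : IsPath s w t') : t = t' := by
  induction w generalizing s with
  | nil => simp_all
  | cons σ w ih => exact ih h.2 h'.2

theorem isWeb_nil {n : ℕ} {s t : List Strand} : IsWeb n s [] t ↔ RowOK n s ∧ s = t := by
  constructor
  · rintro ⟨h, -, -, h'⟩; exact ⟨h, h'⟩
  · rintro ⟨h, rfl⟩; exact ⟨h, h, by simp, rfl⟩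

theorem isWeb_cons {n : ℕ} {s t : List Strand} {σ : Slice} {w : Word} :
    IsWeb n s (σ :: w) t ↔ s = σ.src ∧ σ.OK n ∧ IsWeb n σ.tgt w t := by
  constructor
  · rintro ⟨h1, h2, h3, h4, h5⟩
    have hσ : σ.OK n := h3 σ (by simp)
    exact ⟨h4, hσ, hσ.tgt, h2, fun τ hτ => h3 τ (by simp [hτ]), h5⟩
  · rintro ⟨rfl, hσ, -, h2, h3, h4⟩
    refine ⟨hσ.src, h2, ?_, rfl, h4⟩
    intro τ hτ
    rcases List.mem_cons.1 hτ with rfl | hτ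
    · exact hσ
    · exact h3 τ hτ

theorem isWeb_append {n : ℕ} {s t : List Strand} {u v : Word} :
    IsWeb n s (u ++ v) t ↔ ∃ r, IsWeb n s u r ∧ IsWeb n r v t := by
  induction u generalizing s with
  | nil =>
    simp only [List.nil_append, isWeb_nil]
    constructor
    · intro h; exact ⟨s, ⟨h.1, rfl⟩, h⟩
    · rintro ⟨r, ⟨-, rfl⟩, h⟩; exact h
  | cons σ u ih => simp [isWeb_cons, ih, and_assoc]

theorem IsWeb.append {n : ℕ} {s r t : List Strand} {u v : Word} (hu : IsWeb n s u r)
    (hv : IsWeb n r v t) : IsWeb n s (u ++ v) t := isWeb_append.2 ⟨r, hu, hv⟩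

theorem IsWeb.whisker {n : ℕ} {s t : List Strand} {w : Word} {a b : List Strand}
    (ha : RowOK n a) (hb : RowOK n b) (h : IsWeb n s w t) :
    IsWeb n (a ++ s ++ b) (whisker a w b) (a ++ t ++ b) := by
  obtain ⟨h1, h2, h3, h4⟩ := h
  refine ⟨by simp [*], by simp [*], ?_, h4.whisker a b⟩
  intro σ hσ
  obtain ⟨τ, hτ, rfl⟩ := List.mem_map.1 hσ
  have := h3 τ hτ
  simp [*]

theorem IsWeb.refl {n : ℕ} {s : List Strand} (h : RowOK n s) : IsWeb n s [] s :=
  isWeb_nil.2 ⟨h, rfl⟩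

theorem whisker_injective (a b : List Strand) :
    Function.Injective fun w : Word => whisker a w b := by
  intro w w' h
  refine (List.map_injective_iff.2 ?_) h
  rintro ⟨l, g, r⟩ ⟨l', g', r'⟩ h
  simpa using h

theorem insert_injective (u v : Word) (a b : List Strand) :
    Function.Injective fun w : Word => u ++ whisker a w b ++ v := by
  intro w w' h
  exact whisker_injective a b (by simpa using h)

/-! ### Consequences of relations -/

theorem mem_Hom {n : ℕ} {s t : List Strand} {x : Lin} :
    x ∈ Hom n s t ↔ ∀ w, x w ≠ 0 → IsWeb n s w t := by
  simp [Hom, Finsupp.mem_supported, Set.subset_def]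

theorem dg_mem_Hom {n : ℕ} {s t : List Strand} {w : Word} (h : IsWeb n s w t) :
    dg w ∈ Hom n s t := Finsupp.single_mem_supported K 1 h

/-- Linear extensions of maps of diagrams preserve linear combinations of webs. -/
theorem lmapDomain_mem_Hom {n m : ℕ} {s t s' t' : List Strand} {f : Word → Word} {x : Lin}
    (hf : ∀ w, IsWeb n s w t → IsWeb m s' (f w) t') (hx : x ∈ Hom n s t) :
    Finsupp.lmapDomain K K f x ∈ Hom m s' t' := by
  classical
  have : Finsupp.supported K K {w | IsWeb n s w t} ≤
      (Hom m s' t').comap (Finsupp.lmapDomain K K f) := by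
    rw [Finsupp.supported_eq_span_single, Submodule.span_le]
    rintro _ ⟨w, hw, rfl⟩
    have := dg_mem_Hom (hf w hw)
    simpa [dg, Finsupp.lmapDomain_apply, Finsupp.mapDomain_single] using this
  exact this hx

@[simp] theorem insert_single (u v : Word) (a b : List Strand) (w : Word) (c : K) :
    insert u v a b (Finsupp.single w c) = Finsupp.single (u ++ whisker a w b ++ v) c := by
  simp [insert, Finsupp.lmapDomain_apply, Finsupp.mapDomain_single]

@[simp] theorem insert_dg (u v : Word) (a b : List Strand) (w : Word) :
    insert u v a b (dg w) = dg (u ++ whisker a w b ++ v) := insert_single ..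

@[simp] theorem insert_nil (x : Lin) : insert [] [] [] [] x = x := by
  induction x using Finsupp.induction_linear with
  | zero => simp
  | add x y hx hy => rw [map_add, hx, hy]
  | single w c => simp

theorem insert_insert (u v u' v' : Word) (a b a' b' : List Strand) (x : Lin) :
    insert u v a b (insert u' v' a' b' x) =
      insert (u ++ whisker a u' b) (whisker a v' b ++ v) (a ++ a') (b' ++ b) x := by
  induction x using Finsupp.induction_linear with
  | zero => simp
  | add x y hx hy => simp only [map_add, hx, hy]
  | single w c => simp

theorem insert_mem_Hom {n : ℕ} {s t s' t' a b : List Strand} {u v : Word} {x : Lin}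
    (hx : x ∈ Hom n s' t') (hu : IsWeb n s u (a ++ s' ++ b))
    (hv : IsWeb n (a ++ t' ++ b) v t) : insert u v a b x ∈ Hom n s t := by
  refine lmapDomain_mem_Hom (fun w hw => (hu.append (hw.whisker ?_ ?_)).append hv) hx
  · have := hu.2.1; simp at this; exact this.1
  · have := hu.2.1; simp at this; exact this.2.2

theorem relations_le_Hom {n : ℕ} {R : Set Lin} {s t : List Strand} :
    relations n R s t ≤ Hom n s t :=
  Submodule.span_le.2 fun _ hy => hy.1

theorem relations_mono {n : ℕ} {R R' : Set Lin} (h : R ⊆ R') (s t : List Strand) :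
    relations n R s t ≤ relations n R' s t := by
  refine Submodule.span_mono ?_
  rintro y ⟨hy, u, v, a, b, x, hx, rfl⟩
  exact ⟨hy, u, v, a, b, x, hx.imp id fun hx => h hx, rfl⟩

/-- The consequences of a set of relations are closed under insertion into larger webs. -/
theorem insert_mem_relations {n : ℕ} {R : Set Lin} {s t s' t' a b : List Strand} {u v : Word}
    {x : Lin} (hx : x ∈ relations n R s' t') (hu : IsWeb n s u (a ++ s' ++ b))
    (hv : IsWeb n (a ++ t' ++ b) v t) : insert u v a b x ∈ relations n R s t := by
  have : relations n R s' t' ≤ (relations n R s t).comap (insert u v a b) := by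
    refine Submodule.span_le.2 ?_
    rintro y ⟨hy, u', v', a', b', x, hx, rfl⟩
    refine Submodule.subset_span ⟨insert_mem_Hom hy hu hv, ?_⟩
    exact ⟨_, _, _, _, x, hx, insert_insert ..⟩
  exact this hx

theorem mem_relations_of_mem {n : ℕ} {R : Set Lin} {s t : List Strand} {x : Lin}
    (hx : Isotopy x ∨ x ∈ R) (h : x ∈ Hom n s t) : x ∈ relations n R s t := by
  refine Submodule.subset_span ⟨h, [], [], [], [], x, hx, (insert_nil x).symm⟩

/-- The position of a diagram inside a larger web can be read off from the boundary of a nonempty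
diagram, but not from that of the empty diagram, which has every row as its boundary. A linear
combination is placeable if it is zero or involves a nonempty diagram which determines its
boundary; this makes the places where it can be inserted unambiguous. -/
def Placeable (n : ℕ) (x : Lin) : Prop :=
  x = 0 ∨ ∃ s t w, w ≠ [] ∧ x w ≠ 0 ∧ IsPath s w t ∧ (IsWeb n s w t → x ∈ Hom n s t)

theorem Placeable.of_insert_mem {n : ℕ} {s t a b : List Strand} {u v : Word} {x : Lin}
    (h : Placeable n x) (hx : insert u v a b x ∈ Hom n s t) :
    x = 0 ∨ ∃ s' t', x ∈ Hom n s' t' ∧ IsWeb n s u (a ++ s' ++ b) ∧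
      IsWeb n (a ++ t' ++ b) v t := by
  rcases h with h | ⟨s', t', w, hw, hxw, hp, hH⟩
  · exact Or.inl h
  right
  have h1 : IsWeb n s (u ++ whisker a w b ++ v) t := by
    refine mem_Hom.1 hx _ ?_
    rw [insert, Finsupp.lmapDomain_apply,
      Finsupp.mapDomain_apply (insert_injective u v a b)]
    exact hxw
  obtain ⟨r2, h12, h2⟩ := isWeb_append.1 h1
  obtain ⟨r1, h1, h3⟩ := isWeb_append.1 h12
  have e1 : r1 = a ++ s' ++ b := by
    cases w with
    | nil => exact absurd rfl hw
    | cons σ w =>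
      rw [whisker_cons, isWeb_cons] at h3
      rw [h3.1, (isPath_cons.1 hp).1]
      simp [Slice.src]
  subst e1
  have e2 : r2 = a ++ t' ++ b := h3.2.2.2.unique (hp.whisker a b)
  subst e2
  refine ⟨s', t', hH ?_, h1, h2⟩
  refine ⟨?_, ?_, ?_, hp⟩
  · have := h3.1; simp at this; exact this.2.1
  · have := h3.2.1; simp at this; exact this.2.1
  · intro σ hσ
    have := h3.2.2.1 _ (List.mem_map_of_mem hσ)
    simp at this
    exact ⟨this.1.2, this.2.1, this.2.2.1⟩

theorem placeable_sub {n : ℕ} {s t : List Strand} {w w' : Word} (hw : w ≠ [])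
    (hp : IsPath s w t) (h : IsWeb n s w t → IsWeb n s w' t) : Placeable n (dg w - dg w') := by
  by_cases e : w = w'
  · left; simp [e]
  · refine Or.inr ⟨s, t, w, hw, ?_, hp, fun h' => ?_⟩
    · simp [dg, Ne.symm e]
    · exact Submodule.sub_mem _ (dg_mem_Hom h') (dg_mem_Hom (h h'))

end

noncomputable section

theorem Hom_induction {n : ℕ} {s t : List Strand} {p : Lin → Prop} (h0 : p 0)
    (hadd : ∀ x y, p x → p y → p (x + y)) (hsmul : ∀ (c : K) x, p x → p (c • x))
    (hdg : ∀ w, IsWeb n s w t → p (dg w)) {x : Lin} (hx : x ∈ Hom n s t) : p x := by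
  rw [Hom, Finsupp.supported_eq_span_single] at hx
  induction hx using Submodule.span_induction with
  | mem x hx => obtain ⟨w, hw, rfl⟩ := hx; exact hdg w hw
  | zero => exact h0
  | add x y _ _ hx hy => exact hadd x y hx hy
  | smul c x _ hx => exact hsmul c x hx

/-! ### Rotating diagrams by half a turn -/

theorem cups_append (s t : List Strand) :
    cups (s ++ t) = cups s ++ whisker s (cups t) (dualRow s) := by
  induction s with
  | nil => simp [cups]
  | cons x s ih => simp [cups, ih]

theorem caps_append (s t : List Strand) :
    caps (s ++ t) = whisker (dualRow t) (caps s) t ++ caps t := by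
  induction s with
  | nil => simp [caps]
  | cons x s ih => simp [caps, ih]

theorem cups'_eq (s : List Strand) : cups' s = cups (dualRow s) := by
  induction s with
  | nil => rfl
  | cons x s ih => simp [cups', cups_append, ih, cups]

theorem caps'_eq (s : List Strand) : caps' s = caps (dualRow s) := by
  induction s with
  | nil => rfl
  | cons x s ih => simp [caps', caps_append, ih, caps]

theorem isPath_cups (s : List Strand) : IsPath [] (cups s) (s ++ dualRow s) := by
  induction s with
  | nil => simp [cups]
  | cons x s ih =>
    simpa [cups, Slice.src, Slice.tgt, Gen.src, Gen.tgt] using ih.whisker [x] [x.dual]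

theorem isPath_caps (s : List Strand) : IsPath (dualRow s ++ s) (caps s) [] := by
  induction s with
  | nil => simp [caps]
  | cons x s ih => simpa [caps, Slice.src, Slice.tgt, Gen.src, Gen.tgt] using ih

/-- The rotation of a diagram from `s` to `t` by half a turn: its bottom strands are bent to the
right and its top strands to the left. -/
def rotW (s t : List Strand) (w : Word) : Word :=
  whisker (dualRow t) (cups s) [] ++ whisker (dualRow t) w (dualRow s) ++
    whisker [] (caps t) (dualRow s)

/-- The rotation of a diagram from `s` to `t` by half a turn in the other direction. -/
def rotW' (s t : List Strand) (w : Word) : Word :=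
  whisker [] (cups (dualRow s)) (dualRow t) ++ whisker (dualRow s) w (dualRow t) ++
    whisker (dualRow s) (caps (dualRow t)) []

theorem Gen.rot_eq (g : Gen) : g.rot = rotW g.src g.tgt [⟨[], g, []⟩] := by
  simp [Gen.rot, rotW]

theorem Gen.rot'_eq (g : Gen) : g.rot' = rotW' g.src g.tgt [⟨[], g, []⟩] := by
  simp [Gen.rot', rotW', cups'_eq, caps'_eq]

theorem IsPath.rotW {s t : List Strand} {w : Word} (h : IsPath s w t) :
    IsPath (dualRow t) (rotW s t w) (dualRow s) := by
  refine IsPath.append (r := dualRow t ++ t ++ dualRow s)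
    (IsPath.append (r := dualRow t ++ s ++ dualRow s) ?_ ?_) ?_
  · simpa using (isPath_cups s).whisker (dualRow t) []
  · simpa using h.whisker (dualRow t) (dualRow s)
  · simpa using (isPath_caps t).whisker [] (dualRow s)

theorem IsPath.rotW' {s t : List Strand} {w : Word} (h : IsPath s w t) :
    IsPath (dualRow t) (rotW' s t w) (dualRow s) := by
  refine IsPath.append (r := dualRow s ++ t ++ dualRow t)
    (IsPath.append (r := dualRow s ++ s ++ dualRow t) ?_ ?_) ?_
  · simpa using (isPath_cups (dualRow s)).whisker [] (dualRow t)
  · simpa using h.whisker (dualRow s) (dualRow t)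
  · simpa using (isPath_caps (dualRow t)).whisker (dualRow s) []

/-- All vertices of a diagram, and all strands to their left and right, are those of a web. -/
def SlicesOK (n : ℕ) (w : Word) : Prop := ∀ σ ∈ w, Slice.OK n σ

section

variable {n : ℕ}

@[simp] theorem slicesOK_nil : SlicesOK n [] := by simp [SlicesOK]

@[simp] theorem slicesOK_cons {σ : Slice} {w : Word} :
    SlicesOK n (σ :: w) ↔ σ.OK n ∧ SlicesOK n w := by simp [SlicesOK]

@[simp] theorem slicesOK_append {u v : Word} :
    SlicesOK n (u ++ v) ↔ SlicesOK n u ∧ SlicesOK n v := List.forall_mem_append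

theorem slicesOK_whisker {a b : List Strand} {w : Word} (h : w ≠ []) :
    SlicesOK n (whisker a w b) ↔ RowOK n a ∧ SlicesOK n w ∧ RowOK n b := by
  induction w with
  | nil => exact absurd rfl h
  | cons σ w ih =>
    by_cases hw : w = []
    · subst hw
      simp [Slice.OK]; tauto
    · simp [Slice.OK, ih hw]; tauto

theorem SlicesOK.whisker {a b : List Strand} {w : Word} (ha : RowOK n a) (hw : SlicesOK n w)
    (hb : RowOK n b) : SlicesOK n (whisker a w b) := by
  by_cases h : w = []
  · simp [h]
  · exact (slicesOK_whisker h).2 ⟨ha, hw, hb⟩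

theorem isWeb_iff {s t : List Strand} {w : Word} :
    IsWeb n s w t ↔ RowOK n s ∧ SlicesOK n w ∧ IsPath s w t := by
  constructor
  · rintro ⟨h1, -, h3, h4⟩; exact ⟨h1, h3, h4⟩
  · rintro ⟨h1, h3, h4⟩
    refine ⟨h1, ?_, h3, h4⟩
    induction w generalizing s with
    | nil => rw [← isPath_nil.1 h4]; exact h1
    | cons σ w ih =>
      rw [slicesOK_cons] at h3
      exact ih h3.1.tgt h3.2 h4.2

theorem slicesOK_cups {s : List Strand} (h : RowOK n s) : SlicesOK n (cups s) := by
  induction s with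
  | nil => simp [cups]
  | cons x s ih =>
    rw [rowOK_cons] at h
    simp only [cups, slicesOK_cons]
    exact ⟨by simp [Slice.OK, Gen.OK, h.1],
      (ih h.2).whisker (by simp [h.1]) (by simp [h.1])⟩

theorem slicesOK_caps {s : List Strand} (h : RowOK n s) : SlicesOK n (caps s) := by
  induction s with
  | nil => simp [caps]
  | cons x s ih =>
    rw [rowOK_cons] at h
    simp only [caps, slicesOK_cons]
    exact ⟨by simp [Slice.OK, Gen.OK, h.1, h.2], ih h.2⟩

theorem SlicesOK.rotW {s t : List Strand} {w : Word} (hs : RowOK n s) (ht : RowOK n t)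
    (h : SlicesOK n w) : SlicesOK n (rotW s t w) := by
  simp only [SLWeb.rotW, slicesOK_append]
  exact ⟨⟨(slicesOK_cups hs).whisker (by simp [ht]) (by simp),
    h.whisker (by simp [ht]) (by simp [hs])⟩,
    (slicesOK_caps ht).whisker (by simp) (by simp [hs])⟩

theorem SlicesOK.rotW' {s t : List Strand} {w : Word} (hs : RowOK n s) (ht : RowOK n t)
    (h : SlicesOK n w) : SlicesOK n (rotW' s t w) := by
  simp only [SLWeb.rotW', slicesOK_append]
  exact ⟨⟨(slicesOK_cups (by simpa)).whisker (by simp) (by simp [ht]),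
    h.whisker (by simp [hs]) (by simp [ht])⟩,
    (slicesOK_caps (by simpa)).whisker (by simp [hs]) (by simp)⟩

theorem IsWeb.rotW {s t : List Strand} {w : Word} (h : IsWeb n s w t) :
    IsWeb n (dualRow t) (rotW s t w) (dualRow s) :=
  isWeb_iff.2 ⟨by simp [h.2.1], SlicesOK.rotW h.1 h.2.1 h.2.2.1, h.2.2.2.rotW⟩

theorem IsWeb.rotW' {s t : List Strand} {w : Word} (h : IsWeb n s w t) :
    IsWeb n (dualRow t) (rotW' s t w) (dualRow s) :=
  isWeb_iff.2 ⟨by simp [h.2.1], SlicesOK.rotW' h.1 h.2.1 h.2.2.1, h.2.2.2.rotW'⟩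

theorem isPath_gen (g : Gen) : IsPath g.src [⟨[], g, []⟩] g.tgt := by
  simp [Slice.src, Slice.tgt]

theorem isWeb_gen {g : Gen} (h : g.OK n) : IsWeb n g.src [⟨[], g, []⟩] g.tgt :=
  isWeb_iff.2 ⟨h.src, by simp [Slice.OK, h], isPath_gen g⟩

theorem Gen.OK_of_slicesOK_rot {g : Gen} (h : SlicesOK n g.rot) : g.OK n := by
  rw [Gen.rot_eq, SLWeb.rotW] at h
  simp [Slice.OK] at h
  exact h.2.1.2.1

theorem Isotopy.placeable {x : Lin} (hx : Isotopy x) : Placeable n x := by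
  cases hx with
  | exchange g h b =>
    refine placeable_sub (s := g.src ++ b ++ h.src) (t := g.tgt ++ b ++ h.tgt) (by simp)
      (by simp [Slice.src, Slice.tgt]) ?_
    simp only [isWeb_iff, slicesOK_cons, Slice.OK, isPath_cons, Slice.src, Slice.tgt,
      rowOK_append, isPath_nil]
    rintro ⟨h1, ⟨⟨-, h2, -, -⟩, ⟨-, h3, -⟩, -⟩, -⟩
    have := h2.src; have := h3.tgt
    simp_all
  | zigzag x =>
    exact placeable_sub (s := [x]) (t := [x]) (by simp)
      (by simp [Slice.src, Slice.tgt, Gen.src, Gen.tgt]) fun h => IsWeb.refl h.1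
  | zigzag' x =>
    exact placeable_sub (s := [x]) (t := [x]) (by simp)
      (by simp [Slice.src, Slice.tgt, Gen.src, Gen.tgt]) fun h => IsWeb.refl h.1
  | rotate g =>
    refine placeable_sub (s := dualRow g.tgt) (t := dualRow g.src) (by simp [Gen.rot]) ?_ ?_
    · rw [Gen.rot_eq]; exact (isPath_gen g).rotW
    · intro h
      rw [Gen.rot'_eq]
      exact (isWeb_gen (Gen.OK_of_slicesOK_rot h.2.2.1)).rotW'

end

/-- To bound the consequences of placeable relations it suffices to consider each relation
inserted at a place that fits its boundary. -/
theorem relations_le {n : ℕ} {R : Set Lin} {s t : List Strand} (hR : ∀ x ∈ R, Placeable n x)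
    {N : Submodule K Lin}
    (h : ∀ u v a b x s' t', (Isotopy x ∨ x ∈ R) → x ∈ Hom n s' t' →
      IsWeb n s u (a ++ s' ++ b) → IsWeb n (a ++ t' ++ b) v t → insert u v a b x ∈ N) :
    relations n R s t ≤ N := by
  refine Submodule.span_le.2 ?_
  rintro y ⟨hy, u, v, a, b, x, hx, rfl⟩
  have hp : Placeable n x := hx.elim Isotopy.placeable (hR x)
  rcases hp.of_insert_mem hy with rfl | ⟨s', t', h1, h2, h3⟩
  · simp
  · exact h u v a b x s' t' hx h1 h2 h3

/-! ### An algebra of webs modulo relations -/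

variable (n : ℕ) (R : Set Lin)

open Classical in
/-- The part of a linear combination of diagrams that consists of webs from `s` to `t`. -/
def webPart (s t : List Strand) : Lin →ₗ[K] Lin :=
  (Finsupp.supported K K {w | IsWeb n s w t}).subtype ∘ₗ
    Finsupp.restrictDom K K {w | IsWeb n s w t}

/-- Linear combinations of diagrams whose web part vanishes modulo the relations. -/
def nullWebs (s t : List Strand) : Submodule K Lin := (relations n R s t).comap (webPart n s t)

/-- The space of webs from `s` to `t` modulo relations. -/
def WebSpace (s t : List Strand) : Type := Lin ⧸ nullWebs n R s t

instance (s t : List Strand) : AddCommGroup (WebSpace n R s t) :=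
  Submodule.Quotient.addCommGroup (nullWebs n R s t)

instance (s t : List Strand) : Module K (WebSpace n R s t) :=
  Submodule.Quotient.module (nullWebs n R s t)

/-- The class of a linear combination of diagrams modulo relations. -/
def cls (s t : List Strand) : Lin →ₗ[K] WebSpace n R s t := (nullWebs n R s t).mkQ

/-- Endomorphisms of the product of all spaces of webs modulo relations. Webs act on this product
by composition, so it contains the linear category of webs modulo relations as a ring with
idempotents for the objects. Products of webs which do not fit together are zero, and diagrams can
be computed with as ring elements without any bookkeeping of boundaries. -/
abbrev Alg : Type := Module.End K (∀ s t : List Strand, WebSpace n R s t)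

variable {n R}

theorem webPart_of_mem {s t : List Strand} {x : Lin} (hx : x ∈ Hom n s t) :
    webPart n s t x = x := by
  have := mem_Hom.1 hx
  simp only [webPart, LinearMap.comp_apply, Submodule.subtype_apply]
  rw [Finsupp.restrictDom_apply, Finsupp.filter_eq_self_iff]
  exact this

theorem webPart_single_of_not {s t : List Strand} {w : Word} (h : ¬ IsWeb n s w t) (c : K) :
    webPart n s t (Finsupp.single w c) = 0 := by
  simp only [webPart, LinearMap.comp_apply, Submodule.subtype_apply]
  rw [Finsupp.restrictDom_apply, Finsupp.filter_single_of_neg]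
  exact h

theorem single_mem_Hom {s t : List Strand} {w : Word} (h : IsWeb n s w t) (c : K) :
    Finsupp.single w c ∈ Hom n s t := Finsupp.single_mem_supported K c h

/-- Composition with a diagram at the bottom. -/
def below (w : Word) : Lin →ₗ[K] Lin := Finsupp.lmapDomain K K fun w' => w ++ w'

@[simp] theorem below_single (w w' : Word) (c : K) :
    below w (Finsupp.single w' c) = Finsupp.single (w ++ w') c := by
  simp [below, Finsupp.lmapDomain_apply, Finsupp.mapDomain_single]

theorem below_eq_insert (w : Word) (x : Lin) : below w x = insert w [] [] [] x := by
  induction x using Finsupp.induction_linear with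
  | zero => simp
  | add x y hx hy => simp only [map_add, hx, hy]
  | single w' c => simp

theorem webPart_below {s r t : List Strand} {w : Word} (hw : IsWeb n s w r) (x : Lin) :
    webPart n s t (below w x) = below w (webPart n r t x) := by
  induction x using Finsupp.induction_linear with
  | zero => simp
  | add x y hx hy => simp only [map_add, hx, hy]
  | single w' c =>
    by_cases h : IsWeb n r w' t
    · rw [webPart_of_mem (single_mem_Hom h c), below_single,
        webPart_of_mem (single_mem_Hom (hw.append h) c)]
    · rw [webPart_single_of_not h, below_single, webPart_single_of_not, map_zero]
      intro h'
      obtain ⟨r', h1, h2⟩ := isWeb_append.1 h'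
      rw [h1.2.2.2.unique hw.2.2.2] at h2
      exact h h2

theorem below_mem_nullWebs {s r t : List Strand} {w : Word} (hw : IsWeb n s w r) {x : Lin}
    (hx : x ∈ nullWebs n R r t) : below w x ∈ nullWebs n R s t := by
  rw [nullWebs, Submodule.mem_comap, webPart_below hw, below_eq_insert]
  by_cases ht : RowOK n t
  · exact insert_mem_relations hx (by simpa using hw) (by simpa using IsWeb.refl ht)
  · have : webPart n r t x = 0 := by
      ext w
      by_contra h
      exact ht (mem_Hom.1 (relations_le_Hom hx) w h).2.1
    simp [this]

end

noncomputable section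

variable {n : ℕ} {R : Set Lin}

theorem cls_surjective (s t : List Strand) : Function.Surjective (cls n R s t) :=
  Submodule.mkQ_surjective _

theorem cls_eq_zero {s t : List Strand} {x : Lin} : cls n R s t x = 0 ↔ x ∈ nullWebs n R s t :=
  Submodule.Quotient.mk_eq_zero _

/-- Composition with a web at the bottom, modulo relations. -/
def belowMap {s t : List Strand} {w : Word} (h : IsWeb n s w t) (t' : List Strand) :
    WebSpace n R t t' →ₗ[K] WebSpace n R s t' :=
  Submodule.mapQ (nullWebs n R t t') (nullWebs n R s t') (below w)
    fun _ hx => below_mem_nullWebs h hx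

open Classical in
/-- The element of the algebra given by a diagram from `s` to `t`; it is zero if the diagram is not
a web from `s` to `t`. -/
def act (n : ℕ) (R : Set Lin) (s : List Strand) (w : Word) (t : List Strand) : Alg n R :=
  if h : IsWeb n s w t then
    LinearMap.single K (fun s => ∀ t, WebSpace n R s t) s ∘ₗ
      LinearMap.pi (fun t' => belowMap (R := R) h t' ∘ₗ LinearMap.proj t') ∘ₗ LinearMap.proj t
  else 0

theorem act_eq_zero {s t : List Strand} {w : Word} (h : ¬ IsWeb n s w t) :
    act n R s w t = 0 := dif_neg h

open Classical in
theorem act_mk {s t : List Strand} {w : Word} (h : IsWeb n s w t)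
    (y : List Strand → List Strand → Lin) :
    act n R s w t (fun s t => cls n R s t (y s t)) =
      Pi.single s fun t' => cls n R s t' (below w (y t t')) := by
  rw [act, dif_pos h]
  rfl

theorem alg_ext {f g : Alg n R}
    (h : ∀ y : List Strand → List Strand → Lin,
      f (fun s t => cls n R s t (y s t)) =
        g fun s t => cls n R s t (y s t)) : f = g := by
  refine LinearMap.ext fun v => ?_
  have : ∀ s t, ∃ y, cls n R s t y = v s t :=
    fun s t => cls_surjective s t _
  choose y hy using this
  have e : v = fun s t => cls n R s t (y s t) := by
    funext s t; rw [hy]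
  rw [e, h]

theorem below_below (u v : Word) (x : Lin) : below u (below v x) = below (u ++ v) x := by
  induction x using Finsupp.induction_linear with
  | zero => simp
  | add x y hx hy => simp only [map_add, hx, hy]
  | single w' c => simp

open Classical in
theorem single_mk (s : List Strand) (z : List Strand → Lin) :
    (Pi.single s fun t' => cls n R s t' (z t') :
      ∀ s t, WebSpace n R s t) = fun s' t' => cls n R s' t'
        ((Pi.single s z : List Strand → List Strand → Lin) s' t') := by
  funext s' t'
  by_cases h : s' = s
  · subst h; simp
  · simp [Pi.single_eq_of_ne h]

theorem act_mul_act {s r t : List Strand} {u v : Word} (hu : IsWeb n s u r)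
    (hv : IsWeb n r v t) : act n R s u r * act n R r v t = act n R s (u ++ v) t := by
  classical
  refine alg_ext fun y => ?_
  rw [Module.End.mul_apply, act_mk hv, act_mk (hu.append hv), single_mk, act_mk hu]
  simp [below_below]

/-- The idempotent of a row of strands. -/
def idem (n : ℕ) (R : Set Lin) (s : List Strand) : Alg n R := act n R s [] s

/-- The element of the algebra given by the elementary piece `g` between the vertical strands `a`
and `b`. -/
def piece (n : ℕ) (R : Set Lin) (a : List Strand) (g : Gen) (b : List Strand) : Alg n R :=
  act n R (a ++ g.src ++ b) [⟨a, g, b⟩] (a ++ g.tgt ++ b)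

/-- The element of the algebra given by the diagram `w` between the vertical strands `a` and
`b`. -/
def ev (n : ℕ) (R : Set Lin) (a : List Strand) (w : Word) (b : List Strand) : Alg n R :=
  (w.map fun σ => piece n R (a ++ σ.left) σ.gen (σ.right ++ b)).prod

@[simp] theorem ev_nil (a b : List Strand) : ev n R a [] b = 1 := rfl

theorem ev_cons (a b : List Strand) (σ : Slice) (w : Word) :
    ev n R a (σ :: w) b = piece n R (a ++ σ.left) σ.gen (σ.right ++ b) * ev n R a w b := by
  simp [ev]

theorem ev_append (a b : List Strand) (u v : Word) :
    ev n R a (u ++ v) b = ev n R a u b * ev n R a v b := by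
  simp [ev]

theorem ev_whisker (a b a' b' : List Strand) (w : Word) :
    ev n R a (whisker a' w b') b = ev n R (a ++ a') w (b' ++ b) := by
  simp only [ev, whisker, List.map_map]
  congr 1
  refine List.map_congr_left fun σ _ => ?_
  simp

theorem idem_mul_act (s t : List Strand) (w : Word) :
    idem n R s * act n R s w t = act n R s w t := by
  by_cases h : IsWeb n s w t
  · rw [idem, act_mul_act (IsWeb.refl h.1) h, List.nil_append]
  · rw [act_eq_zero h, mul_zero]

theorem act_mul_idem (s t : List Strand) (w : Word) :
    act n R s w t * idem n R t = act n R s w t := by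
  by_cases h : IsWeb n s w t
  · rw [idem, act_mul_act h (IsWeb.refl h.2.1), List.append_nil]
  · rw [act_eq_zero h, zero_mul]

theorem idem_mul_idem (s : List Strand) : idem n R s * idem n R s = idem n R s :=
  act_mul_idem ..

theorem idem_eq_zero {s : List Strand} (h : ¬ RowOK n s) : idem n R s = 0 :=
  act_eq_zero fun h' => h h'.1

theorem piece_eq_zero {a b : List Strand} {g : Gen} (h : ¬ (RowOK n a ∧ g.OK n ∧ RowOK n b)) :
    piece n R a g b = 0 := by
  refine act_eq_zero fun h' => h ?_
  have := (isWeb_cons.1 h').2.1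
  exact this

theorem idem_mul_piece {s a b : List Strand} {g : Gen} (h : s = a ++ g.src ++ b) :
    idem n R s * piece n R a g b = piece n R a g b := by
  subst h; exact idem_mul_act ..

theorem piece_mul_idem {t a b : List Strand} {g : Gen} (h : t = a ++ g.tgt ++ b) :
    piece n R a g b * idem n R t = piece n R a g b := by
  subst h; exact act_mul_idem ..

theorem idem_mul_ev {s t : List Strand} {w : Word} (h : IsWeb n s w t) :
    idem n R s * ev n R [] w [] = act n R s w t := by
  induction w generalizing s with
  | nil => rw [isWeb_nil] at h; rw [ev_nil, mul_one, ← h.2]; rfl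
  | cons σ w ih =>
    rw [isWeb_cons] at h
    obtain ⟨rfl, hσ, hw⟩ := h
    have hσ' : IsWeb n σ.src [σ] σ.tgt := isWeb_cons.2 ⟨rfl, hσ, IsWeb.refl hσ.tgt⟩
    have e : (piece n R ([] ++ σ.left) σ.gen (σ.right ++ []) : Alg n R) =
        act n R σ.src [σ] σ.tgt := by
      simp [piece, Slice.src, Slice.tgt]
    rw [ev_cons, e, ← mul_assoc, idem_mul_act, ← act_mul_idem, mul_assoc, ih hw,
      act_mul_act hσ' hw]
    rfl

/-- A diagram absorbs the idempotents of its boundary; the empty diagram is a unit, which merely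
commutes with them. -/
theorem idem_mul_ev_comm {s t a b : List Strand} {w : Word} (h : IsPath s w t) :
    idem n R (a ++ s ++ b) * ev n R a w b = ev n R a w b * idem n R (a ++ t ++ b) := by
  induction w generalizing s with
  | nil => rw [isPath_nil] at h; simp [h]
  | cons σ w ih =>
    rw [isPath_cons] at h
    rw [ev_cons, ← mul_assoc, idem_mul_piece (by simp [h.1, Slice.src]), mul_assoc, ← ih h.2,
      ← mul_assoc, piece_mul_idem (by simp [Slice.tgt])]

theorem idem_mul_ev_of_ne_nil {s t a b : List Strand} {w : Word} (h : IsPath s w t)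
    (hw : w ≠ []) : idem n R (a ++ s ++ b) * ev n R a w b = ev n R a w b := by
  cases w with
  | nil => exact absurd rfl hw
  | cons σ w =>
    rw [isPath_cons] at h
    rw [ev_cons, ← mul_assoc, idem_mul_piece (by simp [h.1, Slice.src])]

theorem ev_mul_idem_of_ne_nil {s t a b : List Strand} {w : Word} (h : IsPath s w t)
    (hw : w ≠ []) : ev n R a w b * idem n R (a ++ t ++ b) = ev n R a w b := by
  rw [← idem_mul_ev_comm h, idem_mul_ev_of_ne_nil h hw]

/-- Linear extension of `ev`. -/
def evL (n : ℕ) (R : Set Lin) (a b : List Strand) : Lin →ₗ[K] Alg n R :=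
  Finsupp.linearCombination K fun w => ev n R a w b

@[simp] theorem evL_dg (a b : List Strand) (w : Word) : evL n R a b (dg w) = ev n R a w b := by
  simp [evL, dg]

theorem evL_insert (a b : List Strand) (x : Lin) :
    evL n R [] [] (insert [] [] a b x) = evL n R a b x := by
  induction x using Finsupp.induction_linear with
  | zero => simp
  | add x y hx hy => simp only [map_add, hx, hy]
  | single w c => simp [evL, ev_whisker]

/-- Linear extension of `act`. -/
def actL (n : ℕ) (R : Set Lin) (s t : List Strand) : Lin →ₗ[K] Alg n R :=
  Finsupp.linearCombination K fun w => act n R s w t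

theorem idem_mul_evL {s t : List Strand} {x : Lin} (hx : x ∈ Hom n s t) :
    idem n R s * evL n R [] [] x = actL n R s t x := by
  refine Hom_induction (p := fun x => idem n R s * evL n R [] [] x = actL n R s t x) (by simp)
    (fun x y hx hy => ?_) (fun c x hx => ?_) (fun w hw => ?_) hx
  · simp only [map_add, mul_add, hx, hy]
  · simp only [map_smul, mul_smul_comm, hx]
  · rw [evL_dg, idem_mul_ev hw]; simp [actL, dg]

theorem relations_le_nullWebs {s t : List Strand} : relations n R s t ≤ nullWebs n R s t := by
  intro x hx
  rw [nullWebs, Submodule.mem_comap, webPart_of_mem (relations_le_Hom hx)]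
  exact hx

/-- The composition of linear combinations of diagrams, `x` below `y`. -/
def compose (x y : Lin) : Lin := Finsupp.linearCombination K (fun w => below w y) x

theorem compose_mem_nullWebs {s t t' : List Strand} {x : Lin} (hx : x ∈ relations n R s t)
    (y : Lin) : compose x y ∈ nullWebs n R s t' := by
  induction y using Finsupp.induction_linear with
  | zero => simp [compose, Finsupp.linearCombination_apply]
  | add y z hy hz =>
    have : compose x (y + z) = compose x y + compose x z := by
      simp [compose, Finsupp.linearCombination_apply, Finsupp.sum_add]
    rw [this]; exact Submodule.add_mem _ hy hz
  | single w c =>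
    have : ∀ x, compose x (Finsupp.single w c) = c • insert [] w [] [] x := by
      intro x
      induction x using Finsupp.induction_linear with
      | zero => simp [compose]
      | add x y hx hy =>
        simp only [compose] at hx hy
        simp only [compose, map_add, smul_add, hx, hy]
      | single w' c' => simp [compose, mul_comm]
    rw [this]
    refine Submodule.smul_mem _ _ ?_
    by_cases hw : IsWeb n t w t'
    · by_cases hs : RowOK n s
      · exact relations_le_nullWebs
          (insert_mem_relations hx (by simpa using IsWeb.refl hs) (by simpa using hw))
      · have : x = 0 := by
          ext w
          by_contra h
          exact hs (mem_Hom.1 (relations_le_Hom hx) w h).1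
        simp [this]
    · rw [nullWebs, Submodule.mem_comap]
      have : webPart n s t' (insert [] w [] [] x) = 0 := by
        refine Hom_induction (p := fun x => webPart n s t' (insert [] w [] [] x) = 0)
          (by simp) (fun x y hx hy => by simp only [map_add, hx, hy, add_zero])
          (fun c x hx => by simp only [map_smul, hx, smul_zero]) (fun w' hw' => ?_)
          (relations_le_Hom hx)
        rw [insert_dg]
        refine webPart_single_of_not (fun h => hw ?_) 1
        simp only [List.nil_append, whisker_empty] at h
        obtain ⟨r, h1, h2⟩ := isWeb_append.1 h
        rwa [h1.2.2.2.unique hw'.2.2.2] at h2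
      rw [this]
      exact Submodule.zero_mem _

open Classical in
theorem actL_mk {s t : List Strand} {x : Lin} (hx : x ∈ Hom n s t)
    (y : List Strand → List Strand → Lin) :
    actL n R s t x (fun s t => cls n R s t (y s t)) =
      Pi.single s fun t' => cls n R s t' (compose x (y t t')) := by
  simp only [single_mk]
  refine Hom_induction (p := fun x => actL n R s t x (fun s t => cls n R s t (y s t)) =
      fun s' t' => cls n R s' t' ((Pi.single s fun t' => compose x (y t t') :
        List Strand → List Strand → Lin) s' t'))
    ?_ (fun x y hx hy => ?_) (fun c x hx => ?_) (fun w hw => ?_) hx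
  · funext s' t'
    by_cases h : s' = s
    · subst h; simp [compose]
    · simp [Pi.single_eq_of_ne h]
  · rw [map_add, LinearMap.add_apply, hx, hy]
    funext s' t'
    by_cases h : s' = s
    · subst h; simp [compose]
    · simp [Pi.single_eq_of_ne h]
  · rw [map_smul, LinearMap.smul_apply, hx]
    funext s' t'
    by_cases h : s' = s
    · subst h; simp [compose]
    · simp [Pi.single_eq_of_ne h]
  · have : actL n R s t (dg w) = act n R s w t := by simp [actL, dg]
    rw [this, act_mk hw, single_mk]
    simp [compose, dg]

/-- A linear combination of webs is a consequence of the relations if and only if its element of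
the algebra is zero. -/
theorem actL_eq_zero_iff {s t : List Strand} {x : Lin} (hx : x ∈ Hom n s t) :
    actL n R s t x = 0 ↔ x ∈ relations n R s t := by
  classical
  constructor
  · intro h
    have := congrFun (congrFun (congrArg (fun f : Alg n R => f fun s' t' =>
      cls n R s' t' (if s' = t ∧ t' = t then dg [] else 0)) h) s) t
    simp only [actL_mk hx (fun s' t' => if s' = t ∧ t' = t then dg [] else 0), Pi.single_eq_same,
      and_self, if_true, LinearMap.zero_apply, Pi.zero_apply] at this
    have e : compose x (dg []) = x := by
      clear * -
      induction x using Finsupp.induction_linear with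
      | zero => simp [compose]
      | add x y hx hy =>
        simp only [compose] at hx hy
        simp only [compose, map_add, hx, hy]
      | single w' c' => simp [compose, dg]
    rw [e, cls_eq_zero, nullWebs, Submodule.mem_comap,
      webPart_of_mem hx] at this
    exact this
  · intro h
    refine alg_ext fun y => ?_
    rw [actL_mk hx]
    funext s' t'
    by_cases hs : s' = s
    · subst hs
      simpa [cls_eq_zero] using compose_mem_nullWebs h _
    · simp [Pi.single_eq_of_ne hs]

theorem mem_relations_of_evL {s t : List Strand} {x : Lin} (hx : x ∈ Hom n s t)
    (h : idem n R s * evL n R [] [] x = 0) : x ∈ relations n R s t := by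
  rwa [idem_mul_evL hx, actL_eq_zero_iff hx] at h

theorem idem_mul_evL_eq_zero {s t : List Strand} {x : Lin} (hx : x ∈ relations n R s t)
    (a b : List Strand) : idem n R (a ++ s ++ b) * evL n R a b x = 0 := by
  by_cases h : RowOK n (a ++ s ++ b)
  · by_cases ht : RowOK n t
    · simp only [rowOK_append] at h
      have h1 : insert [] [] a b x ∈ relations n R (a ++ s ++ b) (a ++ t ++ b) :=
        insert_mem_relations hx (IsWeb.refl (by simp [h])) (IsWeb.refl (by simp [h, ht]))
      rw [← evL_insert, idem_mul_evL (relations_le_Hom h1),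
        (actL_eq_zero_iff (relations_le_Hom h1)).2 h1]
    · have : x = 0 := by
        ext w
        by_contra h
        exact ht (mem_Hom.1 (relations_le_Hom hx) w h).2.1
      simp [this]
  · rw [idem_eq_zero h, zero_mul]

/-- Two diagrams are equal modulo the relations if they are in the algebra. -/
theorem sub_mem_relations {s t : List Strand} {w w' : Word} (hw : IsWeb n s w t)
    (hw' : IsWeb n s w' t)
    (h : idem n R s * ev n R [] w [] = idem n R s * ev n R [] w' []) :
    dg w - dg w' ∈ relations n R s t := by
  refine mem_relations_of_evL (Submodule.sub_mem _ (dg_mem_Hom hw) (dg_mem_Hom hw')) ?_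
  rw [map_sub, evL_dg, evL_dg, mul_sub, h, sub_self]

theorem idem_mul_ev_congr {s t : List Strand} {w w' : Word}
    (h : dg w - dg w' ∈ relations n R s t) (a b : List Strand) :
    idem n R (a ++ s ++ b) * ev n R a w b = idem n R (a ++ s ++ b) * ev n R a w' b := by
  have := idem_mul_evL_eq_zero h a b
  rwa [map_sub, evL_dg, evL_dg, mul_sub, sub_eq_zero] at this

end

noncomputable section

variable {n : ℕ} {R : Set Lin}

/-! ### Planar isotopy in the algebra -/

/-- Vertices side by side can be moved past each other in height. -/
theorem piece_exchange (g h : Gen) (a b c : List Strand) :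
    piece n R a g (b ++ h.src ++ c) * piece n R (a ++ g.tgt ++ b) h c =
      piece n R (a ++ g.src ++ b) h c * piece n R a g (b ++ h.tgt ++ c) := by
  by_cases H : RowOK n a ∧ g.OK n ∧ RowOK n b ∧ h.OK n ∧ RowOK n c
  · obtain ⟨-, hg, hb, hh, -⟩ := H
    have hs := hg.src
    have ht := hg.tgt
    have hs' := hh.src
    have ht' := hh.tgt
    have h1 : IsWeb n (g.src ++ b ++ h.src) [⟨[], g, b ++ h.src⟩, ⟨g.tgt ++ b, h, []⟩]
        (g.tgt ++ b ++ h.tgt) := isWeb_iff.2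
      ⟨by simp [*], by simp [Slice.OK, *], by simp [Slice.src, Slice.tgt]⟩
    have h2 : IsWeb n (g.src ++ b ++ h.src) [⟨g.src ++ b, h, []⟩, ⟨[], g, b ++ h.tgt⟩]
        (g.tgt ++ b ++ h.tgt) := isWeb_iff.2
      ⟨by simp [*], by simp [Slice.OK, *], by simp [Slice.src, Slice.tgt]⟩
    have := idem_mul_ev_congr (R := R) (mem_relations_of_mem (Or.inl (Isotopy.exchange g h b))
      (Submodule.sub_mem _ (dg_mem_Hom h1) (dg_mem_Hom h2))) a c
    rw [idem_mul_ev_of_ne_nil h1.2.2.2 (by simp), idem_mul_ev_of_ne_nil h2.2.2.2 (by simp)]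
      at this
    simpa [ev_cons] using this
  · have e1 : piece n R a g (b ++ h.src ++ c) * piece n R (a ++ g.tgt ++ b) h c = 0 := by
      by_cases H1 : RowOK n a ∧ g.OK n ∧ RowOK n (b ++ h.src ++ c)
      · rw [piece_eq_zero (g := h), mul_zero]
        simp only [rowOK_append] at H1 ⊢
        tauto
      · rw [piece_eq_zero H1, zero_mul]
    have e2 : piece n R (a ++ g.src ++ b) h c * piece n R a g (b ++ h.tgt ++ c) = 0 := by
      by_cases H1 : RowOK n (a ++ g.src ++ b) ∧ h.OK n ∧ RowOK n c
      · rw [piece_eq_zero (g := g), mul_zero]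
        simp only [rowOK_append] at H1 ⊢
        tauto
      · rw [piece_eq_zero H1, zero_mul]
    rw [e1, e2]

/-- Diagrams which are next to each other can be moved past each other. -/
theorem ev_exchange {s t s' t' : List Strand} {w w' : Word} (h : IsPath s w t)
    (h' : IsPath s' w' t') (a b c : List Strand) :
    ev n R a w (b ++ s' ++ c) * ev n R (a ++ t ++ b) w' c =
      ev n R (a ++ s ++ b) w' c * ev n R a w (b ++ t' ++ c) := by
  induction w' generalizing s' with
  | nil => rw [isPath_nil] at h'; simp [isPath_nil.1 h']
  | cons τ w' ih' =>
    rw [isPath_cons] at h'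
    have key : ev n R a w (b ++ s' ++ c) * piece n R (a ++ t ++ b ++ τ.left) τ.gen (τ.right ++ c) =
        piece n R (a ++ s ++ b ++ τ.left) τ.gen (τ.right ++ c) *
          ev n R a w (b ++ τ.tgt ++ c) := by
      clear ih'
      induction w generalizing s with
      | nil => simp [isPath_nil.1 h]
      | cons σ w ih =>
        rw [isPath_cons] at h
        rw [ev_cons, mul_assoc, ih h.2, ev_cons, ← mul_assoc, ← mul_assoc]
        congr 1
        have := piece_exchange (n := n) (R := R) σ.gen τ.gen (a ++ σ.left)
          (σ.right ++ b ++ τ.left) (τ.right ++ c)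
        simpa [h.1, h'.1, Slice.src, Slice.tgt] using this
    rw [ev_cons, ← mul_assoc, key, mul_assoc, ih' h'.2, ← mul_assoc, ev_cons]

theorem piece_ev_exchange {s t : List Strand} {g : Gen} {w : Word} (h : IsPath s w t)
    (a b c : List Strand) :
    piece n R a g (b ++ s ++ c) * ev n R (a ++ g.tgt ++ b) w c =
      ev n R (a ++ g.src ++ b) w c * piece n R a g (b ++ t ++ c) := by
  simpa [ev_cons] using ev_exchange (n := n) (R := R) (isPath_gen g) h a b c

theorem ev_piece_exchange {s t : List Strand} {g : Gen} {w : Word} (h : IsPath s w t)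
    (a b c : List Strand) :
    ev n R a w (b ++ g.src ++ c) * piece n R (a ++ t ++ b) g c =
      piece n R (a ++ s ++ b) g c * ev n R a w (b ++ g.tgt ++ c) := by
  simpa [ev_cons] using ev_exchange (n := n) (R := R) h (isPath_gen g) a b c

/-- The zigzag relation. If the row is not admissible, both sides are zero. -/
theorem cup_mul_cap (x : Strand) (a b : List Strand) :
    piece n R a (.cup x) (x :: b) * piece n R (a ++ [x]) (.cap x.dual) b =
      idem n R (a ++ x :: b) := by
  by_cases H : RowOK n (a ++ x :: b)
  · simp only [rowOK_append, rowOK_cons] at H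
    have h1 : IsWeb n [x] [⟨[], .cup x, [x]⟩, ⟨[x], .cap x.dual, []⟩] [x] := isWeb_iff.2
      ⟨by simp [*], by simp [Slice.OK, Gen.OK, *],
        by simp [Slice.src, Slice.tgt, Gen.src, Gen.tgt]⟩
    have := idem_mul_ev_congr (R := R) (mem_relations_of_mem (Or.inl (Isotopy.zigzag x))
      (Submodule.sub_mem _ (dg_mem_Hom h1) (dg_mem_Hom (IsWeb.refl h1.1)))) a b
    rw [idem_mul_ev_of_ne_nil h1.2.2.2 (by simp)] at this
    simpa [ev_cons] using this
  · rw [idem_eq_zero H, piece_eq_zero, zero_mul]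
    simp only [rowOK_append, rowOK_cons] at H ⊢
    tauto

/-- The mirror image of `cup_mul_cap`. -/
theorem cup_mul_cap' (x : Strand) (a b : List Strand) :
    piece n R (a ++ [x]) (.cup x.dual) b * piece n R a (.cap x) (x :: b) =
      idem n R (a ++ x :: b) := by
  by_cases H : RowOK n (a ++ x :: b)
  · simp only [rowOK_append, rowOK_cons] at H
    have h1 : IsWeb n [x] [⟨[x], .cup x.dual, []⟩, ⟨[], .cap x, [x]⟩] [x] := isWeb_iff.2
      ⟨by simp [*], by simp [Slice.OK, Gen.OK, *],
        by simp [Slice.src, Slice.tgt, Gen.src, Gen.tgt]⟩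
    have := idem_mul_ev_congr (R := R) (mem_relations_of_mem (Or.inl (Isotopy.zigzag' x))
      (Submodule.sub_mem _ (dg_mem_Hom h1) (dg_mem_Hom (IsWeb.refl h1.1)))) a b
    rw [idem_mul_ev_of_ne_nil h1.2.2.2 (by simp)] at this
    simpa [ev_cons] using this
  · rw [idem_eq_zero H, piece_eq_zero, zero_mul]
    simp only [rowOK_append, rowOK_cons, rowOK_nil] at H ⊢
    tauto

theorem piece_eq_ev (g : Gen) (a b : List Strand) :
    piece n R a g b = ev n R a [⟨[], g, []⟩] b := by simp [ev_cons]

theorem ev_rot_gen (g : Gen) (a b : List Strand) :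
    ev n R a (rotW g.src g.tgt [⟨[], g, []⟩]) b = ev n R a (rotW' g.src g.tgt [⟨[], g, []⟩]) b := by
  have p1 := (isPath_gen g).rotW
  have p2 := (isPath_gen g).rotW'
  have n1 : rotW g.src g.tgt [⟨[], g, []⟩] ≠ [] := by simp [rotW]
  have n2 : rotW' g.src g.tgt [⟨[], g, []⟩] ≠ [] := by simp [rotW']
  rw [← idem_mul_ev_of_ne_nil p1 n1, ← idem_mul_ev_of_ne_nil p2 n2]
  by_cases H : g.OK n
  · have h1 := (isWeb_gen H).rotW
    have h2 := (isWeb_gen H).rotW'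
    refine idem_mul_ev_congr (t := dualRow g.src) ?_ a b
    rw [← Gen.rot_eq, ← Gen.rot'_eq] at *
    exact mem_relations_of_mem (Or.inl (Isotopy.rotate g))
      (Submodule.sub_mem _ (dg_mem_Hom h1) (dg_mem_Hom h2))
  · have e : ∀ c d, ev n R c [⟨[], g, []⟩] d = 0 := fun c d => by
      rw [← piece_eq_ev]
      exact piece_eq_zero (by tauto)
    simp only [rotW, rotW', ev_append, ev_whisker, e, mul_zero, zero_mul]

/-- Straightening a family of parallel strands. -/
theorem cups_mul_caps (s a b : List Strand) :
    idem n R (a ++ s ++ b) * (ev n R a (cups s) (s ++ b) * ev n R (a ++ s) (caps s) b) =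
      idem n R (a ++ s ++ b) := by
  induction s generalizing a with
  | nil => simp [cups, caps]
  | cons x s ih =>
    have h1 := ev_piece_exchange (n := n) (R := R) (g := .cap x.dual) (isPath_cups s) (a ++ [x]) []
      (s ++ b)
    have h2 := cup_mul_cap (n := n) (R := R) x a (s ++ b)
    have h3 := ih (a ++ [x])
    simp only [Gen.src, Gen.tgt, List.append_assoc, List.nil_append, List.cons_append,
      List.append_nil, Strand.dual_dual] at h1 h2 h3 ⊢
    simp only [cups, caps, ev_cons, ev_whisker, List.append_assoc, List.cons_append,
      List.nil_append, List.append_nil]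
    rw [mul_assoc, ← mul_assoc (ev n R _ (cups s) _), h1, mul_assoc, ← mul_assoc (piece _ _ _ _ _),
      h2, h3, idem_mul_idem]

theorem cups_mul_caps' (s a b : List Strand) :
    idem n R (a ++ dualRow s ++ b) *
        (ev n R (a ++ dualRow s) (cups s) b * ev n R a (caps s) (dualRow s ++ b)) =
      idem n R (a ++ dualRow s ++ b) := by
  induction s generalizing b with
  | nil => simp [cups, caps]
  | cons x s ih =>
    have h1 := piece_ev_exchange (n := n) (R := R) (g := .cap x.dual) (isPath_cups s)
      (a ++ dualRow s) [] (x.dual :: b)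
    have h2 := cup_mul_cap' (n := n) (R := R) x.dual (a ++ dualRow s) b
    have h3 := ih (x.dual :: b)
    simp only [Gen.src, Gen.tgt, List.append_assoc, List.nil_append,
      List.append_nil, Strand.dual_dual] at h1 h2 h3 ⊢
    simp only [cups, caps, ev_cons, ev_whisker, dualRow_cons, List.append_assoc, List.cons_append,
      List.nil_append, List.append_nil]
    rw [mul_assoc, ← mul_assoc (ev n R _ (cups s) _), ← h1, mul_assoc,
      ← mul_assoc (piece _ _ _ _ _), h2, h3, idem_mul_idem]

/-- Sliding a diagram around nested maxima. -/
theorem ev_rotW_mul_caps {s t : List Strand} {w : Word} (h : IsPath s w t) (a b : List Strand) :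
    idem n R (a ++ dualRow t ++ s ++ b) *
        (ev n R a (rotW s t w) (s ++ b) * ev n R a (caps s) b) =
      idem n R (a ++ dualRow t ++ s ++ b) *
        (ev n R (a ++ dualRow t) w b * ev n R a (caps t) b) := by
  have h1 := ev_exchange (n := n) (R := R) (isPath_caps t) (isPath_caps s) a [] b
  have h2 := ev_exchange (n := n) (R := R) h (isPath_caps s) (a ++ dualRow t) [] b
  have h3 := cups_mul_caps (n := n) (R := R) s (a ++ dualRow t) b
  simp only [List.append_assoc, List.nil_append, List.append_nil] at h1 h2 h3 ⊢
  simp only [rotW, ev_append, ev_whisker, List.append_assoc, List.nil_append, List.append_nil,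
    mul_assoc]
  rw [h1, ← mul_assoc (ev n R _ w _), h2]
  simp only [← mul_assoc] at h3 ⊢
  rw [h3]

/-- A diagram is determined up to isotopy by the result of bending all its strands to the
bottom. -/
theorem ev_eq_rotW {s t : List Strand} {w y : Word}
    (hy : IsPath (dualRow t) y (dualRow s)) {a b : List Strand}
    (h : ∀ b, idem n R (a ++ dualRow t ++ s ++ b) *
        (ev n R a y (s ++ b) * ev n R a (caps s) b) =
      idem n R (a ++ dualRow t ++ s ++ b) *
        (ev n R (a ++ dualRow t) w b * ev n R a (caps t) b)) :
    idem n R (a ++ dualRow t ++ b) * ev n R a y b =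
      idem n R (a ++ dualRow t ++ b) * ev n R a (rotW s t w) b := by
  have h1 := ev_exchange (n := n) (R := R) hy (isPath_cups s) a [] b
  have h3 := cups_mul_caps' (n := n) (R := R) s a b
  have h4 := h (dualRow s ++ b)
  have h5 := idem_mul_ev_comm (n := n) (R := R) (a := a ++ dualRow t) (b := b) (isPath_cups s)
  rw [idem_mul_ev_comm hy, ← h3, ← mul_assoc, ← idem_mul_ev_comm hy]
  simp only [List.append_assoc, List.nil_append, List.append_nil] at h1 h4 h5 ⊢
  simp only [rotW, ev_append, ev_whisker, List.append_assoc, List.nil_append, List.append_nil]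
  rw [mul_assoc, ← mul_assoc (ev n R a y _), h1, ← mul_assoc, ← mul_assoc, h5, mul_assoc,
    mul_assoc, h4]
  simp only [← mul_assoc]
  rw [h5]

end

noncomputable section

variable {n : ℕ} {R : Set Lin}

/-! ### Isotopic webs -/

/-- Two webs from `s` to `t` that are related by planar isotopy. -/
def Iso (n : ℕ) (s t : List Strand) (w w' : Word) : Prop :=
  IsWeb n s w t ∧ IsWeb n s w' t ∧ dg w - dg w' ∈ relations n ∅ s t

namespace Iso

variable {s r t : List Strand} {u v w w' w'' : Word}

theorem of_ev (hw : IsWeb n s w t) (hw' : IsWeb n s w' t)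
    (h : idem n ∅ s * ev n ∅ [] w [] = idem n ∅ s * ev n ∅ [] w' []) : Iso n s t w w' :=
  ⟨hw, hw', sub_mem_relations hw hw' h⟩

theorem sub_mem (h : Iso n s t w w') : dg w - dg w' ∈ relations n R s t :=
  relations_mono (Set.empty_subset R) s t h.2.2

theorem idem_mul_ev (h : Iso n s t w w') (a b : List Strand) :
    idem n R (a ++ s ++ b) * ev n R a w b = idem n R (a ++ s ++ b) * ev n R a w' b :=
  idem_mul_ev_congr h.sub_mem a b

theorem refl (h : IsWeb n s w t) : Iso n s t w w := ⟨h, h, by simp⟩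

theorem symm (h : Iso n s t w w') : Iso n s t w' w :=
  ⟨h.2.1, h.1, by simpa using Submodule.neg_mem _ h.2.2⟩

theorem trans (h : Iso n s t w w') (h' : Iso n s t w' w'') : Iso n s t w w'' :=
  ⟨h.1, h'.2.1, by simpa using Submodule.add_mem _ h.2.2 h'.2.2⟩

theorem insert {a b s' t' : List Strand} (hu : IsWeb n s' u (a ++ s ++ b))
    (hv : IsWeb n (a ++ t ++ b) v t') (h : Iso n s t w w') :
    Iso n s' t' (u ++ whisker a w b ++ v) (u ++ whisker a w' b ++ v) := by
  have ha := hu.2.1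
  simp only [rowOK_append] at ha
  refine ⟨(hu.append (h.1.whisker ha.1.1 ha.2)).append hv,
    (hu.append (h.2.1.whisker ha.1.1 ha.2)).append hv, ?_⟩
  simpa using insert_mem_relations h.2.2 hu hv

theorem append (h : Iso n s r u v) (h' : Iso n r t w w') : Iso n s t (u ++ w) (v ++ w') := by
  have h1 := h.insert (a := []) (b := []) (u := []) (v := w) (s' := s) (t' := t)
    (by simpa using IsWeb.refl h.1.1) (by simpa using h'.1)
  have h2 := h'.insert (a := []) (b := []) (u := v) (v := []) (s' := s) (t' := t)
    (by simpa using h.2.1) (by simpa using IsWeb.refl h'.1.2.1)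
  simp only [List.nil_append, whisker_empty, List.append_nil] at h1 h2
  exact h1.trans h2

theorem whisker {a b : List Strand} (ha : RowOK n a) (hb : RowOK n b) (h : Iso n s t w w') :
    Iso n (a ++ s ++ b) (a ++ t ++ b) (whisker a w b) (whisker a w' b) := by
  have := h.insert (a := a) (b := b) (u := []) (v := []) (s' := a ++ s ++ b) (t' := a ++ t ++ b)
    (IsWeb.refl (by simp [ha, hb, h.1.1])) (IsWeb.refl (by simp [ha, hb, h.1.2.1]))
  simpa using this

theorem rotW (h : Iso n s t w w') :
    Iso n (dualRow t) (dualRow s) (rotW s t w) (rotW s t w') := by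
  have hs := h.1.1
  have ht := h.1.2.1
  refine Iso.insert (a := dualRow t) (b := dualRow s) ?_ ?_ h
  · simpa using (isWeb_iff.2 ⟨by simp, slicesOK_cups hs, isPath_cups s⟩ :
      IsWeb n [] (cups s) (s ++ dualRow s)).whisker (a := dualRow t) (b := []) (by simpa) (by simp)
  · simpa using (isWeb_iff.2 ⟨by simp [ht], slicesOK_caps ht, isPath_caps t⟩ :
      IsWeb n (dualRow t ++ t) (caps t) []).whisker (a := []) (b := dualRow s) (by simp) (by simpa)

end Iso

/-- Two operations on diagrams with isotopic results agree modulo relations. -/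
theorem lin_sub_lin_mem {P : Word → Prop} {s t : List Strand} {f g : Word → Word} {x : Lin}
    (hfg : ∀ w, P w → Iso n s t (f w) (g w)) (hx : ∀ w, x w ≠ 0 → P w) :
    lin f x - lin g x ∈ relations n R s t := by
  have e : lin f x - lin g x = x.sum fun w c => c • (dg (f w) - dg (g w)) := by
    simp only [lin, Finsupp.lmapDomain_apply, Finsupp.mapDomain, Finsupp.sum, smul_sub,
      Finset.sum_sub_distrib, dg, Finsupp.smul_single, smul_eq_mul, mul_one]
  rw [e]
  exact Submodule.sum_mem _ fun w hw => Submodule.smul_mem _ _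
    (hfg w (hx w (Finsupp.mem_support_iff.1 hw))).sub_mem

theorem lin_mem_relations_congr {P : Word → Prop} {s t : List Strand} {f g : Word → Word}
    {x : Lin} (hfg : ∀ w, P w → Iso n s t (f w) (g w)) (hx : ∀ w, x w ≠ 0 → P w) :
    lin f x ∈ relations n R s t ↔ lin g x ∈ relations n R s t := by
  have := lin_sub_lin_mem (R := R) hfg hx
  constructor
  · intro h
    simpa using Submodule.sub_mem _ h this
  · intro h
    simpa using Submodule.add_mem _ h this

@[simp] theorem lin_dg (f : Word → Word) (w : Word) : lin f (dg w) = dg (f w) := by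
  simp [lin, dg, Finsupp.lmapDomain_apply, Finsupp.mapDomain_single]

theorem lin_lin (f g : Word → Word) (x : Lin) : lin f (lin g x) = lin (f ∘ g) x := by
  simp only [lin, Finsupp.lmapDomain_apply, Finsupp.mapDomain_comp]

theorem lin_congr {P : Word → Prop} {f g : Word → Word} {x : Lin}
    (hfg : ∀ w, P w → f w = g w) (hx : ∀ w, x w ≠ 0 → P w) : lin f x = lin g x :=
  Finsupp.mapDomain_congr fun w hw => hfg w (hx w (Finsupp.mem_support_iff.1 hw))

theorem lin_rotW (s t : List Strand) (x : Lin) : lin (rotW s t) x =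
    insert (whisker (dualRow t) (cups s) []) (whisker [] (caps t) (dualRow s)) (dualRow t)
      (dualRow s) x := rfl

theorem lin_rotW_mem {s t : List Strand} {x : Lin} (hx : x ∈ relations n R s t) :
    lin (rotW s t) x ∈ relations n R (dualRow t) (dualRow s) := by
  by_cases h : RowOK n s ∧ RowOK n t
  · rw [lin_rotW]
    refine insert_mem_relations hx ?_ ?_
    · simpa using (isWeb_iff.2 ⟨by simp, slicesOK_cups h.1, isPath_cups s⟩ :
        IsWeb n [] (cups s) (s ++ dualRow s)).whisker (a := dualRow t) (b := [])
        (by simpa using h.2) (by simp)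
    · simpa using (isWeb_iff.2 ⟨by simp [h.2], slicesOK_caps h.2, isPath_caps t⟩ :
        IsWeb n (dualRow t ++ t) (caps t) []).whisker (a := []) (b := dualRow s)
        (by simp) (by simpa using h.1)
  · have : x = 0 := by
      ext w
      by_contra hw
      have := mem_Hom.1 (relations_le_Hom hx) w hw
      exact h ⟨this.1, this.2.1⟩
    simp [this]

theorem iso_rotW_nil {s : List Strand} (hs : RowOK n s) :
    Iso n (dualRow s) (dualRow s) (rotW s s []) [] := by
  have h : IsWeb n s [] s := IsWeb.refl hs
  refine Iso.symm (Iso.of_ev (IsWeb.refl (by simpa)) h.rotW ?_)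
  have := ev_eq_rotW (n := n) (R := ∅) (s := s) (t := s) (w := []) (y := []) (a := []) (b := [])
    rfl (fun b => by simp)
  simpa using this

theorem iso_rotW_append {s r t : List Strand} {u v : Word} (hu : IsWeb n s u r)
    (hv : IsWeb n r v t) :
    Iso n (dualRow t) (dualRow s) (rotW s t (u ++ v)) (rotW r t v ++ rotW s r u) := by
  refine Iso.symm (Iso.of_ev (hv.rotW.append hu.rotW) (hu.append hv).rotW ?_)
  have := ev_eq_rotW (n := n) (R := ∅) (s := s) (t := t) (w := u ++ v)
    (y := rotW r t v ++ rotW s r u) (a := []) (b := [])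
    (hv.rotW.append hu.rotW).2.2.2 (fun b => ?_)
  · simpa using this
  have h1 := idem_mul_ev_comm (n := n) (R := ∅) (a := []) (b := s ++ b) hv.2.2.2.rotW
  have h2 := ev_rotW_mul_caps (n := n) (R := ∅) hu.2.2.2 [] b
  have h3 := ev_exchange (n := n) (R := ∅) hv.2.2.2.rotW hu.2.2.2 [] [] b
  have h4 := idem_mul_ev_comm (n := n) (R := ∅) (a := dualRow t) (b := b) hu.2.2.2
  have h5 := ev_rotW_mul_caps (n := n) (R := ∅) hv.2.2.2 [] b
  simp only [List.append_assoc, List.nil_append, List.append_nil] at h1 h2 h3 h4 h5 ⊢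
  simp only [ev_append]
  rw [mul_assoc, ← mul_assoc, h1, mul_assoc, h2, ← mul_assoc, ← h1, mul_assoc,
    ← mul_assoc (ev n ∅ [] (rotW r t v) _), h3, mul_assoc, ← mul_assoc, h4, mul_assoc, h5,
    ← mul_assoc, ← h4]
  simp only [mul_assoc]

theorem iso_rotW_whisker {s t a b : List Strand} {w : Word} (ha : RowOK n a) (hb : RowOK n b)
    (hw : IsWeb n s w t) :
    Iso n (dualRow (a ++ t ++ b)) (dualRow (a ++ s ++ b))
      (rotW (a ++ s ++ b) (a ++ t ++ b) (whisker a w b))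
      (whisker (dualRow b) (rotW s t w) (dualRow a)) := by
  have hw' := hw.whisker ha hb
  have hy : IsWeb n (dualRow (a ++ t ++ b)) (whisker (dualRow b) (rotW s t w) (dualRow a))
      (dualRow (a ++ s ++ b)) := by
    simpa using hw.rotW.whisker (a := dualRow b) (b := dualRow a) (by simpa) (by simpa)
  refine Iso.symm (Iso.of_ev hy hw'.rotW ?_)
  have := ev_eq_rotW (n := n) (R := ∅) (w := whisker a w b) (a := []) (b := [])
    hy.2.2.2 (fun c => ?_)
  · simpa using this
  have h1 := ev_exchange (n := n) (R := ∅) hw.2.2.2.rotW (isPath_caps a) (dualRow b) []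
    (s ++ (b ++ c))
  have h2 := ev_exchange (n := n) (R := ∅) (isPath_caps a) hw.2.2.2 (dualRow b ++ dualRow t) []
    (b ++ c)
  have h3 := ev_rotW_mul_caps (n := n) (R := ∅) hw.2.2.2 (dualRow b) (b ++ c)
  have h4 := idem_mul_ev_comm (n := n) (R := ∅) (a := dualRow b ++ dualRow t)
    (b := s ++ (b ++ c)) (isPath_caps a)
  simp only [dualRow_append, List.append_assoc, List.nil_append, List.append_nil] at h1 h2 h3 h4 ⊢
  simp only [ev_append, ev_whisker, caps_append, List.append_assoc, List.nil_append,
    dualRow_append]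
  rw [← mul_assoc (ev n ∅ (dualRow b) (rotW s t w) _), h1, ← mul_assoc (ev n ∅ _ w _), ← h2]
  simp only [mul_assoc]
  rw [← mul_assoc (idem _ _ _), h4, ← mul_assoc (ev n ∅ (dualRow b) (rotW s t w) _)]
  simp only [mul_assoc]
  rw [← mul_assoc (ev n ∅ (dualRow b) (rotW s t w) _), ← mul_assoc (idem _ _ _), h3]
  simp only [← mul_assoc]
  rw [h4]

end

noncomputable section

variable {n : ℕ} {R R' : Set Lin}

/-! ### Reflections -/

@[simp] theorem reverse_dualRow (s : List Strand) : (dualRow s).reverse = s.map Strand.dual := by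
  rw [dualRow, List.reverse_reverse]

@[simp] theorem dualRow_reverse (s : List Strand) : dualRow s.reverse = s.map Strand.dual := by
  simp [dualRow]

@[simp] theorem dualRow_map_dual (s : List Strand) : dualRow (s.map Strand.dual) = s.reverse := by
  simp [dualRow, Function.comp_def]

@[simp] theorem reverse_map_dual (s : List Strand) : (s.map Strand.dual).reverse = dualRow s := rfl

/-- Reflection of an elementary piece in a horizontal line, followed by reversal of all arrows. -/
def Gen.flip : Gen → Gen
  | cup x => cap x
  | cap x => cup x
  | merge k l => split k l
  | split k l => merge k l
  | tagOut k l => tagIn k l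
  | tagIn k l => tagOut k l

/-- Reflection of a diagram in a horizontal line, followed by reversal of all arrows. Rows of
strands are unchanged. -/
def flip (w : Word) : Word := (w.map fun σ => ⟨σ.left, σ.gen.flip, σ.right⟩).reverse

@[simp] theorem flip_nil : flip [] = [] := rfl

@[simp] theorem flip_cons (σ : Slice) (w : Word) :
    flip (σ :: w) = flip w ++ [⟨σ.left, σ.gen.flip, σ.right⟩] := by simp [flip]

@[simp] theorem flip_append (u v : Word) : flip (u ++ v) = flip v ++ flip u := by simp [flip]

@[simp] theorem flip_whisker (a b : List Strand) (w : Word) :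
    flip (whisker a w b) = whisker a (flip w) b := by simp [flip, whisker]

@[simp] theorem Gen.flip_flip (g : Gen) : g.flip.flip = g := by cases g <;> rfl

@[simp] theorem flip_flip (w : Word) : flip (flip w) = w := by
  induction w with
  | nil => rfl
  | cons σ w ih => simp [ih]

@[simp] theorem Gen.src_flip (g : Gen) : g.flip.src = g.tgt := by cases g <;> rfl

@[simp] theorem Gen.tgt_flip (g : Gen) : g.flip.tgt = g.src := by cases g <;> rfl

@[simp] theorem Gen.ok_flip {g : Gen} : g.flip.OK n ↔ g.OK n := by cases g <;> rfl

@[simp] theorem mirror_nil : mirror [] = [] := rfl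

@[simp] theorem mirror_cons (σ : Slice) (w : Word) :
    mirror (σ :: w) = ⟨σ.right.reverse, σ.gen.mirror, σ.left.reverse⟩ :: mirror w := rfl

@[simp] theorem mirror_append (u v : Word) : mirror (u ++ v) = mirror u ++ mirror v := by
  simp [mirror]

@[simp] theorem mirror_whisker (a b : List Strand) (w : Word) :
    mirror (whisker a w b) = whisker b.reverse (mirror w) a.reverse := by simp [mirror, whisker]

@[simp] theorem Gen.mirror_mirror (g : Gen) : g.mirror.mirror = g := by
  cases g <;> simp [Gen.mirror]

@[simp] theorem mirror_mirror (w : Word) : mirror (mirror w) = w := by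
  induction w with
  | nil => rfl
  | cons σ w ih => simp [ih]

@[simp] theorem Gen.src_mirror (g : Gen) : g.mirror.src = g.src.reverse := by
  cases g <;> simp [Gen.src, Gen.mirror, add_comm]

@[simp] theorem Gen.tgt_mirror (g : Gen) : g.mirror.tgt = g.tgt.reverse := by
  cases g <;> simp [Gen.tgt, Gen.mirror, add_comm]

@[simp] theorem Gen.ok_mirror {g : Gen} : g.mirror.OK n ↔ g.OK n := by
  cases g <;> simp [Gen.OK, Gen.mirror, add_comm] <;> tauto

theorem Gen.mirror_flip (g : Gen) : g.flip.mirror = g.mirror.flip := by cases g <;> rfl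

theorem mirror_flip (w : Word) : mirror (flip w) = flip (mirror w) := by
  induction w with
  | nil => rfl
  | cons σ w ih => simp [ih, Gen.mirror_flip]

theorem IsPath.mirror {s t : List Strand} {w : Word} (h : IsPath s w t) :
    IsPath s.reverse (mirror w) t.reverse := by
  induction w generalizing s with
  | nil => simp_all
  | cons σ w ih =>
    rw [isPath_cons] at h
    rw [mirror_cons, isPath_cons]
    exact ⟨by simp [h.1, Slice.src], by simpa [Slice.tgt] using ih h.2⟩

theorem IsPath.flip {s t : List Strand} {w : Word} (h : IsPath s w t) :
    IsPath t (flip w) s := by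
  induction w generalizing s with
  | nil => simp_all
  | cons σ w ih =>
    rw [isPath_cons] at h
    rw [flip_cons]
    refine (ih h.2).append ?_
    simp [h.1, Slice.src, Slice.tgt]

theorem slicesOK_mirror {w : Word} : SlicesOK n (mirror w) ↔ SlicesOK n w := by
  induction w with
  | nil => simp
  | cons σ w ih => simp [ih, Slice.OK]; tauto

theorem slicesOK_flip {w : Word} : SlicesOK n (flip w) ↔ SlicesOK n w := by
  induction w with
  | nil => simp
  | cons σ w ih => simp [ih, Slice.OK]; tauto

theorem IsWeb.mirror {s t : List Strand} {w : Word} (h : IsWeb n s w t) :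
    IsWeb n s.reverse (mirror w) t.reverse :=
  isWeb_iff.2 ⟨by simpa using h.1, slicesOK_mirror.2 h.2.2.1, h.2.2.2.mirror⟩

theorem IsWeb.flip {s t : List Strand} {w : Word} (h : IsWeb n s w t) :
    IsWeb n t (flip w) s :=
  isWeb_iff.2 ⟨h.2.1, slicesOK_flip.2 h.2.2.1, h.2.2.2.flip⟩

theorem mirror_cups (s : List Strand) : mirror (cups s) = cups (s.map Strand.dual) := by
  induction s with
  | nil => rfl
  | cons x s ih => simp [cups, ih, Gen.mirror]

theorem mirror_caps (s : List Strand) : mirror (caps s) = caps (s.map Strand.dual) := by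
  induction s with
  | nil => rfl
  | cons x s ih => simp [caps, ih, Gen.mirror]

theorem flip_cups (s : List Strand) : flip (cups s) = caps (dualRow s) := by
  induction s with
  | nil => rfl
  | cons x s ih => simp [cups, ih, caps_append, caps, Gen.flip]

theorem flip_caps (s : List Strand) : flip (caps s) = cups (dualRow s) := by
  rw [← flip_flip (cups (dualRow s)), flip_cups, dualRow_dualRow]

theorem mirror_rotW (s t : List Strand) (w : Word) :
    mirror (rotW s t w) = rotW' s.reverse t.reverse (mirror w) := by
  simp [rotW, rotW', mirror_cups, mirror_caps]

theorem mirror_rotW' (s t : List Strand) (w : Word) :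
    mirror (rotW' s t w) = rotW s.reverse t.reverse (mirror w) := by
  rw [← mirror_mirror (rotW s.reverse t.reverse (mirror w)), mirror_rotW]
  simp

theorem flip_rotW (s t : List Strand) (w : Word) :
    flip (rotW s t w) = rotW' t s (flip w) := by
  simp [rotW, rotW', flip_cups, flip_caps]

theorem lin_mirror_insert (u v : Word) (a b : List Strand) (x : Lin) :
    lin mirror (insert u v a b x) =
      insert (mirror u) (mirror v) b.reverse a.reverse (lin mirror x) := by
  induction x using Finsupp.induction_linear with
  | zero => simp
  | add x y hx hy => simp only [map_add, hx, hy]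
  | single w c => simp [lin, Finsupp.lmapDomain_apply, Finsupp.mapDomain_single]

theorem lin_flip_insert (u v : Word) (a b : List Strand) (x : Lin) :
    lin flip (insert u v a b x) = insert (flip v) (flip u) a b (lin flip x) := by
  induction x using Finsupp.induction_linear with
  | zero => simp
  | add x y hx hy => simp only [map_add, hx, hy]
  | single w c => simp [lin, Finsupp.lmapDomain_apply, Finsupp.mapDomain_single]

theorem lin_mirror_mem_Hom {s t : List Strand} {x : Lin} (hx : x ∈ Hom n s t) :
    lin mirror x ∈ Hom n s.reverse t.reverse := lmapDomain_mem_Hom (fun _ h => h.mirror) hx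

theorem lin_flip_mem_Hom {s t : List Strand} {x : Lin} (hx : x ∈ Hom n s t) :
    lin flip x ∈ Hom n t s := lmapDomain_mem_Hom (fun _ h => h.flip) hx

theorem Isotopy.mirror {x : Lin} (hx : Isotopy x) :
    Isotopy (lin mirror x) ∨ Isotopy (-lin mirror x) := by
  cases hx with
  | exchange g h b =>
    right
    simpa using Isotopy.exchange h.mirror g.mirror b.reverse
  | zigzag x => left; simpa [Gen.mirror] using Isotopy.zigzag' x
  | zigzag' x => left; simpa [Gen.mirror] using Isotopy.zigzag x
  | rotate g =>
    right
    have := Isotopy.rotate g.mirror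
    rw [Gen.rot_eq, Gen.rot'_eq] at this ⊢
    simpa [mirror_rotW, mirror_rotW'] using this

theorem Isotopy.flip {x : Lin} (hx : Isotopy x) :
    Isotopy (lin flip x) ∨ Isotopy (-lin flip x) := by
  cases hx with
  | exchange g h b =>
    right
    simpa using Isotopy.exchange g.flip h.flip b
  | zigzag x => left; simpa [Gen.flip] using Isotopy.zigzag' x
  | zigzag' x => left; simpa [Gen.flip] using Isotopy.zigzag x
  | rotate g =>
    right
    have := Isotopy.rotate g.flip
    have e : ∀ s t w, SLWeb.flip (rotW' s t w) = rotW t s (SLWeb.flip w) := fun s t w => by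
      rw [← flip_flip (rotW t s _), flip_rotW, flip_flip]
    rw [Gen.rot_eq, Gen.rot'_eq] at this ⊢
    simpa [flip_rotW, e] using this

/-- Relations whose mirror images are consequences of other relations have this property for all
their consequences. -/
theorem lin_mirror_mem_relations (hR : ∀ x ∈ R, Placeable n x)
    (h : ∀ x ∈ R, ∀ s t, x ∈ Hom n s t → lin mirror x ∈ relations n R' s.reverse t.reverse)
    {s t : List Strand} {x : Lin} (hx : x ∈ relations n R s t) :
    lin mirror x ∈ relations n R' s.reverse t.reverse := by
  refine relations_le (N := (relations n R' s.reverse t.reverse).comap (lin mirror)) hR ?_ hx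
  intro u v a b x s' t' hx hH hu hv
  rw [Submodule.mem_comap, lin_mirror_insert]
  refine insert_mem_relations (s' := s'.reverse) (t' := t'.reverse) ?_
    (by simpa using hu.mirror) (by simpa using hv.mirror)
  rcases hx with hx | hx
  · rcases hx.mirror with h | h
    · exact mem_relations_of_mem (Or.inl h) (lin_mirror_mem_Hom hH)
    · simpa using Submodule.neg_mem _ (mem_relations_of_mem (R := R') (Or.inl h)
        (Submodule.neg_mem _ (lin_mirror_mem_Hom hH)))
  · exact h x hx s' t' hH

theorem lin_flip_mem_relations (hR : ∀ x ∈ R, Placeable n x)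
    (h : ∀ x ∈ R, ∀ s t, x ∈ Hom n s t → lin flip x ∈ relations n R' t s)
    {s t : List Strand} {x : Lin} (hx : x ∈ relations n R s t) :
    lin flip x ∈ relations n R' t s := by
  refine relations_le (N := (relations n R' t s).comap (lin flip)) hR ?_ hx
  intro u v a b x s' t' hx hH hu hv
  rw [Submodule.mem_comap, lin_flip_insert]
  refine insert_mem_relations (s' := t') (t' := s') ?_ (by simpa using hv.flip)
    (by simpa using hu.flip)
  rcases hx with hx | hx
  · rcases hx.flip with h | h
    · exact mem_relations_of_mem (Or.inl h) (lin_flip_mem_Hom hH)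
    · simpa using Submodule.neg_mem _ (mem_relations_of_mem (R := R') (Or.inl h)
        (Submodule.neg_mem _ (lin_flip_mem_Hom hH)))
  · exact h x hx s' t' hH

theorem Iso.mirror {s t : List Strand} {w w' : Word} (h : Iso n s t w w') :
    Iso n s.reverse t.reverse (mirror w) (mirror w') := by
  refine ⟨h.1.mirror, h.2.1.mirror, ?_⟩
  simpa using lin_mirror_mem_relations (R' := ∅) (by simp) (by simp) h.2.2

theorem Iso.flip {s t : List Strand} {w w' : Word} (h : Iso n s t w w') :
    Iso n t s (flip w) (flip w') := by
  refine ⟨h.1.flip, h.2.1.flip, ?_⟩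
  simpa using lin_flip_mem_relations (R' := ∅) (by simp) (by simp) h.2.2

/-! ### The two half turns -/

theorem iso_rotW'_append {s r t : List Strand} {u v : Word} (hu : IsWeb n s u r)
    (hv : IsWeb n r v t) :
    Iso n (dualRow t) (dualRow s) (rotW' s t (u ++ v)) (rotW' r t v ++ rotW' s r u) := by
  have := (iso_rotW_append hu.mirror hv.mirror).mirror
  simpa [mirror_rotW] using this

theorem iso_rotW'_whisker {s t a b : List Strand} {w : Word} (ha : RowOK n a) (hb : RowOK n b)
    (hw : IsWeb n s w t) :
    Iso n (dualRow (a ++ t ++ b)) (dualRow (a ++ s ++ b))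
      (rotW' (a ++ s ++ b) (a ++ t ++ b) (whisker a w b))
      (whisker (dualRow b) (rotW' s t w) (dualRow a)) := by
  have := (iso_rotW_whisker (a := b.reverse) (b := a.reverse) (by simpa) (by simpa)
    hw.mirror).mirror
  simpa [mirror_rotW] using this

theorem iso_rotW_gen {g : Gen} (hg : g.OK n) :
    Iso n (dualRow g.tgt) (dualRow g.src) (rotW g.src g.tgt [⟨[], g, []⟩])
      (rotW' g.src g.tgt [⟨[], g, []⟩]) :=
  Iso.of_ev (isWeb_gen hg).rotW (isWeb_gen hg).rotW' (by rw [ev_rot_gen])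

/-- Rotating a web by a half turn in either direction gives the same result. -/
theorem iso_rotW_rotW' {s t : List Strand} {w : Word} (hw : IsWeb n s w t) :
    Iso n (dualRow t) (dualRow s) (rotW s t w) (rotW' s t w) := by
  induction w generalizing s with
  | nil =>
    rw [isWeb_nil] at hw
    obtain ⟨hs, rfl⟩ := hw
    refine (iso_rotW_nil hs).trans (Iso.symm ?_)
    have := (iso_rotW_nil (s := s.reverse) (by simpa)).mirror
    simpa [mirror_rotW] using this
  | cons σ w ih =>
    rw [isWeb_cons] at hw
    obtain ⟨rfl, hσ, hw⟩ := hw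
    have hg : IsWeb n σ.src [σ] σ.tgt := isWeb_cons.2 ⟨rfl, hσ, IsWeb.refl hσ.tgt⟩
    have e : [σ] = whisker σ.left [⟨[], σ.gen, []⟩] σ.right := by simp
    have h1 := iso_rotW_whisker hσ.1 hσ.2.2 (isWeb_gen hσ.2.1)
    have h2 := iso_rotW'_whisker hσ.1 hσ.2.2 (isWeb_gen hσ.2.1)
    have h3 := (iso_rotW_gen hσ.2.1).whisker (a := dualRow σ.right) (b := dualRow σ.left)
      (by simpa using hσ.2.2) (by simpa using hσ.1)
    rw [← e] at h1 h2
    simp only [dualRow_append, ← List.append_assoc] at h1 h2 h3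
    have h4 := (h1.trans h3).trans h2.symm
    refine (iso_rotW_append hg hw).trans (Iso.trans ?_ (iso_rotW'_append hg hw).symm)
    refine (ih hw).append ?_
    simpa [Slice.src, Slice.tgt] using h4

/-- Two successive half turns cancel. -/
theorem iso_rotW_rotW {s t : List Strand} {w : Word} (hw : IsWeb n s w t) :
    Iso n s t (rotW (dualRow t) (dualRow s) (rotW s t w)) w := by
  have slide : ∀ {s t : List Strand} {w : Word}, IsWeb n s w t → Iso n (dualRow t ++ s) []
      (whisker [] (rotW s t w) s ++ caps s) (whisker (dualRow t) w [] ++ caps t) := by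
    intro s t w hw
    have hc : ∀ s, RowOK n s → IsWeb n (dualRow s ++ s) (caps s) [] := fun s hs =>
      isWeb_iff.2 ⟨by simp [hs], slicesOK_caps hs, isPath_caps s⟩
    have h1 := (hw.rotW.whisker (a := []) (b := s) (by simp) hw.1).append (hc s hw.1)
    have h2 := (hw.whisker (a := dualRow t) (b := []) (by simpa using hw.2.1) (by simp)).append
      (by simpa using hc t hw.2.1)
    refine Iso.of_ev h1 (by simpa using h2) ?_
    have := ev_rotW_mul_caps (n := n) (R := ∅) hw.2.2.2 [] []
    simpa [ev_append, ev_whisker] using this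
  refine Iso.trans ?_ (Iso.symm ?_) (w' := rotW (dualRow t) (dualRow s) (rotW' s t w))
  · simpa using (iso_rotW_rotW' hw).rotW
  have h0 : IsWeb n (dualRow (dualRow s)) w (dualRow (dualRow t)) := by simpa using hw
  refine Iso.of_ev hw (by simpa using hw.rotW'.rotW) ?_
  have := ev_eq_rotW (n := n) (R := ∅) (s := dualRow t) (t := dualRow s) (w := rotW' s t w)
    (y := w) (a := []) (b := []) h0.2.2.2 (fun b => ?_)
  · simpa using this
  have h1 := (slide hw.mirror).mirror.symm.idem_mul_ev (R := ∅) [] b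
  simpa [mirror_rotW, ev_append, ev_whisker, mirror_caps, mirror_rotW'] using h1

end

noncomputable section

variable {n : ℕ} {R R' : Set Lin}

/-! ### Deletion of strands labelled `0` or `n` -/

@[simp] theorem deleteRow_nil : deleteRow n [] = [] := rfl

@[simp] theorem deleteRow_append (s t : List Strand) :
    deleteRow n (s ++ t) = deleteRow n s ++ deleteRow n t := by simp [deleteRow]

theorem deleteRow_cons (x : Strand) (s : List Strand) :
    deleteRow n (x :: s) = deleteRow n [x] ++ deleteRow n s := by
  rw [← deleteRow_append]; rfl

@[simp] theorem deleteRow_reverse (s : List Strand) :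
    deleteRow n s.reverse = (deleteRow n s).reverse := by simp [deleteRow]

@[simp] theorem deleteRow_map_dual (s : List Strand) :
    deleteRow n (s.map Strand.dual) = (deleteRow n s).map Strand.dual := by
  rw [deleteRow, List.filter_map]; rfl

@[simp] theorem deleteRow_dualRow (s : List Strand) :
    deleteRow n (dualRow s) = dualRow (deleteRow n s) := by
  rw [dualRow, dualRow, deleteRow_reverse, deleteRow_map_dual]

theorem deleteRow_singleton (x : Strand) :
    deleteRow n [x] = if 0 < x.label ∧ x.label < n then [x] else [] := by
  by_cases h : 0 < x.label ∧ x.label < n <;> simp [deleteRow, h]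

theorem deleteRow_of_rowOK {s : List Strand} (h : RowOK n s) : deleteRow n s = s := by
  rw [deleteRow, List.filter_eq_self]
  intro x hx
  simpa using h x hx

@[simp] theorem subst_nil (f : List Strand → List Strand) (F : Gen → Word) :
    subst f F [] = [] := rfl

theorem subst_cons (f : List Strand → List Strand) (F : Gen → Word) (σ : Slice) (w : Word) :
    subst f F (σ :: w) = whisker (f σ.left) (F σ.gen) (f σ.right) ++ subst f F w := rfl

theorem subst_append (f : List Strand → List Strand) (F : Gen → Word) (u v : Word) :
    subst f F (u ++ v) = subst f F u ++ subst f F v := by simp [subst]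

theorem subst_whisker {f : List Strand → List Strand} (hf : ∀ s t, f (s ++ t) = f s ++ f t)
    (F : Gen → Word) (a b : List Strand) (w : Word) :
    subst f F (whisker a w b) = whisker (f a) (subst f F w) (f b) := by
  induction w with
  | nil => rfl
  | cons σ w ih => simp [subst_cons, ih, hf]

variable {c : Convention}

@[simp] theorem delete_nil : delete n c [] = [] := rfl

theorem delete_cons (σ : Slice) (w : Word) :
    delete n c (σ :: w) =
      whisker (deleteRow n σ.left) (σ.gen.delete n c) (deleteRow n σ.right) ++ delete n c w := rfl

@[simp] theorem delete_append (u v : Word) :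
    delete n c (u ++ v) = delete n c u ++ delete n c v := subst_append ..

@[simp] theorem delete_whisker (a b : List Strand) (w : Word) :
    delete n c (whisker a w b) = whisker (deleteRow n a) (delete n c w) (deleteRow n b) :=
  subst_whisker deleteRow_append ..

@[simp] theorem delete_gen (g : Gen) : delete n c [⟨[], g, []⟩] = g.delete n c := by
  simp [delete_cons]

/-- The elementary pieces with labels in `0, …, n`. -/
def Gen.Ext (n : ℕ) : Gen → Prop
  | cup x => x.label ≤ n
  | cap x => x.label ≤ n
  | merge k l => k + l ≤ n
  | split k l => k + l ≤ n
  | tagOut k l => 0 < k ∧ 0 < l ∧ k + l = n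
  | tagIn k l => 0 < k ∧ 0 < l ∧ k + l = n

/-- Diagrams from `s` to `t` with vertices whose labels are in `0, …, n`. -/
def ExtWeb (n : ℕ) (s : List Strand) (w : Word) (t : List Strand) : Prop :=
  (∀ σ ∈ w, σ.gen.Ext n) ∧ IsPath s w t

theorem extWeb_cons {s t : List Strand} {σ : Slice} {w : Word} :
    ExtWeb n s (σ :: w) t ↔ s = σ.src ∧ σ.gen.Ext n ∧ ExtWeb n σ.tgt w t := by
  simp only [ExtWeb, List.forall_mem_cons, isPath_cons]; tauto

theorem extWeb_nil {s t : List Strand} : ExtWeb n s [] t ↔ s = t := by simp [ExtWeb]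

theorem ExtWeb.append {s r t : List Strand} {u v : Word} (hu : ExtWeb n s u r)
    (hv : ExtWeb n r v t) : ExtWeb n s (u ++ v) t :=
  ⟨fun σ hσ => (List.mem_append.1 hσ).elim (hu.1 σ) (hv.1 σ), hu.2.append hv.2⟩

theorem ExtWeb.whisker {s t : List Strand} {w : Word} (a b : List Strand) (h : ExtWeb n s w t) :
    ExtWeb n (a ++ s ++ b) (whisker a w b) (a ++ t ++ b) := by
  refine ⟨?_, h.2.whisker a b⟩
  intro σ hσ
  obtain ⟨τ, hτ, rfl⟩ := List.mem_map.1 hσ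
  exact h.1 τ hτ

theorem Gen.Ext.mirror {g : Gen} (h : g.Ext n) : g.mirror.Ext n := by
  cases g <;> simp_all [Gen.Ext, Gen.mirror, add_comm]

theorem Gen.Ext.flip {g : Gen} (h : g.Ext n) : g.flip.Ext n := by
  cases g <;> simp_all [Gen.Ext, Gen.flip]

theorem ExtWeb.mirror {s t : List Strand} {w : Word} (h : ExtWeb n s w t) :
    ExtWeb n s.reverse (mirror w) t.reverse := by
  refine ⟨?_, h.2.mirror⟩
  intro σ hσ
  obtain ⟨τ, hτ, rfl⟩ := List.mem_map.1 hσ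
  exact (h.1 τ hτ).mirror

theorem ExtWeb.flip {s t : List Strand} {w : Word} (h : ExtWeb n s w t) :
    ExtWeb n t (flip w) s := by
  refine ⟨?_, h.2.flip⟩
  intro σ hσ
  obtain ⟨τ, hτ, rfl⟩ := List.mem_map.1 (List.mem_reverse.1 hσ)
  exact (h.1 τ hτ).flip

theorem extWeb_gen {g : Gen} (h : g.Ext n) : ExtWeb n g.src [⟨[], g, []⟩] g.tgt :=
  ⟨by simpa using h, isPath_gen g⟩

theorem isWeb_tagInSwitched {k l : ℕ} (hk : 0 < k) (hl : 0 < l) (h : k + l = n) :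
    IsWeb n [up k, up l] (tagInSwitched k l) [] := by
  refine isWeb_iff.2 ⟨?_, ?_, ?_⟩ <;>
    simp [tagInSwitched, up, dn, Slice.OK, Gen.OK, Slice.src, Slice.tgt, Gen.src, Gen.tgt,
      Strand.dual] <;> omega

theorem isWeb_tagOutSwitched {k l : ℕ} (hk : 0 < k) (hl : 0 < l) (h : k + l = n) :
    IsWeb n [] (tagOutSwitched k l) [up k, up l] := by
  refine isWeb_iff.2 ⟨?_, ?_, ?_⟩ <;>
    simp [tagOutSwitched, up, dn, Slice.OK, Gen.OK, Slice.src, Slice.tgt, Gen.src, Gen.tgt,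
      Strand.dual]
  omega

theorem isWeb_inTag {k l : ℕ} (hk : 0 < k) (hl : 0 < l) (h : k + l = n) :
    IsWeb n [up k, up l] (c.inTag k l) [] := by
  cases c with
  | toward => exact isWeb_gen (g := .tagIn k l) ⟨hk, hl, h⟩
  | ckm => exact isWeb_tagInSwitched hk hl h

theorem deleteRow_up (k : ℕ) : deleteRow n [up k] = if 0 < k ∧ k < n then [up k] else [] :=
  deleteRow_singleton _

theorem isWeb_delete_gen {g : Gen} (h : g.Ext n) :
    IsWeb n (deleteRow n g.src) (g.delete n c) (deleteRow n g.tgt) := by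
  have h0 : deleteRow n [up 0] = [] := by simp [deleteRow_up]
  have hn : deleteRow n [up n] = [] := by simp [deleteRow_up]
  cases g with
  | cup x =>
    by_cases hx : 0 < x.label ∧ x.label < n
    · have := isWeb_gen (n := n) (g := .cup x) hx
      rw [deleteRow_of_rowOK this.1, deleteRow_of_rowOK this.2.1]
      simpa [Gen.delete, hx] using this
    · simp only [Gen.delete, hx, if_false, Gen.src, Gen.tgt, isWeb_nil]
      rw [deleteRow_cons]
      simp [deleteRow_singleton, hx]
  | cap x =>
    by_cases hx : 0 < x.label ∧ x.label < n
    · have := isWeb_gen (n := n) (g := .cap x) hx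
      rw [deleteRow_of_rowOK this.1, deleteRow_of_rowOK this.2.1]
      simpa [Gen.delete, hx] using this
    · simp only [Gen.delete, hx, if_false, Gen.src, Gen.tgt, isWeb_nil]
      rw [deleteRow_cons]
      simp [deleteRow_singleton, hx]
  | merge k l =>
    simp only [Gen.Ext] at h
    simp only [Gen.delete, Gen.src, Gen.tgt]
    rw [deleteRow_cons]
    split_ifs with h1 h2
    · rw [isWeb_nil]
      rcases h1 with rfl | rfl <;> simp [h0]
    · subst h2
      simp only [hn]
      have := isWeb_inTag (n := k + l) (c := c) (k := k) (l := l) (by omega) (by omega) rfl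
      rwa [← deleteRow_append, deleteRow_of_rowOK (by exact this.1)]
    · have := isWeb_gen (n := n) (g := .merge k l) ⟨by omega, by omega, by omega⟩
      rw [← deleteRow_append, deleteRow_of_rowOK (by exact this.1),
        deleteRow_of_rowOK (by exact this.2.1)]
      exact this
  | split k l =>
    simp only [Gen.Ext] at h
    simp only [Gen.delete, Gen.src, Gen.tgt]
    rw [deleteRow_cons _ [up l]]
    split_ifs with h1 h2
    · rw [isWeb_nil]
      rcases h1 with rfl | rfl <;> simp [h0]
    · subst h2
      simp only [hn]
      have := isWeb_gen (n := k + l) (g := .tagOut k l) ⟨by omega, by omega, rfl⟩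
      rw [← deleteRow_append, deleteRow_of_rowOK (by exact this.2.1)]
      exact this
    · have := isWeb_gen (n := n) (g := .split k l) ⟨by omega, by omega, by omega⟩
      rw [← deleteRow_append, deleteRow_of_rowOK (by exact this.1),
        deleteRow_of_rowOK (by exact this.2.1)]
      exact this
  | tagOut k l =>
    have := isWeb_gen (n := n) (g := .tagOut k l) h
    rw [deleteRow_of_rowOK this.1, deleteRow_of_rowOK this.2.1]
    exact this
  | tagIn k l =>
    have := isWeb_gen (n := n) (g := .tagIn k l) h
    rw [deleteRow_of_rowOK this.1, deleteRow_of_rowOK this.2.1]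
    exact this

/-- Deleting the strands labelled `0` or `n` produces a web. -/
theorem ExtWeb.delete {s t : List Strand} {w : Word} (h : ExtWeb n s w t) :
    IsWeb n (deleteRow n s) (delete n c w) (deleteRow n t) := by
  induction w generalizing s with
  | nil => rw [extWeb_nil] at h; subst h; exact IsWeb.refl (rowOK_deleteRow s)
  | cons σ w ih =>
    rw [extWeb_cons] at h
    obtain ⟨rfl, hσ, hw⟩ := h
    rw [delete_cons]
    refine IsWeb.append ?_ (ih hw)
    simpa [Slice.src, Slice.tgt] using (isWeb_delete_gen (c := c) hσ).whisker
      (rowOK_deleteRow σ.left) (rowOK_deleteRow σ.right)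

theorem delete_cups (s : List Strand) : delete n c (cups s) = cups (deleteRow n s) := by
  induction s with
  | nil => rfl
  | cons x s ih =>
    rw [deleteRow_cons, cups_append]
    by_cases h : 0 < x.label ∧ x.label < n <;>
      simp [cups, delete_cons, ih, Gen.delete, deleteRow_singleton, h]

theorem delete_caps (s : List Strand) : delete n c (caps s) = caps (deleteRow n s) := by
  induction s with
  | nil => rfl
  | cons x s ih =>
    rw [deleteRow_cons, caps_append]
    by_cases h : 0 < x.label ∧ x.label < n <;>
      simp [caps, delete_cons, ih, Gen.delete, deleteRow_singleton, h]

theorem delete_rotW (s t : List Strand) (w : Word) :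
    delete n c (rotW s t w) = rotW (deleteRow n s) (deleteRow n t) (delete n c w) := by
  simp [rotW, delete_cups, delete_caps]

theorem mirror_delete (w : Word) :
    mirror (delete n .toward w) = delete n .toward (mirror w) := by
  induction w with
  | nil => rfl
  | cons σ w ih =>
    have : mirror (σ.gen.delete n .toward) = σ.gen.mirror.delete n .toward := by
      cases σ.gen with
      | merge k l =>
        simp only [Gen.delete, Gen.mirror, or_comm (a := l = 0), add_comm l k]
        split_ifs <;> simp [Convention.inTag, Gen.mirror]
      | split k l =>
        simp only [Gen.delete, Gen.mirror, or_comm (a := l = 0), add_comm l k]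
        split_ifs <;> simp [Gen.mirror]
      | cup x =>
        by_cases h : 0 < x.label ∧ x.label < n <;> simp [Gen.delete, Gen.mirror, h]
      | cap x =>
        by_cases h : 0 < x.label ∧ x.label < n <;> simp [Gen.delete, Gen.mirror, h]
      | tagOut k l => simp [Gen.delete, Gen.mirror]
      | tagIn k l => simp [Gen.delete, Gen.mirror]
    simp [delete_cons, ih, this]

/-- This needs the convention `toward`, under which incoming and outgoing vertices are treated
alike. -/
theorem flip_delete (w : Word) :
    flip (delete n .toward w) = delete n .toward (flip w) := by
  induction w with
  | nil => rfl
  | cons σ w ih =>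
    have : flip (σ.gen.delete n .toward) = σ.gen.flip.delete n .toward := by
      cases σ.gen <;> simp only [Gen.delete, Gen.flip] <;> (try split_ifs) <;>
        simp [Convention.inTag, Gen.flip]
    simp [delete_cons, ih, this]

/-! ### Reversal of arrows -/

theorem reverse_cons (σ : Slice) (w : Word) :
    reverse (σ :: w) = whisker (σ.left.map Strand.dual) σ.gen.reverse (σ.right.map Strand.dual) ++
      reverse w := rfl

theorem iso_rotW_cup {x : Strand} (hx : 0 < x.label ∧ x.label < n) :
    Iso n [] [x, x.dual] [⟨[], .cup x, []⟩] (rotW [x, x.dual] [] [⟨[], .cap x, []⟩]) := by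
  have hc := isWeb_gen (n := n) (g := .cap x) hx
  have hy := isWeb_gen (n := n) (g := .cup x) hx
  refine Iso.of_ev hy (by simpa [Gen.src, Gen.tgt] using hc.rotW) ?_
  have := ev_eq_rotW (n := n) (R := ∅) (s := [x, x.dual]) (t := []) (w := [⟨[], .cap x, []⟩])
    (y := [⟨[], .cup x, []⟩]) (a := []) (b := []) (by simpa [Gen.src, Gen.tgt] using hy.2.2.2)
    (fun b => ?_)
  · simpa using this
  have h1 := cup_mul_cap (n := n) (R := ∅) x [] (x.dual :: b)
  have h2 := idem_mul_piece (n := n) (R := ∅) (s := x :: x.dual :: b) (a := []) (b := b)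
    (g := .cap x) (by simp [Gen.src])
  simp only [List.nil_append] at h1
  simp only [caps, ev_cons, ev_nil, mul_one, dualRow_nil, List.nil_append, List.append_nil,
    dualRow_cons, Strand.dual_dual, List.cons_append]
  rw [← mul_assoc (piece _ _ _ _ _), h1, h2, h2]

theorem iso_rotW_cap {x : Strand} (hx : 0 < x.label ∧ x.label < n) :
    Iso n [x, x.dual] [] [⟨[], .cap x, []⟩] (rotW [] [x, x.dual] [⟨[], .cup x, []⟩]) := by
  have hc := isWeb_gen (n := n) (g := .cup x) hx
  have hy := isWeb_gen (n := n) (g := .cap x) hx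
  refine Iso.of_ev hy (by simpa [Gen.src, Gen.tgt] using hc.rotW) ?_
  have := ev_eq_rotW (n := n) (R := ∅) (s := []) (t := [x, x.dual]) (w := [⟨[], .cup x, []⟩])
    (y := [⟨[], .cap x, []⟩]) (a := []) (b := []) (by simpa [Gen.src, Gen.tgt] using hy.2.2.2)
    (fun b => ?_)
  · simpa using this
  have h1 := cup_mul_cap' (n := n) (R := ∅) x.dual [x] b
  have h2 := idem_mul_piece (n := n) (R := ∅) (s := x :: x.dual :: b) (a := []) (b := b)
    (g := .cap x) (by simp [Gen.src])
  simp only [List.cons_append, List.nil_append, Strand.dual_dual] at h1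
  simp only [caps, ev_cons, ev_nil, mul_one, dualRow_nil, List.nil_append, List.append_nil,
    dualRow_cons, Strand.dual_dual, List.cons_append]
  rw [← mul_assoc (piece _ _ _ _ _), h1, h2, idem_mul_piece (by simp [Gen.src])]

/-- Reversing the arrows of a diagram is the same as rotating it by half a turn after reflecting
it in both directions. -/
theorem iso_delete_reverse {s t : List Strand} {w : Word} (hw : ExtWeb n s w t) :
    Iso n ((deleteRow n s).map Strand.dual) ((deleteRow n t).map Strand.dual)
      (delete n c (reverse w))
      (rotW (deleteRow n t).reverse (deleteRow n s).reverse (delete n c (flip (mirror w)))) := by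
  induction w generalizing s with
  | nil =>
    rw [extWeb_nil] at hw
    subst hw
    simpa [reverse] using (iso_rotW_nil (s := (deleteRow n s).reverse) (by simp)).symm
  | cons σ w ih =>
    rw [extWeb_cons] at hw
    obtain ⟨rfl, hσ, hw⟩ := hw
    have key : Iso n ((deleteRow n σ.gen.src).map Strand.dual)
        ((deleteRow n σ.gen.tgt).map Strand.dual) (delete n c σ.gen.reverse)
        (rotW (deleteRow n σ.gen.tgt).reverse (deleteRow n σ.gen.src).reverse
          (delete n c [⟨[], σ.gen.mirror.flip, []⟩])) := by
      have hvert : ∀ g : Gen, g.Ext n → g.reverse = g.mirror.flip.rot →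
          Iso n ((deleteRow n g.src).map Strand.dual)
            ((deleteRow n g.tgt).map Strand.dual) (delete n c g.reverse)
            (rotW (deleteRow n g.tgt).reverse (deleteRow n g.src).reverse
              (delete n c [⟨[], g.mirror.flip, []⟩])) := by
        intro g hg e
        rw [e, Gen.rot_eq, delete_rotW]
        have := ((extWeb_gen hg.mirror.flip).delete (c := c)).rotW
        simp only [Gen.src_flip, Gen.tgt_flip, Gen.src_mirror, Gen.tgt_mirror, deleteRow_reverse,
          dualRow_reverse] at this ⊢
        exact Iso.refl this
      cases hg : σ.gen with
      | cup x =>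
        by_cases hx : 0 < x.label ∧ x.label < n
        · have h1 := iso_rotW_cup (n := n) (x := x.dual) (by simpa)
          have h2 : deleteRow n [x, x.dual] = [x, x.dual] :=
            deleteRow_of_rowOK (by simp [hx])
          simpa [Gen.src, Gen.tgt, Gen.reverse, Gen.mirror, Gen.flip, Gen.delete, hx, h2] using h1
        · have h2 : deleteRow n [x, x.dual] = [] := by
            rw [deleteRow_cons]; simp [deleteRow_singleton, hx]
          simpa [Gen.src, Gen.tgt, Gen.reverse, Gen.mirror, Gen.flip, Gen.delete, hx, h2] using
            (iso_rotW_nil (n := n) (s := []) (by simp)).symm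
      | cap x =>
        by_cases hx : 0 < x.label ∧ x.label < n
        · have h1 := iso_rotW_cap (n := n) (x := x.dual) (by simpa)
          have h2 : deleteRow n [x, x.dual] = [x, x.dual] :=
            deleteRow_of_rowOK (by simp [hx])
          simpa [Gen.src, Gen.tgt, Gen.reverse, Gen.mirror, Gen.flip, Gen.delete, hx, h2] using h1
        · have h2 : deleteRow n [x, x.dual] = [] := by
            rw [deleteRow_cons]; simp [deleteRow_singleton, hx]
          simpa [Gen.src, Gen.tgt, Gen.reverse, Gen.mirror, Gen.flip, Gen.delete, hx, h2] using
            (iso_rotW_nil (n := n) (s := []) (by simp)).symm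
      | merge k l => exact hvert _ (hg ▸ hσ) rfl
      | split k l => exact hvert _ (hg ▸ hσ) rfl
      | tagOut k l => exact hvert _ (hg ▸ hσ) rfl
      | tagIn k l => exact hvert _ (hg ▸ hσ) rfl
    have h1 := key.whisker (a := (deleteRow n σ.left).map Strand.dual)
      (b := (deleteRow n σ.right).map Strand.dual) (by simp) (by simp)
    have hg : IsWeb n (deleteRow n σ.gen.tgt).reverse
        (delete n c [⟨[], σ.gen.mirror.flip, []⟩]) (deleteRow n σ.gen.src).reverse := by
      simpa using (extWeb_gen hσ.mirror.flip).delete (c := c)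
    have h2 := iso_rotW_whisker (a := (deleteRow n σ.right).reverse)
      (b := (deleteRow n σ.left).reverse) (by simp) (by simp) hg
    have h3 : Iso n ((deleteRow n σ.src).map Strand.dual) ((deleteRow n σ.tgt).map Strand.dual)
        (whisker ((deleteRow n σ.left).map Strand.dual) (delete n c σ.gen.reverse)
          ((deleteRow n σ.right).map Strand.dual))
        (rotW (deleteRow n σ.tgt).reverse (deleteRow n σ.src).reverse
          (delete n c [⟨σ.right.reverse, σ.gen.mirror.flip, σ.left.reverse⟩])) := by
      refine (by simpa [Slice.src, Slice.tgt] using h1 : Iso n _ _ _ _).trans ?_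
      simpa [Slice.src, Slice.tgt, delete_cons] using h2.symm
    have hw1 : IsWeb n (deleteRow n t).reverse (delete n c (flip (mirror w)))
        (deleteRow n σ.tgt).reverse := by
      simpa using (hw.mirror.flip).delete (c := c)
    have hw2 : IsWeb n (deleteRow n σ.tgt).reverse
        (delete n c [⟨σ.right.reverse, σ.gen.mirror.flip, σ.left.reverse⟩])
        (deleteRow n σ.src).reverse := by
      have := hg.whisker (a := (deleteRow n σ.right).reverse) (b := (deleteRow n σ.left).reverse)
        (by simp) (by simp)
      simpa [Slice.src, Slice.tgt, delete_cons] using this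
    have h4 := iso_rotW_append hw1 hw2
    rw [reverse_cons, delete_append, delete_whisker, mirror_cons, flip_cons, delete_append]
    simp only [dualRow_reverse, deleteRow_map_dual] at h4 ⊢
    exact (h3.append (ih hw)).trans h4.symm

end

noncomputable section

/-! ### Quantum integers -/

theorem q_ne_zero : q ≠ 0 := RatFunc.X_ne_zero

theorem q_pow_ne_one {k : ℕ} (hk : k ≠ 0) : q ^ k ≠ 1 := by
  intro h
  have h1 : algebraMap (Polynomial ℚ) (RatFunc ℚ) (Polynomial.X ^ k) =
      algebraMap (Polynomial ℚ) (RatFunc ℚ) 1 := by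
    rw [map_pow, RatFunc.algebraMap_X, map_one]; exact h
  have h2 := congrArg Polynomial.natDegree (RatFunc.algebraMap_injective ℚ h1)
  simp at h2
  exact hk h2

theorem q_zpow_ne {m : ℕ} (hm : m ≠ 0) : q ^ (m : ℤ) - q ^ (-(m : ℤ)) ≠ 0 := by
  intro h
  refine q_pow_ne_one (k := m + m) (by omega) ?_
  rw [sub_eq_zero, zpow_neg, zpow_natCast] at h
  rw [pow_add]
  nth_rewrite 1 [h]
  exact inv_mul_cancel₀ (pow_ne_zero _ q_ne_zero)

theorem q_sub_inv_ne_zero : q - q⁻¹ ≠ 0 := by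
  simpa using q_zpow_ne (m := 1) one_ne_zero

theorem qNat_mul (m : ℕ) : qNat m * (q - q⁻¹) = q ^ (m : ℤ) - q ^ (-(m : ℤ)) := by
  have key : ∀ (c : ℤ) (m : ℕ), (∑ i ∈ Finset.range m, q ^ (2 * (i : ℤ) + 1 - c)) * (q - q⁻¹) =
      q ^ (2 * (m : ℤ) - c) - q ^ (-c) := by
    intro c m
    induction m with
    | zero => simp
    | succ m ih =>
      rw [Finset.sum_range_succ, add_mul, ih]
      have h1 : q ^ (2 * (m : ℤ) + 1 - c) * q = q ^ (2 * ((m + 1 : ℕ) : ℤ) - c) := by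
        rw [← zpow_add_one₀ q_ne_zero]; congr 1; push_cast; ring
      have h2 : q ^ (2 * (m : ℤ) + 1 - c) * q⁻¹ = q ^ (2 * (m : ℤ) - c) := by
        rw [← zpow_sub_one₀ q_ne_zero]; congr 1; ring
      rw [mul_sub, h1, h2]; ring
  rw [qNat, key]
  congr 2; ring

theorem qInt_mul (m : ℤ) : qInt m * (q - q⁻¹) = q ^ m - q ^ (-m) := by
  rw [qInt, mul_assoc, qNat_mul]
  rcases lt_trichotomy m 0 with h | rfl | h
  · have : (m.natAbs : ℤ) = -m := by omega
    rw [this, Int.sign_eq_neg_one_of_neg h]; push_cast; rw [neg_neg]; ring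
  · simp
  · have : (m.natAbs : ℤ) = m := by omega
    rw [this, Int.sign_eq_one_of_pos h]; push_cast; ring

theorem qInt_natCast (m : ℕ) : qInt m = qNat m :=
  mul_right_cancel₀ q_sub_inv_ne_zero (by rw [qInt_mul, qNat_mul])

@[simp] theorem qNat_zero : qNat 0 = 0 := by simp [qNat]

@[simp] theorem qNat_one : qNat 1 = 1 := by simp [qNat]

theorem qNat_succ_ne_zero (m : ℕ) : qNat (m + 1) ≠ 0 := by
  intro h
  have := qNat_mul (m + 1)
  rw [h, zero_mul] at this
  exact q_zpow_ne (Nat.succ_ne_zero m) this.symm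

theorem qNat_ne_zero {m : ℕ} (h : 0 < m) : qNat m ≠ 0 := by
  obtain ⟨m, rfl⟩ := Nat.exists_eq_succ_of_ne_zero h.ne'
  exact qNat_succ_ne_zero m

theorem qInt_neg (m : ℤ) : qInt (-m) = -qInt m := by simp [qInt]

theorem qInt_ne_zero {m : ℤ} (h : m ≠ 0) : qInt m ≠ 0 := by
  rw [qInt]
  refine mul_ne_zero ?_ (qNat_ne_zero (Int.natAbs_pos.2 h))
  exact_mod_cast Int.sign_eq_zero_iff_zero.not.2 h

/-- The basic quadratic identity between quantum integers. -/
theorem qInt_mul_sub (x y t : ℤ) :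
    qInt x * qInt y - qInt (x - t) * qInt (y - t) = qInt t * qInt (x + y - t) := by
  refine mul_right_cancel₀ q_sub_inv_ne_zero (mul_right_cancel₀ q_sub_inv_ne_zero ?_)
  have e : ∀ a b : ℤ, qInt a * qInt b * (q - q⁻¹) * (q - q⁻¹) =
      q ^ (a + b) - q ^ (a - b) - q ^ (b - a) + q ^ (-(a + b)) := by
    intro a b
    have : qInt a * qInt b * (q - q⁻¹) * (q - q⁻¹) =
        (qInt a * (q - q⁻¹)) * (qInt b * (q - q⁻¹)) := by ring
    rw [this, qInt_mul, qInt_mul]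
    simp only [sub_mul, mul_sub, ← zpow_add₀ q_ne_zero]
    rw [← sub_eq_add_neg a b, neg_add_eq_sub, ← neg_add]; ring
  rw [sub_mul, sub_mul, e, e, e]
  ring_nf

@[simp] theorem qBinom_zero (m : ℤ) : qBinom m 0 = 1 := by simp [qBinom]

theorem qBinom_succ (m : ℤ) (t : ℕ) :
    qNat (t + 1) * qBinom m (t + 1) = qBinom m t * qInt (m - t) := by
  rw [qBinom, Finset.prod_range_succ, ← qBinom]
  field_simp [qNat_succ_ne_zero t]

theorem qBinom_succ_succ (m : ℤ) (t : ℕ) :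
    qNat (t + 1) * qBinom (m + 1) (t + 1) = qInt (m + 1) * qBinom m t := by
  induction t with
  | zero => simp [qBinom]
  | succ t ih =>
    have h1 := qBinom_succ (m + 1) (t + 1)
    have h2 := qBinom_succ m t
    refine mul_left_cancel₀ (qNat_succ_ne_zero t) ?_
    rw [h1]
    have e : m + 1 - ((t + 1 : ℕ) : ℤ) = m - t := by push_cast; ring
    rw [e, ← mul_assoc, ih, mul_assoc, ← h2]; ring

theorem qBinom_one (m : ℤ) : qBinom m 1 = qInt m := by simp [qBinom]

@[simp] theorem qBinom_self (m : ℕ) : qBinom m m = 1 := by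
  induction m with
  | zero => simp
  | succ m ih =>
    have := qBinom_succ_succ m m
    rw [ih, mul_one] at this
    push_cast
    refine mul_left_cancel₀ (qNat_succ_ne_zero m) ?_
    rw [this, mul_one]
    exact_mod_cast qInt_natCast (m + 1)

theorem qBinom_succ_self (m : ℕ) : qBinom ((m : ℤ) + 1) m = qNat (m + 1) := by
  induction m with
  | zero => simp
  | succ m ih =>
    have := qBinom_succ_succ (m + 1) m
    rw [ih] at this
    push_cast
    refine mul_left_cancel₀ (qNat_succ_ne_zero m) ?_
    rw [this, mul_comm]
    congr 1
    exact_mod_cast qInt_natCast (m + 2)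

theorem qBinom_eq_zero_iff {m : ℤ} {t : ℕ} : qBinom m t = 0 ↔ 0 ≤ m ∧ m < t := by
  constructor
  · intro h
    obtain ⟨i, hi, h⟩ := Finset.prod_eq_zero_iff.1 h
    rw [div_eq_zero_iff] at h
    rcases h with h | h
    · have : m - i = 0 := by
        by_contra h'
        exact qInt_ne_zero h' h
      have := Finset.mem_range.1 hi
      omega
    · exact absurd h (qNat_succ_ne_zero i)
  · rintro ⟨h1, h2⟩
    refine Finset.prod_eq_zero (i := m.toNat) (by simp; omega) ?_
    have : m - (m.toNat : ℤ) = 0 := by omega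
    rw [this]; simp [qInt]

theorem qBinom_eq_zero {m t : ℕ} (h : m < t) : qBinom m t = 0 :=
  qBinom_eq_zero_iff.2 ⟨by omega, by exact_mod_cast h⟩

/-- The recursion for the coefficients of the commutation formula of divided powers. -/
theorem qBinom_rec (b : ℤ) (r t : ℕ) :
    qInt ((r : ℤ) - t) * qBinom (b + 1) (t + 1) + qInt (b - r) * qBinom b t =
      qNat (r + 1) * qBinom b (t + 1) := by
  refine mul_left_cancel₀ (qNat_succ_ne_zero t) ?_
  have h1 := qBinom_succ_succ b t
  have h2 := qBinom_succ b t
  rw [← qInt_natCast (r + 1)]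
  have e : qInt ((r : ℤ) + 1) * qInt (b - t) - qInt ((r : ℤ) - t) * qInt (b + 1) =
      qInt ((t + 1 : ℕ) : ℤ) * qInt (b - r) := by
    have h := qInt_mul_sub ((r : ℤ) + 1) (-(b - t)) (t + 1)
    rw [show (r : ℤ) + 1 - (t + 1) = r - t by ring,
      show -(b - t) - ((t : ℤ) + 1) = -(b + 1) by ring,
      show (r : ℤ) + 1 + -(b - t) - (t + 1) = -(b - r) by ring, qInt_neg, qInt_neg, qInt_neg] at h
    push_cast
    linear_combination -h
  push_cast at e ⊢
  rw [mul_add, mul_left_comm, h1, mul_left_comm (qNat (t + 1)) (qInt _) (qBinom b (t + 1)), h2]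
  have e' := qInt_natCast (t + 1)
  push_cast at e'
  rw [← e']
  linear_combination (-qBinom b t) * e

/-! ### Commutation of divided powers -/

/-- Divided powers `E r`, `F s` acting on weights `(k, l)` with `k + l = N` and `k, l ≤ n`:
`E r k l` leads from `(k, l)` to `(k + r, l - r)` and `F s k l` from `(k, l)` to `(k - s, l + s)`.
They vanish if the target weight is out of range. Products are read in the order of
application. -/
structure DividedPowers (n N : ℕ) (A : Type*) [Ring A] [Algebra K A] where
  e : ℕ → ℕ → A
  E : ℕ → ℕ → ℕ → A
  F : ℕ → ℕ → ℕ → A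
  E_zero : ∀ k l, k + l = N → k ≤ n → l ≤ n → E 0 k l = e k l
  F_zero : ∀ k l, k + l = N → k ≤ n → l ≤ n → F 0 k l = e k l
  E_out : ∀ r k l, k + l = N → ¬ (r ≤ l ∧ k + r ≤ n) → E r k l = 0
  F_out : ∀ s k l, k + l = N → ¬ (s ≤ k ∧ l + s ≤ n) → F s k l = 0
  e_mul_E : ∀ r k l, k + l = N → k ≤ n → l ≤ n → e k l * E r k l = E r k l
  E_mul_e : ∀ r k l, k + l = N → k ≤ n → l ≤ n → E r k l * e (k + r) (l - r) = E r k l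
  e_mul_F : ∀ s k l, k + l = N → k ≤ n → l ≤ n → e k l * F s k l = F s k l
  F_mul_e : ∀ s k l, k + l = N → k ≤ n → l ≤ n → F s k l * e (k - s) (l + s) = F s k l
  E_succ : ∀ r k l, k + l = N → k ≤ n → l ≤ n → 0 < l → k < n →
    E 1 k l * E r (k + 1) (l - 1) = qNat (r + 1) • E (r + 1) k l
  F_succ : ∀ s k l, k + l = N → k ≤ n → l ≤ n → s ≤ k → l + s ≤ n →
    F s k l * F 1 (k - s) (l + s) = qNat (s + 1) • F (s + 1) k l
  comm : ∀ k l, k + l = N → k ≤ n → l ≤ n →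
    F 1 k l * E 1 (k - 1) (l + 1) = E 1 k l * F 1 (k + 1) (l - 1) + qInt ((k : ℤ) - l) • e k l

namespace DividedPowers

variable {n N : ℕ} {A : Type*} [Ring A] [Algebra K A] (D : DividedPowers n N A)

/-- Commuting one `E` past a divided power of `F`, by induction on the divided power: since
`[s + 2]` is invertible, `F (s + 2)` may be replaced with the product of `F (s + 1)` and `F 1`. -/
theorem F_mul_E_one (s k l : ℕ) (hN : k + l = N) (hk : k ≤ n) (hl : l ≤ n) :
    D.F (s + 1) k l * D.E 1 (k - (s + 1)) (l + (s + 1)) =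
      D.E 1 k l * D.F (s + 1) (k + 1) (l - 1) + qInt ((k : ℤ) - l - s) • D.F s k l := by
  induction s with
  | zero => simpa [D.F_zero k l hN hk hl] using D.comm k l hN hk hl
  | succ s ih =>
    by_cases hs : s + 1 ≤ k ∧ l + (s + 1) ≤ n
    · refine smul_right_injective A (qNat_succ_ne_zero (s + 1)) ?_
      simp only [smul_add]
      rw [← smul_mul_assoc, ← D.F_succ (s + 1) k l hN hk hl hs.1 hs.2, mul_assoc]
      have h1 := D.comm (k - (s + 1)) (l + (s + 1)) (by omega) (by omega) (by omega)
      have e1 : k - (s + 1 + 1) = k - (s + 1) - 1 := by omega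
      have e2 : l + (s + 1 + 1) = l + (s + 1) + 1 := by omega
      rw [e1, e2, h1, mul_add, mul_smul_comm, D.F_mul_e (s + 1) k l hN hk hl, ← mul_assoc, ih,
        add_mul, mul_assoc, smul_mul_assoc]
      have e3 : k - (s + 1) + 1 = k - s := by omega
      have e4 : l + (s + 1) - 1 = l + s := by omega
      rw [e3, e4, D.F_succ s k l hN hk hl (by omega) (by omega)]
      have h2 : D.E 1 k l * (D.F (s + 1) (k + 1) (l - 1) * D.F 1 (k - s) (l + s)) =
          qNat (s + 1 + 1) • (D.E 1 k l * D.F (s + 1 + 1) (k + 1) (l - 1)) := by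
        by_cases h : 0 < l ∧ k < n
        · have := D.F_succ (s + 1) (k + 1) (l - 1) (by omega) (by omega) (by omega) (by omega)
            (by omega)
          have e5 : k + 1 - (s + 1) = k - s := by omega
          have e6 : l - 1 + (s + 1) = l + s := by omega
          rw [e5, e6] at this
          rw [this, mul_smul_comm]
        · rw [D.E_out 1 k l hN (by omega)]; simp
      rw [h2, add_assoc, smul_smul, ← add_smul, smul_smul]
      congr 2
      have h3 := qInt_mul_sub ((s : ℤ) + 2) (-((k : ℤ) - l - (s + 1))) 1
      have e7 : qInt 1 = 1 := by simpa using qInt_natCast 1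
      rw [show (s : ℤ) + 2 - 1 = s + 1 by ring,
        show -((k : ℤ) - l - (s + 1)) - 1 = -((k : ℤ) - l - s) by ring,
        show (s : ℤ) + 2 + -((k : ℤ) - l - (s + 1)) - 1 = -((k : ℤ) - l - s - s - 2) by ring,
        qInt_neg, qInt_neg, qInt_neg, e7] at h3
      rw [← qInt_natCast, ← qInt_natCast, show ((k - (s + 1) : ℕ) : ℤ) - ((l + (s + 1) : ℕ) : ℤ) =
        (k : ℤ) - l - s - s - 2 by push_cast [Nat.cast_sub hs.1]; ring]
      push_cast
      rw [show (s : ℤ) + 1 + 1 = s + 2 by ring]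
      linear_combination h3
    · rw [D.F_out (s + 1 + 1) k l hN (by omega), D.F_out (s + 1) k l hN hs, zero_mul, smul_zero,
        add_zero]
      by_cases h : 0 < l ∧ k < n
      · rw [D.F_out (s + 1 + 1) (k + 1) (l - 1) (by omega) (by omega), mul_zero]
      · rw [D.E_out 1 k l hN (by omega), zero_mul]

/-- The term of index `t` in the commutation formula. -/
def term (k l r s t : ℕ) : A :=
  if t ≤ r then D.E (r - t) k l * D.F (s - t) (k + (r - t)) (l - (r - t)) else 0

theorem E_one_mul_term (k l r s t : ℕ) (hN : k + l = N) (hk : k < n) (hl : l ≤ n) (hl' : 0 < l) :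
    D.E 1 k l * D.term (k + 1) (l - 1) r s t =
      qInt ((r : ℤ) + 1 - t) • D.term k l (r + 1) s t := by
  unfold term
  rcases lt_trichotomy t (r + 1) with h | rfl | h
  · rw [if_pos (by omega), if_pos (by omega), ← mul_assoc, D.E_succ (r - t) k l hN hk.le hl hl' hk,
      smul_mul_assoc, ← qInt_natCast]
    have e1 : ((r - t + 1 : ℕ) : ℤ) = (r : ℤ) + 1 - t := by omega
    have e2 : r - t + 1 = r + 1 - t := by omega
    have e3 : k + 1 + (r - t) = k + (r + 1 - t) := by omega
    have e4 : l - 1 - (r - t) = l - (r + 1 - t) := by omega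
    rw [e1, e2, e3, e4]
  · have e7 : qInt 0 = 0 := by simp [qInt]
    simp [e7]
  · rw [if_neg (by omega), if_neg (by omega)]; simp

theorem E_out_term (k l r s t : ℕ) (hN : k + l = N) (h : ¬ (0 < l ∧ k < n)) (ht : t < r) :
    D.term k l r s t = 0 := by
  unfold term
  rw [if_pos ht.le, D.E_out _ _ _ hN (by omega), zero_mul]

/-- The commutation formula with all terms kept; those with `t > r` are zero. The induction on `r`
splits off the factor `E 1` next to `F` and combines neighbouring terms by `qBinom_rec`. -/
theorem F_mul_E_aux (r : ℕ) : ∀ s k l : ℕ, k + l = N → k ≤ n → l ≤ n →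
    D.F s k l * D.E r (k - s) (l + s) =
      ∑ t ∈ Finset.range (s + 1), qBinom ((k : ℤ) - l + r - s) t • D.term k l r s t := by
  induction r with
  | zero =>
    intro s k l hN hk hl
    rw [Finset.sum_eq_single 0 (fun t _ ht => by rw [term, if_neg (by omega), smul_zero])
      (by simp)]
    rw [term, if_pos le_rfl, qBinom_zero, one_smul]
    by_cases hs : s ≤ k ∧ l + s ≤ n
    · rw [D.E_zero (k - s) (l + s) (by omega) (by omega) (by omega), D.F_mul_e s k l hN hk hl]
      simp [D.E_zero k l hN hk hl, D.e_mul_F s k l hN hk hl]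
    · simp [D.F_out s k l hN hs]
  | succ r ih =>
    intro s k l hN hk hl
    rcases s with _ | s
    · simp only [zero_add, Finset.sum_range_one, term, if_pos (Nat.zero_le _), qBinom_zero,
        one_smul, Nat.sub_zero, add_zero, D.F_zero k l hN hk hl]
      rw [D.e_mul_E _ k l hN hk hl]
      by_cases h : r + 1 ≤ l ∧ k + (r + 1) ≤ n
      · rw [D.F_zero _ _ (by omega) (by omega) (by omega), D.E_mul_e _ k l hN hk hl]
      · rw [D.E_out _ k l hN h, zero_mul]
    · have key : qNat (r + 1) • (D.F (s + 1) k l * D.E (r + 1) (k - (s + 1)) (l + (s + 1))) =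
          (D.E 1 k l * D.F (s + 1) (k + 1) (l - 1) + qInt ((k : ℤ) - l - s) • D.F s k l) *
            D.E r (k - s) (l + s) := by
        rw [← D.F_mul_E_one s k l hN hk hl]
        by_cases hs : s + 1 ≤ k ∧ l + (s + 1) ≤ n
        · have := D.E_succ r (k - (s + 1)) (l + (s + 1)) (by omega) (by omega) (by omega)
            (by omega) (by omega)
          have e1 : k - (s + 1) + 1 = k - s := by omega
          rw [e1, show l + (s + 1) - 1 = l + s by omega] at this
          rw [← mul_smul_comm, ← this, mul_assoc]
        · simp [D.F_out (s + 1) k l hN hs]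
      refine smul_right_injective A (qNat_succ_ne_zero r) ?_
      simp only
      rw [key, add_mul, smul_mul_assoc, ih s k l hN hk hl]
      have h1 : D.E 1 k l * D.F (s + 1) (k + 1) (l - 1) * D.E r (k - s) (l + s) =
          ∑ t ∈ Finset.range (s + 1 + 1), (qBinom ((k : ℤ) - l + (r + 1) - (s + 1) + 1) t *
            qInt ((r : ℤ) + 1 - t)) • D.term k l (r + 1) (s + 1) t := by
        by_cases h : 0 < l ∧ k < n
        · have := ih (s + 1) (k + 1) (l - 1) (by omega) (by omega) (by omega)
          rw [show k + 1 - (s + 1) = k - s by omega, show l - 1 + (s + 1) = l + s by omega] at this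
          rw [mul_assoc, this, Finset.mul_sum]
          refine Finset.sum_congr rfl fun t _ => ?_
          rw [mul_smul_comm, D.E_one_mul_term k l r (s + 1) t hN h.2 hl h.1, smul_smul]
          congr 3
          push_cast [Nat.cast_sub h.1]
          ring
        · rw [D.E_out 1 k l hN (by omega), zero_mul, zero_mul]
          refine (Finset.sum_eq_zero fun t _ => ?_).symm
          rcases lt_trichotomy t (r + 1) with h' | rfl | h'
          · rw [D.E_out_term k l (r + 1) (s + 1) t hN h h', smul_zero]
          · have e7 : qInt 0 = 0 := by simp [qInt]
            simp [e7]
          · rw [term, if_neg (by omega), smul_zero]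
      rw [h1, Finset.sum_range_succ' _ (s + 1), Finset.smul_sum, Finset.smul_sum,
        Finset.sum_range_succ' _ (s + 1), add_right_comm, ← Finset.sum_add_distrib]
      congr 1
      · refine Finset.sum_congr rfl fun t _ => ?_
        have e1 : D.term k l r s t = D.term k l (r + 1) (s + 1) (t + 1) := by
          simp [term]
        rw [e1, smul_smul, smul_smul, ← add_smul]
        congr 1
        have h2 := qBinom_rec ((k : ℤ) - l + (r + 1) - (s + 1)) r t
        push_cast
        rw [show (k : ℤ) - l + (r + 1) - (s + 1) - r = k - l - s by ring] at h2
        rw [show (r : ℤ) + 1 - (t + 1) = r - t by ring, show (k : ℤ) - l + r - s =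
          k - l + (r + 1) - (s + 1) by ring, mul_comm (qBinom _ _)]
        exact h2
      · have := qInt_natCast (r + 1)
        push_cast at this
        simp [this]

/-- The commutation formula for divided powers. -/
theorem F_mul_E (s r k l : ℕ) (hN : k + l = N) (hk : k ≤ n) (hl : l ≤ n) :
    D.F s k l * D.E r (k - s) (l + s) =
      ∑ t ∈ Finset.range (min r s + 1), qBinom ((k : ℤ) - l + r - s) t •
        (D.E (r - t) k l * D.F (s - t) (k + (r - t)) (l - (r - t))) := by
  rw [D.F_mul_E_aux r s k l hN hk hl]
  refine (Finset.sum_subset (s₁ := Finset.range (min r s + 1)) ?_ ?_).symm.trans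
    (Finset.sum_congr rfl fun t ht => ?_)
  · intro t; simp only [Finset.mem_range]; omega
  · intro t h1 h2
    simp only [Finset.mem_range] at h1 h2
    rw [term, if_neg (by omega), smul_zero]
  · simp only [Finset.mem_range] at ht
    rw [term, if_pos (by omega)]

end DividedPowers

end

noncomputable section

/-! ### Ladders -/

/-- The diagrams built from merges and splits of upward strands labelled `0, …, n`, up to the
relations of the reduced list, as elements of an algebra: `e L` is the row `L`, and `mg L k l R`,
`sp L k l R` are the trivalent vertices between the rows `L` and `R`. Products are read from bottom
to top. -/
structure Ladder (n : ℕ) (A : Type*) [Ring A] [Algebra K A] where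
  e : List ℕ → A
  mg : List ℕ → ℕ → ℕ → List ℕ → A
  sp : List ℕ → ℕ → ℕ → List ℕ → A
  e_mul_e : ∀ L, e L * e L = e L
  e_mul_mg : ∀ L k l R, k + l ≤ n → e (L ++ k :: l :: R) * mg L k l R = mg L k l R
  mg_mul_e : ∀ L k l R, k + l ≤ n → mg L k l R * e (L ++ (k + l) :: R) = mg L k l R
  e_mul_sp : ∀ L k l R, k + l ≤ n → e (L ++ (k + l) :: R) * sp L k l R = sp L k l R
  sp_mul_e : ∀ L k l R, k + l ≤ n → sp L k l R * e (L ++ k :: l :: R) = sp L k l R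
  mg_mg : ∀ L k l M k' l' R, k + l ≤ n → k' + l' ≤ n →
    mg L k l (M ++ k' :: l' :: R) * mg (L ++ (k + l) :: M) k' l' R =
      mg (L ++ k :: l :: M) k' l' R * mg L k l (M ++ (k' + l') :: R)
  mg_sp : ∀ L k l M k' l' R, k + l ≤ n → k' + l' ≤ n →
    mg L k l (M ++ (k' + l') :: R) * sp (L ++ (k + l) :: M) k' l' R =
      sp (L ++ k :: l :: M) k' l' R * mg L k l (M ++ k' :: l' :: R)
  sp_mg : ∀ L k l M k' l' R, k + l ≤ n → k' + l' ≤ n →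
    sp L k l (M ++ k' :: l' :: R) * mg (L ++ k :: l :: M) k' l' R =
      mg (L ++ (k + l) :: M) k' l' R * sp L k l (M ++ (k' + l') :: R)
  sp_sp : ∀ L k l M k' l' R, k + l ≤ n → k' + l' ≤ n →
    sp L k l (M ++ (k' + l') :: R) * sp (L ++ k :: l :: M) k' l' R =
      sp (L ++ (k + l) :: M) k' l' R * sp L k l (M ++ k' :: l' :: R)
  assoc : ∀ L k l m R, k + l + m ≤ n →
    mg (L ++ [k]) l m R * mg L k (l + m) R = mg L k l (m :: R) * mg L (k + l) m R
  coassoc : ∀ L k l m R, k + l + m ≤ n →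
    sp L k (l + m) R * sp (L ++ [k]) l m R = sp L (k + l) m R * sp L k l (m :: R)
  digon_one : ∀ L k R, k + 1 ≤ n → sp L k 1 R * mg L k 1 R = qNat (k + 1) • e (L ++ (k + 1) :: R)
  digon_zero : ∀ L k R, k ≤ n → sp L k 0 R * mg L k 0 R = e (L ++ k :: R)
  digon_zero' : ∀ L k R, k ≤ n → sp L 0 k R * mg L 0 k R = e (L ++ k :: R)
  mg_sp_zero : ∀ L k R, k ≤ n → mg L k 0 R * sp L k 0 R = e (L ++ k :: 0 :: R)
  mg_sp_zero' : ∀ L k R, k ≤ n → mg L 0 k R * sp L 0 k R = e (L ++ 0 :: k :: R)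
  rung_zero : ∀ L k l R, k ≤ n → l ≤ n →
    sp L k 0 (l :: R) * mg (L ++ [k]) 0 l R = e (L ++ k :: l :: R)
  rung_zero' : ∀ L k l R, k ≤ n → l ≤ n →
    sp (L ++ [k]) 0 l R * mg L k 0 (l :: R) = e (L ++ k :: l :: R)
  square : ∀ L j R, j + 1 ≤ n →
    sp L j 1 (1 :: R) * (mg (L ++ [j]) 1 1 R * sp (L ++ [j]) 1 1 R) * mg L j 1 (1 :: R) =
      (if j + 2 ≤ n then mg L (j + 1) 1 R * sp L (j + 1) 1 R else 0) +
        qNat j • e (L ++ (j + 1) :: 1 :: R)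
  square' : ∀ L j R, j + 1 ≤ n →
    sp (L ++ [1]) 1 j R * (mg L 1 1 (j :: R) * sp L 1 1 (j :: R)) * mg (L ++ [1]) 1 j R =
      (if j + 2 ≤ n then mg L 1 (j + 1) R * sp L 1 (j + 1) R else 0) +
        qNat j • e (L ++ 1 :: (j + 1) :: R)

namespace Ladder

variable {n : ℕ} {A : Type*} [Ring A] [Algebra K A] (D : Ladder n A)

theorem digon (L : List ℕ) (k l : ℕ) (R : List ℕ) (h : k + l ≤ n) :
    D.sp L k l R * D.mg L k l R = qBinom ((k : ℤ) + l) l • D.e (L ++ (k + l) :: R) := by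
  induction l generalizing R with
  | zero => simpa using D.digon_zero L k R h
  | succ l ih =>
    refine smul_right_injective A (qNat_succ_ne_zero l) ?_
    simp only
    calc qNat (l + 1) • (D.sp L k (l + 1) R * D.mg L k (l + 1) R)
        = D.sp L k (l + 1) R * (D.sp (L ++ [k]) l 1 R * D.mg (L ++ [k]) l 1 R) *
            D.mg L k (l + 1) R := by
          rw [D.digon_one _ _ _ (by omega), mul_smul_comm, smul_mul_assoc]
          simp only [List.append_assoc, List.cons_append, List.nil_append]
          rw [D.sp_mul_e _ _ _ _ h]
      _ = D.sp L (k + l) 1 R * (D.sp L k l (1 :: R) * D.mg L k l (1 :: R)) *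
            D.mg L (k + l) 1 R := by
          have h1 := D.assoc L k l 1 R (by omega)
          have h2 := D.coassoc L k l 1 R (by omega)
          rw [← mul_assoc, h2, mul_assoc _ (D.mg (L ++ [k]) l 1 R), h1]
          simp only [mul_assoc]
      _ = _ := by
          have h1 := D.sp_mul_e L (k + l) 1 R (by omega)
          rw [ih _ (by omega), mul_smul_comm, h1, smul_mul_assoc, D.digon_one _ _ _ (by omega),
            smul_smul, smul_smul]
          congr 1
          have h2 := qBinom_succ_succ ((k : ℤ) + l) l
          push_cast
          rw [← add_assoc, h2, mul_comm, ← qInt_natCast]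
          push_cast; rfl

/-- The mirror image. -/
def mirror : Ladder n A where
  e L := D.e L.reverse
  mg L k l R := D.mg R.reverse l k L.reverse
  sp L k l R := D.sp R.reverse l k L.reverse
  e_mul_e L := D.e_mul_e _
  e_mul_mg L k l R h := by
    have := D.e_mul_mg R.reverse l k L.reverse (by omega)
    simpa [add_comm] using this
  mg_mul_e L k l R h := by
    have := D.mg_mul_e R.reverse l k L.reverse (by omega)
    simpa [add_comm] using this
  e_mul_sp L k l R h := by
    have := D.e_mul_sp R.reverse l k L.reverse (by omega)
    simpa [add_comm] using this
  sp_mul_e L k l R h := by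
    have := D.sp_mul_e R.reverse l k L.reverse (by omega)
    simpa [add_comm] using this
  mg_mg L k l M k' l' R h h' := by
    have := D.mg_mg R.reverse l' k' M.reverse l k L.reverse (by omega) (by omega)
    simpa [add_comm] using this.symm
  mg_sp L k l M k' l' R h h' := by
    have := D.sp_mg R.reverse l' k' M.reverse l k L.reverse (by omega) (by omega)
    simpa [add_comm] using this.symm
  sp_mg L k l M k' l' R h h' := by
    have := D.mg_sp R.reverse l' k' M.reverse l k L.reverse (by omega) (by omega)
    simpa [add_comm] using this.symm
  sp_sp L k l M k' l' R h h' := by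
    have := D.sp_sp R.reverse l' k' M.reverse l k L.reverse (by omega) (by omega)
    simpa [add_comm] using this.symm
  assoc L k l m R h := by
    have := D.assoc R.reverse m l k L.reverse (by omega)
    simpa [add_comm] using this.symm
  coassoc L k l m R h := by
    have := D.coassoc R.reverse m l k L.reverse (by omega)
    simpa [add_comm] using this.symm
  digon_one L k R h := by
    have := D.digon R.reverse 1 k L.reverse (by omega)
    have e1 : ((1 : ℕ) : ℤ) + k = k + 1 := by push_cast; ring
    rw [e1, qBinom_succ_self] at this
    simpa [add_comm] using this
  digon_zero L k R h := by simpa using D.digon_zero' R.reverse k L.reverse h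
  digon_zero' L k R h := by simpa using D.digon_zero R.reverse k L.reverse h
  mg_sp_zero L k R h := by simpa using D.mg_sp_zero' R.reverse k L.reverse h
  mg_sp_zero' L k R h := by simpa using D.mg_sp_zero R.reverse k L.reverse h
  rung_zero L k l R h h' := by simpa using D.rung_zero' R.reverse l k L.reverse h' h
  rung_zero' L k l R h h' := by simpa using D.rung_zero R.reverse l k L.reverse h' h
  square L j R h := by simpa using D.square' R.reverse j L.reverse h
  square' L j R h := by simpa using D.square R.reverse j L.reverse h

/-- A rung labelled `s` from left to right; zero if a label is out of range. -/
def rungF (s k l : ℕ) : A :=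
  if s ≤ k ∧ l + s ≤ n then D.sp [] (k - s) s [l] * D.mg [k - s] s l [] else 0

/-- A rung labelled `r` from right to left; zero if a label is out of range. -/
def rungE (r k l : ℕ) : A :=
  if r ≤ l ∧ k + r ≤ n then D.sp [k] r (l - r) [] * D.mg [] k r [l - r] else 0

theorem mirror_rungF (s k l : ℕ) : D.mirror.rungF s k l = D.rungE s l k := by
  simp [rungF, rungE, mirror]

theorem rungF_mul_rungF (r s k l : ℕ) (hk : k ≤ n) :
    D.rungF r k l * D.rungF s (k - r) (l + r) =
      qBinom ((r : ℤ) + s) r • D.rungF (r + s) k l := by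
  by_cases h : r + s ≤ k ∧ l + (r + s) ≤ n
  · obtain ⟨a, rfl⟩ := Nat.exists_eq_add_of_le h.1
    have e1 : r + s + a - r = a + s := by omega
    have e2 : a + s - s = a := by omega
    have e3 : r + s + a - (r + s) = a := by omega
    rw [rungF, rungF, rungF, if_pos ⟨by omega, by omega⟩, if_pos ⟨by omega, by omega⟩, if_pos h,
      e1, e2, e3]
    have h1 := D.sp_mg [] a s [] r l [] (by omega) (by omega)
    have h2 := D.coassoc [] a s r [l] (by omega)
    have h3 := D.assoc [a] s r l [] (by omega)
    have h4 := D.digon [a] s r [l] (by omega)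
    have h5 := D.sp_mul_e [] a (s + r) [l] (by omega)
    simp only [List.nil_append, List.cons_append] at h1 h2 h3 h4 h5
    rw [mul_assoc, ← mul_assoc (D.mg [a + s] r l []), add_comm l r, ← h1, add_comm r s,
      mul_assoc, h3, ← mul_assoc, ← h2, mul_assoc, ← mul_assoc (D.sp [a] s r [l]), h4,
      smul_mul_assoc, mul_smul_comm, ← mul_assoc, h5]
    rw [add_comm (s : ℤ)]
  · have : D.rungF (r + s) k l = 0 := by rw [rungF, if_neg h]
    rw [this, smul_zero]
    by_cases h1 : r ≤ k ∧ l + r ≤ n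
    · have : D.rungF s (k - r) (l + r) = 0 := by rw [rungF, if_neg (by omega)]
      rw [this, mul_zero]
    · rw [rungF, if_neg h1, zero_mul]

theorem e_mul_rungF (s k l : ℕ) (hk : k ≤ n) :
    D.e [k, l] * D.rungF s k l = D.rungF s k l := by
  unfold rungF
  split_ifs with h
  · obtain ⟨a, rfl⟩ := Nat.exists_eq_add_of_le' h.1
    have h1 := D.e_mul_sp [] a s [l] hk
    simp only [List.nil_append, Nat.add_sub_cancel] at h1 ⊢
    rw [← mul_assoc, h1]
  · simp

theorem rungF_mul_e (s k l : ℕ) :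
    D.rungF s k l * D.e [k - s, l + s] = D.rungF s k l := by
  unfold rungF
  split_ifs with h
  · have h1 := D.mg_mul_e [k - s] s l [] (by omega)
    simp only [List.cons_append, List.nil_append] at h1
    rw [mul_assoc, add_comm l s, h1]
  · simp

theorem rungF_zero (k l : ℕ) (hk : k ≤ n) (hl : l ≤ n) : D.rungF 0 k l = D.e [k, l] := by
  rw [rungF, if_pos ⟨by omega, by omega⟩]
  exact D.rung_zero [] k l [] hk hl

/-- A rung to the right followed by a rung to the left, on strands with nonzero labels, in terms of
the symmetric web with four vertices. -/
theorem rungF_mul_rungE (a j : ℕ) (ha : a + 1 ≤ n) (hj : j + 1 ≤ n) :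
    D.rungF 1 (a + 1) (j + 1) * D.rungE 1 a (j + 2) =
      D.sp [] a 1 [j + 1] * D.sp [a, 1] 1 j [] * (D.mg [a] 1 1 [j] * D.sp [a] 1 1 [j]) *
          (D.mg [a, 1] 1 j [] * D.mg [] a 1 [j + 1]) -
        (qNat j * qNat (a + 1)) • D.e [a + 1, j + 1] := by
  have h1 := D.square' [a] j [] hj
  simp only [List.cons_append, List.nil_append] at h1
  have h2 : D.rungF 1 (a + 1) (j + 1) * D.rungE 1 a (j + 2) = D.sp [] a 1 [j + 1] *
      (if j + 2 ≤ n then D.mg [a] 1 (j + 1) [] * D.sp [a] 1 (j + 1) [] else 0) *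
      D.mg [] a 1 [j + 1] := by
    by_cases h3 : j + 2 ≤ n
    · rw [rungF, rungE, if_pos ⟨by omega, by omega⟩, if_pos ⟨by omega, by omega⟩, if_pos h3]
      simp [mul_assoc]
    · rw [rungF, if_neg (by omega), if_neg h3]; simp
  have h3 := D.sp_mul_e [] a 1 [j + 1] ha
  have h4 := D.digon_one [] a [j + 1] ha
  simp only [List.nil_append] at h3 h4
  rw [h2, eq_sub_of_add_eq h1.symm, mul_sub, sub_mul, mul_smul_comm, smul_mul_assoc, h3, h4,
    smul_smul]
  simp only [mul_assoc]

theorem rungE_mul_rungF (a j : ℕ) (ha : a + 1 ≤ n) (hj : j + 1 ≤ n) :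
    D.rungE 1 (a + 1) (j + 1) * D.rungF 1 (a + 2) j =
      D.sp [] a 1 [j + 1] * D.sp [a, 1] 1 j [] * (D.mg [a] 1 1 [j] * D.sp [a] 1 1 [j]) *
          (D.mg [a, 1] 1 j [] * D.mg [] a 1 [j + 1]) -
        (qNat a * qNat (j + 1)) • D.e [a + 1, j + 1] := by
  have h := D.mirror.rungF_mul_rungE j a hj ha
  have h' := D.mirror.mirror_rungF 1 a (j + 2)
  have h1 : D.mirror.rungE 1 j (a + 2) = D.rungF 1 (a + 2) j := by
    simp [rungF, rungE, mirror]
  rw [mirror_rungF, h1] at h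
  rw [h]
  have h2 := D.sp_sp [] a 1 [] 1 j [] ha (by omega)
  have h3 := D.mg_mg [] a 1 [] 1 j [] ha (by omega)
  simp only [List.nil_append, add_comm 1 j] at h2 h3
  rw [h2, ← h3]
  simp [mirror]

/-- The commutator of two opposite rungs of label one. If a label is `0`, one of the products is
zero and the other is a digon; otherwise both products contain the same square web, which
cancels. -/
theorem rung_comm (k l : ℕ) (hk : k ≤ n) (hl : l ≤ n) :
    D.rungF 1 k l * D.rungE 1 (k - 1) (l + 1) =
      D.rungE 1 k l * D.rungF 1 (k + 1) (l - 1) + qInt ((k : ℤ) - l) • D.e [k, l] := by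
  have h0 : qInt 0 = 0 := by simp [qInt]
  have hF : ∀ a, a + 1 ≤ n → D.rungF 1 (a + 1) 0 * D.rungE 1 a 1 =
      qNat (a + 1) • D.e [a + 1, 0] := by
    intro a ha
    have h1 := D.mg_sp_zero [a] 1 [] (by omega)
    have h2 := D.sp_mul_e [] a 1 [0] ha
    have h3 := D.digon_one [] a [0] ha
    simp only [List.nil_append, List.cons_append] at h1 h2 h3
    rw [rungF, rungE, if_pos ⟨by omega, by omega⟩, if_pos ⟨by omega, by omega⟩]
    simp only [Nat.add_sub_cancel, Nat.sub_self]
    rw [mul_assoc, ← mul_assoc (D.mg _ _ _ _), h1, ← mul_assoc, h2, h3]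
  have hE : ∀ j, j + 1 ≤ n → D.rungE 1 0 (j + 1) * D.rungF 1 1 j =
      qNat (j + 1) • D.e [0, j + 1] := by
    intro j hj
    have h1 := D.mg_sp_zero' [] 1 [j] (by omega)
    have h2 := D.sp_mul_e [0] 1 j [] (by omega)
    have h3 := D.digon [0] 1 j [] (by omega)
    have e1 : ((1 : ℕ) : ℤ) + j = j + 1 := by push_cast; ring
    simp only [List.nil_append, List.cons_append, e1, qBinom_succ_self, add_comm 1 j] at h1 h2 h3
    rw [rungF, rungE, if_pos ⟨by omega, by omega⟩, if_pos ⟨by omega, by omega⟩]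
    simp only [Nat.add_sub_cancel, Nat.sub_self]
    rw [mul_assoc, ← mul_assoc (D.mg _ _ _ _), h1, ← mul_assoc, h2, h3]
  have oF : ∀ k l, ¬ (1 ≤ k ∧ l + 1 ≤ n) → D.rungF 1 k l = 0 := fun k l h => by rw [rungF, if_neg h]
  have oE : ∀ k l, ¬ (1 ≤ l ∧ k + 1 ≤ n) → D.rungE 1 k l = 0 := fun k l h => by rw [rungE, if_neg h]
  rcases k with _ | a <;> rcases l with _ | j
  · rw [oF 0 0 (by omega), oE 0 0 (by omega)]; simp [h0]
  · rw [oF 0 _ (by omega), zero_mul]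
    have := hE j hl
    simp only [Nat.add_sub_cancel, zero_add] at this ⊢
    rw [this, ← add_smul, Nat.cast_zero, zero_sub, qInt_neg, qInt_natCast]; simp
  · rw [oE _ 0 (by omega), zero_mul, zero_add]
    simpa [← qInt_natCast] using hF a hk
  · have h1 := D.rungF_mul_rungE a j hk hl
    have h2 := D.rungE_mul_rungF a j hk hl
    simp only [Nat.add_sub_cancel]
    rw [h1, h2, sub_add, sub_right_inj, ← sub_smul]
    congr 1
    have h3 := qInt_mul_sub ((a : ℤ) + 1) (-j) 1
    have e7 : qInt 1 = 1 := by simpa using qInt_natCast 1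
    rw [show (a : ℤ) + 1 - 1 = a by ring, show -(j : ℤ) - 1 = -(j + 1) by ring,
      show (a : ℤ) + 1 + -j - 1 = a - j by ring, qInt_neg, qInt_neg, e7] at h3
    simp only [← qInt_natCast]
    push_cast
    rw [show (a : ℤ) + 1 - (j + 1) = a - j by ring]
    linear_combination -h3

/-- Rungs of ladders form a system of divided powers. -/
def dividedPowers (N : ℕ) : DividedPowers n N A where
  e k l := D.e [k, l]
  E := D.rungE
  F := D.rungF
  E_zero k l _ hk hl := by
    have := D.mirror.rungF_zero l k hl hk
    rw [mirror_rungF] at this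
    simpa [mirror] using this
  F_zero k l _ hk hl := D.rungF_zero k l hk hl
  E_out r k l _ h := by rw [rungE, if_neg h]
  F_out r k l _ h := by rw [rungF, if_neg h]
  e_mul_E r k l _ hk hl := by
    have := D.mirror.e_mul_rungF r l k hl
    rw [mirror_rungF] at this
    simpa [mirror] using this
  E_mul_e r k l _ hk hl := by
    have := D.mirror.rungF_mul_e r l k
    rw [mirror_rungF] at this
    simpa [mirror] using this
  e_mul_F s k l _ hk hl := D.e_mul_rungF s k l hk
  F_mul_e s k l _ hk hl := D.rungF_mul_e s k l
  E_succ r k l _ hk hl _ _ := by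
    have := D.mirror.rungF_mul_rungF 1 r l k hl
    rw [mirror_rungF, mirror_rungF, mirror_rungF, qBinom_one] at this
    rw [this, add_comm 1 r, ← qInt_natCast]
    congr 2
    push_cast; ring
  F_succ s k l _ hk hl _ _ := by
    have := D.rungF_mul_rungF s 1 k l hk
    rw [this]
    congr 1
    exact_mod_cast qBinom_succ_self s
  comm k l _ hk hl := D.rung_comm k l hk hl

end Ladder

/-- Divided powers on the weight spaces of polynomials of degree `N` in two variables. -/
def scalarPowers (n N : ℕ) (h : N ≤ n) : DividedPowers n N K where
  e _ _ := 1
  E r _ l := qBinom l r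
  F s k _ := qBinom k s
  E_zero _ _ _ _ _ := qBinom_zero _
  F_zero _ _ _ _ _ := qBinom_zero _
  E_out r k l hN h' := qBinom_eq_zero (by omega)
  F_out s k l hN h' := qBinom_eq_zero (by omega)
  e_mul_E _ _ _ _ _ _ := one_mul _
  E_mul_e _ _ _ _ _ _ := mul_one _
  e_mul_F _ _ _ _ _ _ := one_mul _
  F_mul_e _ _ _ _ _ _ := mul_one _
  E_succ r k l _ _ _ hl _ := by
    obtain ⟨l, rfl⟩ := Nat.exists_eq_succ_of_ne_zero hl.ne'
    have := qBinom_succ_succ (l : ℤ) r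
    simp only [Nat.succ_eq_add_one, Nat.add_sub_cancel, qBinom_one, smul_eq_mul]
    push_cast
    exact this.symm
  F_succ s k l _ _ _ hs _ := by
    have := qBinom_succ (k : ℤ) s
    rw [qBinom_one, smul_eq_mul, this]
    push_cast [Nat.cast_sub hs]; rfl
  comm k l _ _ _ := by
    have h3 := qInt_mul_sub (k : ℤ) (-(l : ℤ)) (-1)
    have e7 : qInt 1 = 1 := by simpa using qInt_natCast 1
    have h0 : qInt 0 = 0 := by simp [qInt]
    simp only [qBinom_one, smul_eq_mul, mul_one]
    rw [show (k : ℤ) - (-1) = k + 1 by ring, show -(l : ℤ) - (-1) = -(l - 1) by ring,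
      show (k : ℤ) + -(l : ℤ) - (-1) = k - l + 1 by ring, qInt_neg, qInt_neg, qInt_neg, e7] at h3
    push_cast
    have h4 := qInt_mul_sub (k : ℤ) (-((l : ℤ) + 1)) (-1)
    rw [show (k : ℤ) - (-1) = k + 1 by ring, show -((l : ℤ) + 1) - (-1) = -l by ring,
      show (k : ℤ) + -((l : ℤ) + 1) - (-1) = k - l by ring, qInt_neg, qInt_neg, qInt_neg, e7] at h4
    linear_combination -h4

end

noncomputable section

variable {n : ℕ} {R R' : Set Lin} {c : Convention}

/-! ### Relators in general position -/

/-- A linear combination of diagrams that is not a nonzero multiple of the empty diagram. Since the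
empty diagram does not determine its boundary, only such linear combinations have a well-defined
boundary. -/
def NonScalar (x : Lin) : Prop := x = 0 ∨ ∃ w ≠ [], x w ≠ 0

theorem NonScalar.placeable {s t : List Strand} {x : Lin} (h : NonScalar x) (hx : x ∈ Hom n s t) :
    Placeable n x := by
  rcases h with h | ⟨w, hw, hxw⟩
  · exact Or.inl h
  · exact Or.inr ⟨s, t, w, hw, hxw, (mem_Hom.1 hx w hxw).2.2.2, fun _ => hx⟩

theorem eq_single_of_not_nonScalar {x : Lin} (h : ¬ NonScalar x) :
    x = Finsupp.single [] (x []) := by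
  rw [NonScalar, not_or] at h
  ext w
  by_cases hw : w = []
  · subst hw; simp
  · rw [Finsupp.single_eq_of_ne hw]
    by_contra h'
    exact h.2 ⟨w, hw, h'⟩

theorem Placeable.hom_unique {s t s' t' : List Strand} {x : Lin} (h : Placeable n x)
    (hx : x ∈ Hom n s t) (hx' : x ∈ Hom n s' t') : x = 0 ∨ (s = s' ∧ t = t') := by
  rcases h with h | ⟨_, _, w, hw, hxw, -⟩
  · exact Or.inl h
  · have h1 := (mem_Hom.1 hx w hxw).2.2.2
    have h2 := (mem_Hom.1 hx' w hxw).2.2.2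
    have : s = s' := by
      cases w with
      | nil => exact absurd rfl hw
      | cons σ w => rw [isPath_cons] at h1 h2; rw [h1.1, h2.1]
    subst this
    exact Or.inr ⟨rfl, h1.unique h2⟩

/-- A set of relators follows from another one if each of its relators does, for whatever boundary:
as relators are placeable, that boundary is the one at which they are applied. -/
theorem relations_le_relations (hR : ∀ x ∈ R, Placeable n x)
    (h : ∀ x ∈ R, ∃ s t, x ∈ relations n R' s t) (s t : List Strand) :
    relations n R s t ≤ relations n R' s t := by
  refine relations_le hR fun u v a b x s' t' hx hH hu hv => insert_mem_relations ?_ hu hv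
  rcases hx with hx | hx
  · exact mem_relations_of_mem (Or.inl hx) hH
  · obtain ⟨s₀, t₀, h₀⟩ := h x hx
    rcases (hR x hx).hom_unique (relations_le_Hom h₀) hH with rfl | ⟨rfl, rfl⟩
    · exact Submodule.zero_mem _
    · exact h₀

theorem lin_mirror_mem_relations_of (hR : ∀ x ∈ R, Placeable n x)
    (h : ∀ x ∈ R, ∃ s t, x ∈ Hom n s t ∧ lin mirror x ∈ relations n R' s.reverse t.reverse)
    {s t : List Strand} {x : Lin} (hx : x ∈ relations n R s t) :
    lin mirror x ∈ relations n R' s.reverse t.reverse := by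
  refine lin_mirror_mem_relations hR (fun x hx s t hH => ?_) hx
  obtain ⟨s₀, t₀, h₀, h₁⟩ := h x hx
  rcases (hR x hx).hom_unique h₀ hH with rfl | ⟨rfl, rfl⟩
  · simp
  · exact h₁

theorem lin_flip_mem_relations_of (hR : ∀ x ∈ R, Placeable n x)
    (h : ∀ x ∈ R, ∃ s t, x ∈ Hom n s t ∧ lin flip x ∈ relations n R' t s)
    {s t : List Strand} {x : Lin} (hx : x ∈ relations n R s t) :
    lin flip x ∈ relations n R' t s := by
  refine lin_flip_mem_relations hR (fun x hx s t hH => ?_) hx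
  obtain ⟨s₀, t₀, h₀, h₁⟩ := h x hx
  rcases (hR x hx).hom_unique h₀ hH with rfl | ⟨rfl, rfl⟩
  · simp
  · exact h₁

/-! ### Linear combinations of diagrams with labels `0, …, n` -/

/-- Linear combinations of diagrams from `s` to `t` with labels in `0, …, n`. -/
def ExtHom (n : ℕ) (s t : List Strand) : Submodule K Lin :=
  Finsupp.supported K K {w | ExtWeb n s w t}

variable {s t : List Strand} {x : Lin}

theorem mem_ExtHom : x ∈ ExtHom n s t ↔ ∀ w, x w ≠ 0 → ExtWeb n s w t := by
  simp [ExtHom, Finsupp.mem_supported, Set.subset_def]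

theorem dg_mem_ExtHom {w : Word} (h : ExtWeb n s w t) : dg w ∈ ExtHom n s t :=
  Finsupp.single_mem_supported K _ h

theorem lin_mem_supported {f : Word → Word} {P Q : Set Word} (h : ∀ w ∈ P, f w ∈ Q)
    (hx : x ∈ Finsupp.supported K K P) : lin f x ∈ Finsupp.supported K K Q := by
  classical
  rw [Finsupp.mem_supported] at hx ⊢
  intro w hw
  obtain ⟨v, hv, rfl⟩ := Finset.mem_image.1 (Finsupp.mapDomain_support hw)
  exact h v (hx hv)

theorem lin_mirror_mem_ExtHom (hx : x ∈ ExtHom n s t) :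
    lin mirror x ∈ ExtHom n s.reverse t.reverse := lin_mem_supported (fun _ h => h.mirror) hx

theorem lin_flip_mem_ExtHom (hx : x ∈ ExtHom n s t) : lin flip x ∈ ExtHom n t s :=
  lin_mem_supported (fun _ h => h.flip) hx

theorem lin_delete_mem_Hom (hx : x ∈ ExtHom n s t) :
    lin (delete n c) x ∈ Hom n (deleteRow n s) (deleteRow n t) :=
  lin_mem_supported (fun _ h => h.delete) hx

theorem lin_delete_reverse_mem_Hom (hx : x ∈ ExtHom n s t) :
    lin (delete n c) (lin reverse x) ∈
      Hom n ((deleteRow n s).map Strand.dual) ((deleteRow n t).map Strand.dual) := by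
  rw [lin_lin]
  exact lin_mem_supported (fun _ h => (iso_delete_reverse h).1) hx

theorem lin_mirror_delete (x : Lin) :
    lin (delete n .toward) (lin mirror x) = lin mirror (lin (delete n .toward) x) := by
  rw [lin_lin, lin_lin]
  congr 2; funext w; exact (mirror_delete w).symm

theorem lin_flip_delete (x : Lin) :
    lin (delete n .toward) (lin flip x) = lin flip (lin (delete n .toward) x) := by
  rw [lin_lin, lin_lin]
  congr 2; funext w; exact (flip_delete w).symm

/-- Reversing the arrows amounts to a reflection in a point, up to rotation. -/
theorem lin_delete_reverse_mem_iff (hx : x ∈ ExtHom n s t) :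
    lin (delete n c) (lin reverse x) ∈
        relations n R ((deleteRow n s).map Strand.dual) ((deleteRow n t).map Strand.dual) ↔
      lin (delete n c) (lin flip (lin mirror x)) ∈
        relations n R (deleteRow n t).reverse (deleteRow n s).reverse := by
  have key : lin (delete n c) (lin reverse x) ∈
        relations n R ((deleteRow n s).map Strand.dual) ((deleteRow n t).map Strand.dual) ↔
      lin (rotW (deleteRow n t).reverse (deleteRow n s).reverse)
        (lin (delete n c) (lin flip (lin mirror x))) ∈
        relations n R ((deleteRow n s).map Strand.dual) ((deleteRow n t).map Strand.dual) := by
    rw [lin_lin, lin_lin, lin_lin, lin_lin]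
    exact lin_mem_relations_congr (P := fun w => ExtWeb n s w t)
      (fun w hw => iso_delete_reverse hw) (mem_ExtHom.1 hx)
  rw [key]
  have hH : lin (delete n c) (lin flip (lin mirror x)) ∈
      Hom n (deleteRow n t).reverse (deleteRow n s).reverse := by
    simpa using lin_delete_mem_Hom (c := c) (lin_flip_mem_ExtHom (lin_mirror_mem_ExtHom hx))
  generalize lin (delete n c) (lin flip (lin mirror x)) = y at hH
  constructor
  · intro h
    have h1 := lin_rotW_mem h
    have h2 := (lin_mem_relations_congr (R := R)
      (P := fun w => IsWeb n (deleteRow n t).reverse w (deleteRow n s).reverse)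
      (g := id) (fun w hw => iso_rotW_rotW hw) (mem_Hom.1 hH)).1
    simp only [lin_lin, dualRow_reverse] at h1 h2
    have h3 : lin id y = y := by simp [lin]
    rw [h3] at h2
    refine h2 ?_
    simpa [Function.comp_def, dualRow] using h1
  · intro h
    have := lin_rotW_mem h
    rwa [dualRow_reverse, dualRow_reverse] at this

/-! ### Weights of diagrams -/

section Weight

variable {M : Type*} [CommMonoid M]

/-- The factor of an elementary piece in `weight`. -/
def Gen.weight (α β : ℕ → ℕ → M) : Gen → M
  | cup _ => 1
  | cap _ => 1
  | merge k l => if k = 0 ∨ l = 0 then 1 else β k l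
  | split k l => if k = 0 ∨ l = 0 then 1 else α k l
  | tagOut k l => if k = 0 ∨ l = 0 then 1 else α k l
  | tagIn k l => if k = 0 ∨ l = 0 then 1 else β k l

/-- The product of the factors `α k l` over all dividing or outgoing vertices and `β k l` over all
fusing or incoming vertices, except for those with a strand labelled `0`. This does not change when
strands labelled `0` or `n` are deleted. -/
def weight (α β : ℕ → ℕ → M) (w : Word) : M := (w.map fun σ => σ.gen.weight α β).prod

variable {α β : ℕ → ℕ → M}

@[simp] theorem weight_nil : weight α β [] = 1 := rfl

@[simp] theorem weight_cons (σ : Slice) (w : Word) :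
    weight α β (σ :: w) = σ.gen.weight α β * weight α β w := by simp [weight]

@[simp] theorem weight_append (u v : Word) :
    weight α β (u ++ v) = weight α β u * weight α β v := by simp [weight]

@[simp] theorem weight_whisker (a b : List Strand) (w : Word) :
    weight α β (whisker a w b) = weight α β w := by simp [weight, whisker, Function.comp_def]

theorem weight_subst (f : List Strand → List Strand) (F : Gen → Word) {α' β' : ℕ → ℕ → M}
    (h : ∀ g, weight α β (F g) = g.weight α' β') (w : Word) :
    weight α β (subst f F w) = weight α' β' w := by
  induction w with
  | nil => rfl
  | cons σ w ih => simp [subst_cons, h, ih]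

@[simp] theorem weight_cups (s : List Strand) : weight α β (cups s) = 1 := by
  induction s with
  | nil => rfl
  | cons x s ih => simp [cups, ih, Gen.weight]

@[simp] theorem weight_caps (s : List Strand) : weight α β (caps s) = 1 := by
  induction s with
  | nil => rfl
  | cons x s ih => simp [caps, ih, Gen.weight]

theorem weight_rot (g : Gen) : weight α β g.rot = g.weight α β := by simp [Gen.rot]

theorem weight_delete (hβ : ∀ k l, β k l = β l k) (w : Word) :
    weight α β (delete n c w) = weight α β w := by
  refine weight_subst _ _ (fun g => ?_) w
  cases g with
  | cup x => simp only [Gen.delete]; split_ifs <;> simp [Gen.weight]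
  | cap x => simp only [Gen.delete]; split_ifs <;> simp [Gen.weight]
  | merge k l =>
    simp only [Gen.delete]
    split_ifs with h h'
    · simp [Gen.weight, h]
    · cases c <;> simp [Convention.inTag, tagInSwitched, Gen.weight, or_comm, hβ l k]
    · simp [Gen.weight]
  | split k l =>
    simp only [Gen.delete]
    split_ifs with h h'
    · simp [Gen.weight, h]
    · simp [Gen.weight]
    · simp [Gen.weight]
  | tagOut k l => simp [Gen.delete]
  | tagIn k l => simp [Gen.delete]

theorem weight_mirror (hα : ∀ k l, α k l = α l k) (hβ : ∀ k l, β k l = β l k) (w : Word) :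
    weight α β (mirror w) = weight α β w := by
  induction w with
  | nil => rfl
  | cons σ w ih =>
    have : σ.gen.mirror.weight α β = σ.gen.weight α β := by
      cases σ.gen <;> simp [Gen.mirror, Gen.weight, or_comm, hα, hβ]
    rw [mirror_cons]
    simp [ih, this]

theorem weight_reverse (hα : ∀ k l, α k l = α l k) (hβ : ∀ k l, β k l = β l k) (w : Word) :
    weight α β (reverse w) = weight β α w := by
  refine weight_subst _ _ (fun g => ?_) w
  cases g with
  | cup x => simp [Gen.reverse, Gen.weight]
  | cap x => simp [Gen.reverse, Gen.weight]
  | merge k l => simp [Gen.reverse, weight_rot, Gen.weight, or_comm, hα l k]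
  | split k l => simp [Gen.reverse, weight_rot, Gen.weight, or_comm, hβ l k]
  | tagOut k l => simp [Gen.reverse, weight_rot, Gen.weight, or_comm, hβ l k]
  | tagIn k l => simp [Gen.reverse, weight_rot, Gen.weight, or_comm, hα l k]

end Weight

/-- The multiset of the sums `k + l` over all vertices without a strand labelled `0`. -/
def sizes (w : Word) : Multiset ℕ :=
  Multiplicative.toAdd (weight (M := Multiplicative (Multiset ℕ))
    (fun k l => Multiplicative.ofAdd {k + l}) (fun k l => Multiplicative.ofAdd {k + l}) w)

/-- The quantum factorial. -/
def qFact (m : ℕ) : K := ∏ i ∈ Finset.range m, qNat (i + 1)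

theorem qFact_ne_zero (m : ℕ) : qFact m ≠ 0 :=
  Finset.prod_ne_zero_iff.2 fun i _ => qNat_succ_ne_zero i

theorem qBinom_eq_qFact (k l : ℕ) :
    qBinom ((k : ℤ) + l) l = qFact (k + l) / (qFact k * qFact l) := by
  induction l with
  | zero =>
    have h : qFact 0 = 1 := Finset.prod_range_zero _
    rw [h]
    simp [div_self (qFact_ne_zero k)]
  | succ l ih =>
    have h := qBinom_succ_succ ((k : ℤ) + l) l
    rw [ih] at h
    push_cast
    rw [← add_assoc]
    refine mul_left_cancel₀ (qNat_succ_ne_zero l) ?_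
    rw [h]
    have h1 : qFact (l + 1) = qFact l * qNat (l + 1) := Finset.prod_range_succ _ _
    have h2 : qFact (k + (l + 1)) = qFact (k + l) * qNat (k + l + 1) := Finset.prod_range_succ _ _
    have h3 : qInt ((k : ℤ) + l + 1) = qNat (k + l + 1) := by
      rw [← qInt_natCast]; push_cast; rfl
    rw [h1, h2, h3]
    have := qFact_ne_zero k
    have := qFact_ne_zero l
    have := qNat_succ_ne_zero l
    field_simp

/-- The quantum binomial coefficients as weights of vertices. -/
def binomWeight (k l : ℕ) : K := qFact (k + l) / (qFact k * qFact l)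

theorem binomWeight_comm (k l : ℕ) : binomWeight k l = binomWeight l k := by
  rw [binomWeight, binomWeight, add_comm, mul_comm (qFact k)]

/-- An operation on diagrams that is compatible with the weights of vertices. -/
structure Weighted (n : ℕ) (f : Word → Word) : Prop where
  map_nil : f [] = []
  cup_ne_nil : ∀ a x b w, 0 < x.label → x.label < n → f (⟨a, .cup x, b⟩ :: w) ≠ []
  sizes_eq : ∀ w, sizes (f w) = sizes w
  exists_weight : ∃ ψ : Word → K, ψ [] = 1 ∧
    ∀ w, ψ (f w) = weight binomWeight (fun _ _ => 1) w

theorem weighted_delete : Weighted n (delete n c) where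
  map_nil := rfl
  cup_ne_nil a x b w h h' := by
    simp [delete_cons, Gen.delete, whisker, h, h']
  sizes_eq w := by unfold sizes; rw [weight_delete fun k l => by rw [add_comm]]
  exists_weight := ⟨weight binomWeight fun _ _ => 1, rfl, weight_delete fun _ _ => rfl⟩

theorem weighted_delete_mirror : Weighted n (delete n c ∘ mirror) where
  map_nil := rfl
  cup_ne_nil a x b w h h' := by
    simp [delete_cons, Gen.mirror, Gen.delete, whisker, h, h']
  sizes_eq w := by
    unfold sizes
    rw [Function.comp_apply, weight_delete fun k l => by rw [add_comm],
      weight_mirror (fun k l => by rw [add_comm]) fun k l => by rw [add_comm]]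
  exists_weight := ⟨weight binomWeight fun _ _ => 1, rfl, fun w => by
    rw [Function.comp_apply, weight_delete fun _ _ => rfl,
      weight_mirror binomWeight_comm fun _ _ => rfl]⟩

theorem weighted_delete_reverse : Weighted n (delete n c ∘ reverse) where
  map_nil := rfl
  cup_ne_nil a x b w h h' := by
    simp [delete_cons, reverse, subst_cons, Gen.reverse, Gen.delete, whisker, h, h']
  sizes_eq w := by
    unfold sizes
    rw [Function.comp_apply, weight_delete fun k l => by rw [add_comm],
      weight_reverse (fun k l => by rw [add_comm]) fun k l => by rw [add_comm]]
  exists_weight := ⟨weight (fun _ _ => 1) binomWeight, rfl, fun w => by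
    rw [Function.comp_apply, weight_delete binomWeight_comm,
      weight_reverse (fun _ _ => rfl) binomWeight_comm]⟩

theorem weighted_delete_reverse_mirror : Weighted n (delete n c ∘ reverse ∘ mirror) where
  map_nil := rfl
  cup_ne_nil a x b w h h' := by
    simp [delete_cons, reverse, subst_cons, Gen.reverse, Gen.mirror, Gen.delete, whisker, h, h']
  sizes_eq w := by
    rw [← Function.comp_assoc, Function.comp_apply, weighted_delete_reverse.sizes_eq]
    unfold sizes
    rw [weight_mirror (fun k l => by rw [add_comm]) fun k l => by rw [add_comm]]
  exists_weight := by
    obtain ⟨ψ, h1, h2⟩ := (weighted_delete_reverse (n := n) (c := c)).exists_weight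
    refine ⟨ψ, h1, fun w => ?_⟩
    rw [← Function.comp_assoc, Function.comp_apply, h2,
      weight_mirror binomWeight_comm fun _ _ => rfl]

/-- The sum of the coefficients of the diagrams whose vertices have given sizes. -/
def sizeCoeff (x : Lin) : Multiset ℕ →₀ K := x.mapDomain sizes

namespace Weighted

variable {f : Word → Word}

/-- The number of diagrams with given vertices, counted with coefficients, is unchanged by `f`. Thus
a relator that becomes a multiple of the empty diagram has `sizeCoeff` zero except at the empty
multiset. -/
theorem nonScalar_of_sizeCoeff (hf : Weighted n f)
    (h : (∀ m ≠ 0, sizeCoeff x m = 0) → sizeCoeff x = 0) :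
    NonScalar (lin f x) := by
  have e : sizeCoeff (lin f x) = sizeCoeff x := by
    rw [sizeCoeff, lin, Finsupp.lmapDomain_apply, ← Finsupp.mapDomain_comp]
    exact Finsupp.mapDomain_congr fun w _ => hf.sizes_eq w
  rw [← e] at h
  generalize lin f x = y at h
  by_contra hy
  have h1 := eq_single_of_not_nonScalar hy
  rw [NonScalar, not_or] at hy
  have h2 : sizeCoeff y = Finsupp.single 0 (y []) := by
    rw [h1, sizeCoeff, Finsupp.mapDomain_single]; simp [sizes]
  have h3 : y [] = 0 := by
    have := h fun m hm => by rw [h2, Finsupp.single_eq_of_ne hm]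
    rw [h2] at this
    simpa using this
  exact hy.1 (by rw [h1, h3, Finsupp.single_zero])

/-- If the diagrams of a relator have weights that cancel, they cancel also after `f`; but the
empty diagram has weight one. -/
theorem nonScalar_of_weight (hf : Weighted n f)
    (h : Finsupp.linearCombination K (weight binomWeight fun _ _ => 1) x = 0) :
    NonScalar (lin f x) := by
  obtain ⟨ψ, hψ, hψf⟩ := hf.exists_weight
  have e : Finsupp.linearCombination K ψ (lin f x) = 0 := by
    rw [lin, Finsupp.lmapDomain_apply, Finsupp.linearCombination_mapDomain, ← h]
    congr 2; funext w; exact hψf w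
  generalize lin f x = y at e
  by_contra hy
  have h1 := eq_single_of_not_nonScalar hy
  rw [NonScalar, not_or] at hy
  rw [h1, Finsupp.linearCombination_single, hψ, smul_eq_mul, mul_one] at e
  exact hy.1 (by rw [h1, e, Finsupp.single_zero])

end Weighted

end

noncomputable section

variable {n : ℕ} {R R' : Set Lin} {c : Convention} {s t : List Strand} {x : Lin} {f : Word → Word}

/-! ### The relators -/

theorem extWeb_mergeI {k l m : ℕ} (h : k + l + m ≤ n) :
    ExtWeb n [up k, up l, up m] (mergeI k l m) [up (k + l + m)] := by
  simp [mergeI, extWeb_cons, extWeb_nil, Slice.src, Slice.tgt, Gen.src, Gen.tgt, Gen.Ext, add_assoc]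
  omega

theorem extWeb_mergeH {k l m : ℕ} (h : k + l + m ≤ n) :
    ExtWeb n [up k, up l, up m] (mergeH k l m) [up (k + l + m)] := by
  simp [mergeH, extWeb_cons, extWeb_nil, Slice.src, Slice.tgt, Gen.src, Gen.tgt, Gen.Ext]
  omega

theorem extWeb_digon {k l : ℕ} (h : k + l ≤ n) :
    ExtWeb n [up (k + l)] (digon k l) [up (k + l)] := by
  simp [digon, extWeb_cons, extWeb_nil, Slice.src, Slice.tgt, Gen.src, Gen.tgt, Gen.Ext, h]

theorem extWeb_rungR {k l s : ℕ} (hk : k ≤ n) (hs : s ≤ k) (h : l + s ≤ n) :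
    ExtWeb n [up k, up l] (rungR k l s) [up (k - s), up (l + s)] := by
  simp [rungR, extWeb_cons, extWeb_nil, Slice.src, Slice.tgt, Gen.src, Gen.tgt, Gen.Ext,
    add_comm, Nat.add_sub_cancel' hs, hk]
  omega

theorem extWeb_rungL {k l r : ℕ} (hl : l ≤ n) (hr : r ≤ l) (h : k + r ≤ n) :
    ExtWeb n [up k, up l] (rungL k l r) [up (k + r), up (l - r)] := by
  simp [rungL, extWeb_cons, extWeb_nil, Slice.src, Slice.tgt, Gen.src, Gen.tgt, Gen.Ext,
    Nat.add_sub_cancel' hr, hl, h]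

theorem extWeb_mergeDown {k l : ℕ} (h : k + l ≤ n) :
    ExtWeb n [up k, dn (k + l), up l] (mergeDown k l) [] := by
  simp [mergeDown, extWeb_cons, extWeb_nil, Slice.src, Slice.tgt, Gen.src, Gen.tgt, Gen.Ext, up, dn,
    Strand.dual, add_comm l k]
  omega

theorem extWeb_tagOut {k l : ℕ} (hk : 0 < k) (hl : 0 < l) (h : k + l = n) :
    ExtWeb n [] [⟨[], .tagOut k l, []⟩] [up k, up l] :=
  extWeb_gen (g := .tagOut k l) ⟨hk, hl, h⟩

theorem extWeb_tagOutSwitched {k l : ℕ} (hk : 0 < k) (hl : 0 < l) (h : k + l = n) :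
    ExtWeb n [] (tagOutSwitched k l) [up k, up l] := by
  simp [tagOutSwitched, extWeb_cons, extWeb_nil, Slice.src, Slice.tgt, Gen.src, Gen.tgt, Gen.Ext,
    up, dn, Strand.dual]
  omega

/-- The ladder with a rung to the right below a rung to the left, when its labels are in range. -/
theorem extWeb_ladderRL {k l r s : ℕ} (hk : k ≤ n)
    (h : s ≤ k ∧ l + s ≤ n ∧ r ≤ l + s ∧ k - s + r ≤ n) :
    ExtWeb n [up k, up l] (rungR k l s ++ rungL (k - s) (l + s) r)
      [up (k - s + r), up (l + s - r)] :=
  (extWeb_rungR hk h.1 h.2.1).append (extWeb_rungL h.2.1 h.2.2.1 h.2.2.2)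

theorem extWeb_ladderLR {k l r s : ℕ} (hl : l ≤ n)
    (h : r ≤ l ∧ k + r ≤ n ∧ s ≤ k + r ∧ l - r + s ≤ n) :
    ExtWeb n [up k, up l] (rungL k l r ++ rungR (k + r) (l - r) s)
      [up (k + r - s), up (l - r + s)] :=
  (extWeb_rungL hl h.1 h.2.1).append (extWeb_rungR h.2.1 h.2.2.1 h.2.2.2)

theorem ladderRL_mem_ExtHom {k l : ℕ} (r s : ℕ) (hk : k ≤ n) :
    ladderRL n k l s r ∈ ExtHom n [up k, up l] [up (k + r - s), up (l + s - r)] := by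
  unfold ladderRL
  split_ifs with h
  · have := dg_mem_ExtHom (extWeb_ladderRL hk h)
    rwa [show k - s + r = k + r - s by omega] at this
  · exact Submodule.zero_mem _

theorem ladderLR_mem_ExtHom {k l : ℕ} (r s t : ℕ) (htr : t ≤ r) (hts : t ≤ s) (hl : l ≤ n) :
    ladderLR n k l (r - t) (s - t) ∈ ExtHom n [up k, up l] [up (k + r - s), up (l + s - r)] := by
  unfold ladderLR
  split_ifs with h
  · have := dg_mem_ExtHom (extWeb_ladderLR hl h)
    rwa [show k + (r - t) - (s - t) = k + r - s by omega,
      show l - (r - t) + (s - t) = l + s - r by omega] at this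
  · exact Submodule.zero_mem _

theorem extWeb_loopRight {k l : ℕ} (h : k + l ≤ n) :
    ExtWeb n [up k] [⟨[up k], .cup (up l), []⟩, ⟨[], .merge k l, [dn l]⟩, ⟨[], .split k l, [dn l]⟩,
      ⟨[up k], .cap (up l), []⟩] [up k] := by
  simp [extWeb_cons, extWeb_nil, Slice.src, Slice.tgt, Gen.src, Gen.tgt, Gen.Ext, up, dn,
    Strand.dual]
  omega

theorem extWeb_migrateTag_left {k l m : ℕ} (h : k + l + m = n) :
    ExtWeb n [up (k + l), dn n, up (k + m)]
      (⟨[], .split k l, [dn n, up (k + m)]⟩ :: whisker [up k] (mergeDown l (k + m)) []) [up k] := by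
  subst h
  have h1 := (extWeb_mergeDown (n := k + l + m) (k := l) (l := k + m) (by omega)).whisker
    [up k] []
  rw [extWeb_cons]
  refine ⟨rfl, show k + l ≤ _ by omega, ?_⟩
  simpa [Slice.tgt, Gen.tgt, show l + (k + m) = k + l + m by omega] using h1

theorem extWeb_migrateTag_right {k l m : ℕ} (h : k + l + m = n) :
    ExtWeb n [up (k + l), dn n, up (k + m)]
      (⟨[up (k + l), dn n], .split m k, []⟩ :: whisker [] (mergeDown (k + l) m) [up k])
      [up k] := by
  subst h
  have h1 := (extWeb_mergeDown (n := k + l + m) (k := k + l) (l := m) (by omega)).whisker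
    [] [up k]
  rw [extWeb_cons]
  refine ⟨by simp [Slice.src, Gen.src, add_comm m k], show m + k ≤ _ by omega, ?_⟩
  simpa [Slice.tgt, Gen.tgt] using h1

theorem extWeb_rungR_rungR {k l r s : ℕ} (hk : k ≤ n) (hrs : r + s ≤ k) (h : l + (r + s) ≤ n) :
    ExtWeb n [up k, up l] (rungR k l r ++ rungR (k - r) (l + r) s)
      [up (k - (r + s)), up (l + (r + s))] := by
  have h1 := extWeb_rungR (n := n) (k := k - r) (l := l + r) (s := s) (by omega) (by omega)
    (by omega)
  rw [Nat.sub_sub, add_assoc] at h1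
  exact (extWeb_rungR hk (by omega) (by omega)).append h1

theorem CKMBase.exists_mem_ExtHom (h : CKMBase n x) : ∃ s t, x ∈ ExtHom n s t := by
  cases h with
  | switchTag k l hk hl h =>
    exact ⟨_, _, Submodule.sub_mem _ (dg_mem_ExtHom (extWeb_tagOut hk hl h))
      (Submodule.smul_mem _ _ (dg_mem_ExtHom (extWeb_tagOutSwitched hk hl h)))⟩
  | removeBigon k l h =>
    exact ⟨_, _, Submodule.sub_mem _ (dg_mem_ExtHom (extWeb_digon h))
      (Submodule.smul_mem _ _ (dg_mem_ExtHom (extWeb_nil.2 rfl)))⟩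
  | removeBigon' k l h =>
    exact ⟨_, _, Submodule.sub_mem _ (dg_mem_ExtHom (extWeb_loopRight h))
      (Submodule.smul_mem _ _ (dg_mem_ExtHom (extWeb_nil.2 rfl)))⟩
  | iEqH k l m h =>
    exact ⟨_, _, Submodule.sub_mem _ (dg_mem_ExtHom (extWeb_mergeI h.le))
      (dg_mem_ExtHom (extWeb_mergeH h.le))⟩
  | migrateTag k l m hk hl hm h =>
    exact ⟨_, _, Submodule.sub_mem _ (dg_mem_ExtHom (extWeb_mergeI h.le))
      (dg_mem_ExtHom (extWeb_mergeH h.le))⟩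
  | migrateTag' k l m hk hl hm h =>
    exact ⟨_, _, Submodule.sub_mem _ (dg_mem_ExtHom (extWeb_migrateTag_left h))
      (dg_mem_ExtHom (extWeb_migrateTag_right h))⟩
  | removeSquare k l r s hk hrs h =>
    exact ⟨_, _, Submodule.sub_mem _ (dg_mem_ExtHom (extWeb_rungR_rungR hk hrs h))
      (Submodule.smul_mem _ _ (dg_mem_ExtHom (extWeb_rungR hk hrs h)))⟩
  | switchSquare k l r s hk hl =>
    refine ⟨_, _, Submodule.sub_mem _ (ladderRL_mem_ExtHom r s hk)
      (Submodule.sum_mem _ fun t ht => Submodule.smul_mem _ _ (ladderLR_mem_ExtHom r s t ?_ ?_ hl))⟩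
    all_goals (simp only [Finset.mem_range] at ht; omega)

theorem extWeb_cancelTags {k l : ℕ} (hk : 0 < k) (hl : 0 < l) (h : k + l = n) :
    ExtWeb n [up k] [⟨[], .cup (dn l), [up k]⟩, ⟨[dn l], .tagIn l k, []⟩,
      ⟨[dn l], .tagOut l k, []⟩, ⟨[], .cap (dn l), [up k]⟩] [up k] := by
  simp [extWeb_cons, extWeb_nil, Slice.src, Slice.tgt, Gen.src, Gen.tgt, Gen.Ext, up, dn,
    Strand.dual]
  omega

theorem burstSquare_mem_ExtHom {k : ℕ} (hk : 2 ≤ k) (h : k + 1 ≤ n) :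
    dg (rungR k 1 1 ++ rungL (k - 1) 2 1) -
        (dg [⟨[], .merge k 1, []⟩, ⟨[], .split k 1, []⟩] + qNat (k - 1) • dg []) ∈
      ExtHom n [up k, up 1] [up k, up 1] := by
  refine Submodule.sub_mem _ (dg_mem_ExtHom ?_) (Submodule.add_mem _ (dg_mem_ExtHom ?_)
    (Submodule.smul_mem _ _ (dg_mem_ExtHom (extWeb_nil.2 rfl))))
  · have := extWeb_ladderRL (n := n) (k := k) (l := 1) (r := 1) (s := 1) (by omega)
      ⟨by omega, by omega, by omega, by omega⟩
    simpa [show k - 1 + 1 = k by omega] using this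
  · simp [extWeb_cons, extWeb_nil, Slice.src, Slice.tgt, Gen.src, Gen.tgt, Gen.Ext, h]

theorem ReducedBase.exists_mem_ExtHom (h : ReducedBase n x) : ∃ s t, x ∈ ExtHom n s t := by
  cases h with
  | switchTag k l hk hl h => exact (CKMBase.switchTag k l hk hl h).exists_mem_ExtHom
  | cancelTags k l hk hl h =>
    exact ⟨_, _, Submodule.sub_mem _ (dg_mem_ExtHom (extWeb_cancelTags hk hl h))
      (dg_mem_ExtHom (extWeb_nil.2 rfl))⟩
  | iEqH k l m hk hl hm h =>
    exact ⟨_, _, Submodule.sub_mem _ (dg_mem_ExtHom (extWeb_mergeI h))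
      (dg_mem_ExtHom (extWeb_mergeH h))⟩
  | burstDigon k hk h =>
    exact ⟨_, _, Submodule.sub_mem _ (dg_mem_ExtHom (extWeb_digon (by omega)))
      (Submodule.smul_mem _ _ (dg_mem_ExtHom (extWeb_nil.2 rfl)))⟩
  | burstSquare k hk h => exact ⟨_, _, burstSquare_mem_ExtHom hk h⟩

/-! ### The relators are not scalars -/

@[simp] theorem sizes_nil : sizes [] = 0 := rfl

@[simp] theorem sizes_append (u v : Word) : sizes (u ++ v) = sizes u + sizes v := by
  simp [sizes]

theorem sizes_cup (a b : List Strand) (x : Strand) (w : Word) :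
    sizes (⟨a, .cup x, b⟩ :: w) = sizes w := by simp [sizes, Gen.weight]

theorem sizes_cap (a b : List Strand) (x : Strand) (w : Word) :
    sizes (⟨a, .cap x, b⟩ :: w) = sizes w := by simp [sizes, Gen.weight]

theorem sizes_merge (a b : List Strand) (k l : ℕ) (w : Word) :
    sizes (⟨a, .merge k l, b⟩ :: w) = (if k = 0 ∨ l = 0 then 0 else {k + l}) + sizes w := by
  simp only [sizes, weight_cons, Gen.weight]; split_ifs <;> rfl

theorem sizes_split (a b : List Strand) (k l : ℕ) (w : Word) :
    sizes (⟨a, .split k l, b⟩ :: w) = (if k = 0 ∨ l = 0 then 0 else {k + l}) + sizes w := by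
  simp only [sizes, weight_cons, Gen.weight]; split_ifs <;> rfl

theorem sizes_tagOut (a b : List Strand) (k l : ℕ) (w : Word) :
    sizes (⟨a, .tagOut k l, b⟩ :: w) = (if k = 0 ∨ l = 0 then 0 else {k + l}) + sizes w := by
  simp only [sizes, weight_cons, Gen.weight]; split_ifs <;> rfl

@[simp] theorem sizeCoeff_dg (w : Word) : sizeCoeff (dg w) = Finsupp.single (sizes w) 1 :=
  Finsupp.mapDomain_single

theorem sizeCoeff_sub (x y : Lin) : sizeCoeff (x - y) = sizeCoeff x - sizeCoeff y :=
  map_sub (Finsupp.lmapDomain K K sizes) x y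

theorem sizeCoeff_smul (a : K) (x : Lin) : sizeCoeff (a • x) = a • sizeCoeff x :=
  map_smul (Finsupp.lmapDomain K K sizes) a x

theorem Weighted.nonScalar_sub (hf : Weighted n f) (a : K) (w w' : Word)
    (h : sizes w = 0 → a ≠ 0 ∧ (sizes w' = 0 → a = 1)) :
    NonScalar (lin f (dg w - a • dg w')) := by
  classical
  refine hf.nonScalar_of_sizeCoeff fun H => ?_
  simp only [sizeCoeff_sub, sizeCoeff_smul, sizeCoeff_dg, Finsupp.smul_single, smul_eq_mul,
    mul_one] at H ⊢
  have h1 := H (sizes w)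
  have h2 := H (sizes w')
  simp only [Finsupp.sub_apply, Finsupp.single_eq_same] at h1 h2
  by_cases e : sizes w = sizes w'
  · rw [e] at h1 h ⊢
    rw [Finsupp.single_eq_same] at h1
    by_cases h0 : sizes w' = 0
    · rw [(h h0).2 h0, sub_self]
    · rw [← sub_eq_zero.1 (h1 h0), sub_self]
  · rw [Finsupp.single_eq_of_ne e] at h1
    rw [Finsupp.single_eq_of_ne (Ne.symm e)] at h2
    by_cases h0 : sizes w = 0
    · have := h2 (fun h3 => e (h0.trans h3.symm))
      exact absurd (by simpa using this) (h h0).1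
    · exact absurd (h1 h0) (by simp)

theorem Weighted.nonScalar_dg_sub_dg (hf : Weighted n f) (w w' : Word) :
    NonScalar (lin f (dg w - dg w')) := by
  simpa using hf.nonScalar_sub 1 w w' fun _ => ⟨one_ne_zero, fun _ => rfl⟩

theorem sizes_rungR (k l s : ℕ) (h : s ≤ k) :
    sizes (rungR k l s) =
      (if k = s ∨ s = 0 then 0 else {k}) + if s = 0 ∨ l = 0 then 0 else {l + s} := by
  rw [rungR, sizes_split, sizes_merge, sizes_nil, Nat.sub_add_cancel h, add_comm s l, add_zero]
  congr 2
  simp only [eq_iff_iff]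
  omega

theorem sizes_rungL (k l r : ℕ) (h : r ≤ l) :
    sizes (rungL k l r) =
      (if r = 0 ∨ l = r then 0 else {l}) + if k = 0 ∨ r = 0 then 0 else {k + r} := by
  rw [rungL, sizes_split, sizes_merge, sizes_nil, Nat.add_sub_cancel' h, add_zero]
  congr 2
  simp only [eq_iff_iff]
  omega

theorem sizes_ladderRL {k l r : ℕ} (hk : k ≤ n) (h : r ≤ k ∧ l + r ≤ n) (hkl : n < k + l)
    (hr : r ≠ 0) :
    sizes (rungR k l r ++ rungL (k - r) (l + r) r) = {k, l + r, l + r, k} := by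
  rw [sizes_append, sizes_rungR _ _ _ h.1, sizes_rungL _ _ _ (by omega), if_neg (by omega),
    if_neg (by omega), if_neg (by omega), if_neg (by omega), Nat.sub_add_cancel h.1]
  rfl

theorem sizes_ladderLR {k l r : ℕ} (hl : l ≤ n) (h : r ≤ l ∧ k + r ≤ n) (hkl : n < k + l)
    (hr : r ≠ 0) :
    sizes (rungL k l r ++ rungR (k + r) (l - r) r) = {l, k + r, k + r, l} := by
  rw [sizes_append, sizes_rungR _ _ _ (by omega), sizes_rungL _ _ _ h.1, if_neg (by omega),
    if_neg (by omega), if_neg (by omega), if_neg (by omega), Nat.sub_add_cancel h.1]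
  rfl

theorem sizes_ladderRL_ne_zero {k l s : ℕ} (h : s ≤ k) (hkl : n < k + l) (hk : k ≤ n)
    (hs : s ≠ 0) (u : Word) : sizes (rungR k l s ++ u) ≠ 0 := by
  rw [sizes_append, sizes_rungR _ _ _ h]
  intro h0
  rw [add_eq_zero, add_eq_zero] at h0
  have h1 := h0.1.2
  split_ifs at h1 with h2
  · have h3 := h0.1.1
    split_ifs at h3 with h4
    · omega
    · simp at h3
  · simp at h1

theorem sizeCoeff_ladderRL (k l s r : ℕ) (m : Multiset ℕ)
    [Decidable (s ≤ k ∧ l + s ≤ n ∧ r ≤ l + s ∧ k - s + r ≤ n ∧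
      sizes (rungR k l s ++ rungL (k - s) (l + s) r) = m)] :
    sizeCoeff (ladderRL n k l s r) m = if s ≤ k ∧ l + s ≤ n ∧ r ≤ l + s ∧ k - s + r ≤ n ∧
      sizes (rungR k l s ++ rungL (k - s) (l + s) r) = m then 1 else 0 := by
  classical
  unfold ladderRL
  by_cases h : s ≤ k ∧ l + s ≤ n ∧ r ≤ l + s ∧ k - s + r ≤ n
  · rw [if_pos h, sizeCoeff_dg, Finsupp.single_apply]
    congr 1; simp [h]
  · rw [if_neg h, if_neg (by tauto)]; simp [sizeCoeff]

theorem sizeCoeff_ladderLR (k l r s : ℕ) (m : Multiset ℕ)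
    [Decidable (r ≤ l ∧ k + r ≤ n ∧ s ≤ k + r ∧ l - r + s ≤ n ∧
      sizes (rungL k l r ++ rungR (k + r) (l - r) s) = m)] :
    sizeCoeff (ladderLR n k l r s) m = if r ≤ l ∧ k + r ≤ n ∧ s ≤ k + r ∧ l - r + s ≤ n ∧
      sizes (rungL k l r ++ rungR (k + r) (l - r) s) = m then 1 else 0 := by
  classical
  unfold ladderLR
  by_cases h : r ≤ l ∧ k + r ≤ n ∧ s ≤ k + r ∧ l - r + s ≤ n
  · rw [if_pos h, sizeCoeff_dg, Finsupp.single_apply]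
    congr 1; simp [h]
  · rw [if_neg h, if_neg (by tauto)]; simp [sizeCoeff]

/-- The relator of square switching. -/
def switchSquareRelator (n k l r s : ℕ) : Lin :=
  ladderRL n k l s r - ∑ t ∈ Finset.range (min r s + 1),
    qBinom ((k : ℤ) - l + r - s) t • ladderLR n k l (r - t) (s - t)

theorem sizeCoeff_switchSquare (k l r s : ℕ) (m : Multiset ℕ) :
    sizeCoeff (switchSquareRelator n k l r s) m = sizeCoeff (ladderRL n k l s r) m -
      ∑ t ∈ Finset.range (min r s + 1),
        qBinom ((k : ℤ) - l + r - s) t * sizeCoeff (ladderLR n k l (r - t) (s - t)) m := by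
  have h : ∀ (ι : Finset ℕ) (y : ℕ → Lin), sizeCoeff (∑ t ∈ ι, y t) = ∑ t ∈ ι, sizeCoeff (y t) :=
    fun ι y => map_sum (Finsupp.lmapDomain K K sizes) y ι
  simp [switchSquareRelator, sizeCoeff_sub, h, sizeCoeff_smul]

/-- For `k + l > n`, the empty diagram only occurs in square switching with the coefficient
`[k - l, r]`, and if it does then one of the other diagrams cannot cancel. -/
theorem sizeCoeff_switchSquare_eq_zero {k l r s : ℕ} (hk : k ≤ n) (hl : l ≤ n) (hkl : n < k + l)
    (hr : r ≠ 0) (hs : s ≠ 0)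
    (H : ∀ m ≠ 0, sizeCoeff (switchSquareRelator n k l r s) m = 0) :
    sizeCoeff (switchSquareRelator n k l r s) = 0 := by
  classical
  ext m
  by_cases hm : m = 0
  swap
  · exact H m hm
  subst hm
  have hLR : ∀ t ∈ Finset.range (min r s + 1), ¬ (t = r ∧ t = s) →
      sizeCoeff (ladderLR n k l (r - t) (s - t)) 0 = 0 := by
    intro t ht hrs
    simp only [Finset.mem_range] at ht
    rw [sizeCoeff_ladderLR, if_neg]
    rintro ⟨h1, h2, h3, h4, h5⟩
    rw [sizes_append, sizes_rungR _ _ _ h3, sizes_rungL _ _ _ h1, add_eq_zero,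
      add_eq_zero, add_eq_zero] at h5
    obtain ⟨⟨h5, h6⟩, h7, h8⟩ := h5
    split_ifs at h5 h6 h7 h8 <;> first | omega | simp_all
  rw [sizeCoeff_switchSquare, sizeCoeff_ladderRL,
    if_neg (fun h => sizes_ladderRL_ne_zero (n := n) h.1 hkl hk hs _ h.2.2.2.2)]
  by_cases hrs : r = s
  swap
  · rw [Finset.sum_eq_zero fun t ht => by rw [hLR t ht (by omega), mul_zero]]; simp
  subst hrs
  by_contra hne
  have hq : qBinom ((k : ℤ) - l) r ≠ 0 := by
    rw [Finset.sum_eq_single r (fun t ht htr => by rw [hLR t ht (by omega), mul_zero]) (by simp)]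
      at hne
    intro h
    apply hne
    rw [add_sub_cancel_right, h]; simp
  have hq' := qBinom_eq_zero_iff.not.1 hq
  by_cases hR : r ≤ k ∧ l + r ≤ n
  -- The sizes of the vertices of the left-hand side, which none of the summands has.
  · have h1 := H {k, l + r, l + r, k} (by simp)
    rw [sizeCoeff_switchSquare, sizeCoeff_ladderRL,
      if_pos ⟨hR.1, hR.2, by omega, by omega, sizes_ladderRL hk hR hkl hr⟩,
      Finset.sum_eq_zero] at h1
    · simp at h1
    intro t ht
    simp only [Finset.mem_range] at ht
    rw [sizeCoeff_ladderLR, if_neg, mul_zero]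
    rintro ⟨h2, h3, h4, h5, h6⟩
    by_cases htr : t = r
    · subst htr
      simp [sizes_rungL, sizes_rungR] at h6
    · rw [sizes_ladderLR hl ⟨h2, h3⟩ hkl (by omega)] at h6
      have h7 : l ∈ ({k, l + r, l + r, k} : Multiset ℕ) := by rw [← h6]; simp
      simp at h7
      omega
  -- The left-hand side is zero. Only the summand `t = r - 1` has these vertices, and its
  -- coefficient `[k - l, r - 1]` is nonzero with `[k - l, r]`.
  · have h1 := H {l, k + 1, k + 1, l} (by simp)
    rw [sizeCoeff_switchSquare, sizeCoeff_ladderRL, if_neg (by tauto), zero_sub, neg_eq_zero,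
      Finset.sum_eq_single (r - 1)] at h1
    · rw [sizeCoeff_ladderLR, show r - (r - 1) = 1 by omega, if_pos ⟨by omega, by omega, by omega,
        by omega, sizes_ladderLR hl ⟨by omega, by omega⟩ hkl one_ne_zero⟩, mul_one,
        add_sub_cancel_right, qBinom_eq_zero_iff] at h1
      omega
    · intro t ht htr
      simp only [Finset.mem_range] at ht
      rw [sizeCoeff_ladderLR, if_neg, mul_zero]
      rintro ⟨h2, h3, h4, h5, h6⟩
      by_cases htr' : t = r
      · subst htr'
        simp [sizes_rungL, sizes_rungR] at h6
      · rw [sizes_ladderLR hl ⟨h2, h3⟩ hkl (by omega)] at h6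
        have h7 : k + 1 ∈ ({l, k + (r - t), k + (r - t), l} : Multiset ℕ) := by rw [h6]; simp
        have h8 : k + (r - t) ∈ ({l, k + 1, k + 1, l} : Multiset ℕ) := by rw [← h6]; simp
        simp at h7 h8
        omega
    · simp

theorem weight_rungR (k l s : ℕ) (h : s ≤ k) :
    weight binomWeight (fun _ _ => 1) (rungR k l s) = qBinom k s := by
  have h1 := qBinom_eq_qFact (k - s) s
  rw [Nat.sub_add_cancel h, ← Nat.cast_add, Nat.sub_add_cancel h] at h1
  simp only [rungR, weight_cons, weight_nil, Gen.weight, ite_self, mul_one]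
  split_ifs with h2
  · rcases h2 with h2 | rfl
    · have : s = k := by omega
      subst this; simp
    · simp
  · rw [binomWeight, Nat.sub_add_cancel h, h1]

theorem weight_rungL (k l r : ℕ) (h : r ≤ l) :
    weight binomWeight (fun _ _ => 1) (rungL k l r) = qBinom l r := by
  have h1 := weight_rungR l k r h
  rw [← h1]
  simp only [rungR, rungL, weight_cons, weight_nil, Gen.weight, ite_self, mul_one,
    binomWeight_comm r, or_comm (a := r = 0)]

/-- Square switching holds for the action of divided powers on polynomials in two variables. -/
theorem weight_switchSquare {k l r s : ℕ} (h : k + l ≤ n) :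
    Finsupp.linearCombination K (weight binomWeight fun _ _ => 1)
      (switchSquareRelator n k l r s) = 0 := by
  have hRL : Finsupp.linearCombination K (weight binomWeight fun _ _ => 1) (ladderRL n k l s r) =
      qBinom k s * qBinom (l + s : ℕ) r := by
    unfold ladderRL
    split_ifs with h1
    · simp [dg, weight_rungR _ _ _ h1.1, weight_rungL _ _ _ h1.2.2.1]
    · by_cases hs : s ≤ k
      · rw [qBinom_eq_zero (m := l + s) (t := r) (by omega), mul_zero, map_zero]
      · rw [qBinom_eq_zero (m := k) (t := s) (by omega), zero_mul, map_zero]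
  have hLR : ∀ r s, Finsupp.linearCombination K (weight binomWeight fun _ _ => 1)
      (ladderLR n k l r s) = qBinom l r * qBinom (k + r : ℕ) s := by
    intro r s
    unfold ladderLR
    split_ifs with h1
    · simp [dg, weight_rungR _ _ _ h1.2.2.1, weight_rungL _ _ _ h1.1]
    · by_cases hs : r ≤ l
      · rw [qBinom_eq_zero (m := k + r) (t := s) (by omega), mul_zero, map_zero]
      · rw [qBinom_eq_zero (m := l) (t := r) (by omega), zero_mul, map_zero]
  have := (scalarPowers n (k + l) h).F_mul_E s r k l rfl (by omega) (by omega)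
  simp only [scalarPowers, smul_eq_mul] at this
  simp only [switchSquareRelator, map_sub, map_sum, map_smul, hRL, hLR, this, smul_eq_mul, sub_self]

theorem nonScalar_switchSquare (hf : Weighted n f) {k l r s : ℕ} (hk : k ≤ n) (hl : l ≤ n) :
    NonScalar (lin f (switchSquareRelator n k l r s)) := by
  by_cases h : r = 0 ∨ s = 0
  · have h1 : switchSquareRelator n k l r s = ladderRL n k l s r - ladderLR n k l r s := by
      rw [switchSquareRelator, show min r s = 0 by omega]; simp
    rw [h1, ladderRL, ladderLR]
    split_ifs with h2 h3 h3
    · exact hf.nonScalar_dg_sub_dg _ _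
    · omega
    · omega
    · exact Or.inl (by simp)
  · push Not at h
    by_cases hkl : k + l ≤ n
    · exact hf.nonScalar_of_weight (weight_switchSquare hkl)
    · exact hf.nonScalar_of_sizeCoeff
        (sizeCoeff_switchSquare_eq_zero hk hl (by omega) h.1 h.2)

/-- Either a nonempty diagram is left over, or the relator has lost all its vertices and then its
coefficients add up to zero. -/
theorem CKMBase.nonScalar (hf : Weighted n f) (h : CKMBase n x) : NonScalar (lin f x) := by
  cases h with
  | switchTag k l hk hl h =>
    refine hf.nonScalar_sub _ _ _ fun h0 => ?_
    rw [sizes_tagOut, if_neg (by omega)] at h0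
    simp at h0
  | removeBigon k l h =>
    refine hf.nonScalar_sub _ _ _ fun h0 => ?_
    rw [digon, sizes_split, sizes_merge] at h0
    have : qBinom ((k : ℤ) + l) l = 1 := by
      split_ifs at h0 with h1
      · rcases h1 with rfl | rfl <;> simp
      · simp at h0
    simp [this]
  | removeBigon' k l h =>
    -- For `k = 0` the vertices disappear, but the loop remains as a closed strand.
    by_cases hl : k = 0 ∧ 0 < l ∧ l < n
    · refine Or.inr ⟨_, hf.cup_ne_nil [up k] (up l) [] [⟨[], .merge k l, [dn l]⟩,
        ⟨[], .split k l, [dn l]⟩, ⟨[up k], .cap (up l), []⟩] hl.2.1 hl.2.2, ?_⟩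
      have h1 := hf.cup_ne_nil [up k] (up l) [] [⟨[], .merge k l, [dn l]⟩,
        ⟨[], .split k l, [dn l]⟩, ⟨[up k], .cap (up l), []⟩] hl.2.1 hl.2.2
      rw [map_sub, map_smul, lin_dg, lin_dg, hf.map_nil]
      simp [dg, Finsupp.single_eq_of_ne h1]
    · refine hf.nonScalar_sub _ _ _ fun h0 => ?_
      rw [sizes_cup, sizes_merge, sizes_split, sizes_cap] at h0
      have : qBinom ((n : ℤ) - k) l = 1 := by
        split_ifs at h0 with h1
        · rcases h1 with rfl | rfl
          · rcases Nat.eq_zero_or_pos l with rfl | hl'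
            · simp
            · have : l = n := by omega
              subst this; simp
          · simp
        · simp at h0
      simp [this]
  | iEqH k l m h => exact hf.nonScalar_dg_sub_dg _ _
  | migrateTag k l m hk hl hm h => exact hf.nonScalar_dg_sub_dg _ _
  | migrateTag' k l m hk hl hm h => exact hf.nonScalar_dg_sub_dg _ _
  | removeSquare k l r s hk hrs h =>
    refine hf.nonScalar_sub _ _ _ fun h0 => ⟨?_, fun h1 => ?_⟩
    · have := qBinom_eq_zero_iff.not.2
        (show ¬ (0 ≤ ((r + s : ℕ) : ℤ) ∧ ((r + s : ℕ) : ℤ) < r) by omega)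
      simpa using this
    · rw [sizes_append, sizes_rungR _ _ _ (by omega), sizes_rungR _ _ _ (by omega)] at h0
      have : r = 0 ∨ s = 0 := by
        simp only [add_eq_zero] at h0
        obtain ⟨⟨h2, h3⟩, h4, h5⟩ := h0
        by_contra h6
        split_ifs at h2 with h7
        · omega
        · simp at h2
      rcases this with rfl | rfl <;> simp
  | switchSquare k l r s hk hl => exact nonScalar_switchSquare hf hk hl

theorem ReducedBase.nonScalar (hf : Weighted n f) (h : ReducedBase n x) : NonScalar (lin f x) := by
  cases h with
  | switchTag k l hk hl h => exact (CKMBase.switchTag k l hk hl h).nonScalar hf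
  | cancelTags k l hk hl h => exact hf.nonScalar_dg_sub_dg _ _
  | iEqH k l m hk hl hm h => exact hf.nonScalar_dg_sub_dg _ _
  | burstDigon k hk h =>
    refine hf.nonScalar_sub _ _ _ fun h0 => ?_
    rw [digon, sizes_split, if_neg (by omega)] at h0
    simp at h0
  | burstSquare k hk h =>
    refine hf.nonScalar_of_sizeCoeff fun H => ?_
    exfalso
    have h1 := H {k, 1 + 1, 2, k - 1 + 1} (by simp)
    have h2 : sizes (rungR k 1 1 ++ rungL (k - 1) 2 1) = {k, 1 + 1, 2, k - 1 + 1} := by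
      rw [sizes_append, sizes_rungR _ _ _ (by omega), sizes_rungL _ _ _ (by omega),
        if_neg (by omega), if_neg (by omega), if_neg (by omega), if_neg (by omega)]
      rfl
    have h3 : ∀ y z : Lin, sizeCoeff (y + z) = sizeCoeff y + sizeCoeff z :=
      map_add (Finsupp.lmapDomain K K sizes)
    rw [sizeCoeff_sub, h3, sizeCoeff_smul, sizeCoeff_dg, sizeCoeff_dg, sizeCoeff_dg, h2,
      sizes_merge, sizes_split, if_neg (by omega), sizes_nil, Finsupp.sub_apply,
      Finsupp.single_eq_same, Finsupp.add_apply, Finsupp.single_eq_of_ne, Finsupp.smul_apply,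
      Finsupp.single_eq_of_ne] at h1
    · simp at h1
    · simp
    · intro h4
      have := congrArg Multiset.card h4
      simp at this

end

noncomputable section

variable {n : ℕ} {R R' : Set Lin} {c : Convention} {s t : List Strand} {x : Lin}

/-! ### The sets of relators -/

/-- The relators of Cautis, Kamnitzer and Morrison, drawn in either of the two conventions for the
tags of deleted strands. -/
def ckmWith (n : ℕ) (c : Convention) : Set Lin :=
  {y | ∃ x, CKMBase n x ∧
    (y = lin (delete n c) x ∨ y = lin (delete n c) (lin mirror x) ∨
      y = lin (delete n c) (lin reverse x) ∨
      y = lin (delete n c) (lin reverse (lin mirror x)))}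

theorem placeable_ckmWith (hx : x ∈ ckmWith n c) : Placeable n x := by
  obtain ⟨x, hb, h⟩ := hx
  obtain ⟨s, t, hH⟩ := hb.exists_mem_ExtHom
  rcases h with rfl | rfl | rfl | rfl
  · exact (hb.nonScalar weighted_delete).placeable (lin_delete_mem_Hom hH)
  · have h1 := hb.nonScalar (weighted_delete_mirror (n := n) (c := c))
    rw [← lin_lin] at h1
    exact h1.placeable (lin_delete_mem_Hom (lin_mirror_mem_ExtHom hH))
  · have h1 := hb.nonScalar (weighted_delete_reverse (n := n) (c := c))
    rw [← lin_lin] at h1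
    exact h1.placeable (lin_delete_reverse_mem_Hom hH)
  · have h1 := hb.nonScalar (weighted_delete_reverse_mirror (n := n) (c := c))
    rw [← lin_lin, ← lin_lin] at h1
    exact h1.placeable (lin_delete_reverse_mem_Hom (lin_mirror_mem_ExtHom hH))

theorem placeable_reduced (hx : x ∈ reduced n) : Placeable n x := by
  obtain ⟨x, hb, h⟩ := hx
  obtain ⟨s, t, hH⟩ := hb.exists_mem_ExtHom
  rcases h with rfl | rfl
  · exact (hb.nonScalar weighted_delete).placeable (lin_delete_mem_Hom hH)
  · have h1 := hb.nonScalar (weighted_delete_reverse (n := n) (c := .toward))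
    rw [← lin_lin] at h1
    exact h1.placeable (lin_delete_reverse_mem_Hom hH)

/-! ### The reduced relations are invariant under reflections -/

theorem delete_of_slicesOK {w : Word} (h : SlicesOK n w) : delete n c w = w := by
  induction w with
  | nil => rfl
  | cons σ w ih =>
    simp only [slicesOK_cons] at h
    obtain ⟨⟨h1, h2, h3⟩, h4⟩ := h
    have : σ.gen.delete n c = [⟨[], σ.gen, []⟩] := by
      cases hg : σ.gen <;> rw [hg] at h2 <;> simp only [Gen.OK] at h2 <;> simp only [Gen.delete]
      · rw [if_pos h2]
      · rw [if_pos h2]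
      · rw [if_neg (by omega), if_neg (by omega)]
      · rw [if_neg (by omega), if_neg (by omega)]
    rw [delete_cons, ih h4, deleteRow_of_rowOK h1, deleteRow_of_rowOK h3, this]
    simp

theorem lin_flip_lin_mirror (x : Lin) : lin flip (lin mirror x) = lin mirror (lin flip x) := by
  rw [lin_lin, lin_lin]
  congr 2; funext w; exact (mirror_flip w).symm

theorem lin_mirror_lin_mirror (x : Lin) : lin mirror (lin mirror x) = x := by
  rw [lin_lin]
  have : mirror ∘ mirror = id := funext mirror_mirror
  rw [this]; simp [lin]

theorem lin_delete_mem_reduced (hb : ReducedBase n x) (hx : x ∈ ExtHom n s t) :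
    lin (delete n .toward) x ∈ relations n (reduced n) (deleteRow n s) (deleteRow n t) :=
  mem_relations_of_mem (Or.inr ⟨x, hb, Or.inl rfl⟩) (lin_delete_mem_Hom hx)

theorem lin_delete_flip_mirror_mem_reduced (hb : ReducedBase n x) (hx : x ∈ ExtHom n s t) :
    lin (delete n .toward) (lin flip (lin mirror x)) ∈
      relations n (reduced n) (deleteRow n t).reverse (deleteRow n s).reverse :=
  (lin_delete_reverse_mem_iff hx).1
    (mem_relations_of_mem (Or.inr ⟨x, hb, Or.inr rfl⟩) (lin_delete_reverse_mem_Hom hx))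

/-- Rotating the outgoing vertex by a full turn: its right strand may be bent to the right, or its
left strand to the left. -/
theorem ev_tagOut_bend (k l : ℕ) (a b : List Strand) :
    ev n R a (mirror (tagOutSwitched k l)) b = ev n R a (tagOutSwitched l k) b := by
  have hT : IsPath [] (tagOutSwitched l k) [up l, up k] := by
    simp [tagOutSwitched, up, dn, Strand.dual, Slice.src, Slice.tgt, Gen.src, Gen.tgt]
  have hT' : IsPath [] (mirror (tagOutSwitched k l)) [up l, up k] := by
    simp [tagOutSwitched, mirror, up, dn, Strand.dual, Slice.src, Slice.tgt, Gen.src, Gen.tgt,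
      Gen.mirror]
  have h1 := piece_ev_exchange (n := n) (R := R) (g := .cup (up l)) hT a [] b
  have h2 := ev_piece_exchange (n := n) (R := R) (g := .cup (dn k)) hT' a [] b
  have h3 := cup_mul_cap (n := n) (R := R) (up l) a (up k :: b)
  have h4 := cup_mul_cap' (n := n) (R := R) (up k) (a ++ [up l]) b
  have h5 := ev_rot_gen (n := n) (R := R) (.tagOut k l) (a ++ [up l]) (up k :: b)
  have h6 := piece_exchange (n := n) (R := R) (.cup (up l)) (.cup (dn k)) a [] b
  have h7 := ev_mul_idem_of_ne_nil (n := n) (R := R) (a := a) (b := b) hT (by simp [tagOutSwitched])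
  have h8 := ev_mul_idem_of_ne_nil (n := n) (R := R) (a := a) (b := b) hT'
    (by simp [tagOutSwitched, mirror])
  simp [tagOutSwitched, mirror, Gen.mirror, rotW, rotW', cups, caps, ev_cons, Gen.src, Gen.tgt,
    up, dn, Strand.dual, dualRow, whisker] at h1 h2 h3 h4 h5 h6 h7 h8 ⊢
  rw [← h8, ← h4, ← mul_assoc, h2, ← h7, ← h3,
    ← mul_assoc _ (piece n R a (.cup ⟨l, true⟩) (⟨l, true⟩ :: ⟨k, true⟩ :: b)), ← h1]
  simp only [mul_assoc]
  rw [← h5, ← mul_assoc, ← h6]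
  simp only [mul_assoc]

theorem iso_mirror_tagOutSwitched {k l : ℕ} (hk : 0 < k) (hl : 0 < l) (h : k + l = n) :
    Iso n [] [up l, up k] (mirror (tagOutSwitched k l)) (tagOutSwitched l k) :=
  Iso.of_ev (by simpa using (isWeb_tagOutSwitched hk hl h).mirror)
    (isWeb_tagOutSwitched hl hk (by omega)) (by rw [ev_tagOut_bend])

theorem mem_relations_congr {y : Lin} (h : x - y ∈ relations n R s t) :
    x ∈ relations n R s t ↔ y ∈ relations n R s t := by
  constructor
  · intro hx
    simpa using Submodule.sub_mem _ hx h
  · intro hy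
    simpa using Submodule.add_mem _ h hy

/-- Changing the side of the tag of an outgoing vertex. -/
def switchTagRelator (k l : ℕ) : Lin :=
  dg [⟨[], .tagOut k l, []⟩] - (-1 : K) ^ (k * l) • dg (tagOutSwitched k l)

theorem lin_delete_switchTag {k l : ℕ} (hk : 0 < k) (hl : 0 < l) (h : k + l = n) :
    lin (delete n c) (switchTagRelator k l) = switchTagRelator k l := by
  simp only [switchTagRelator, map_sub, map_smul, lin_dg]
  rw [delete_of_slicesOK (isWeb_iff.1 (isWeb_tagOutSwitched hk hl h)).2.1, delete_gen, Gen.delete]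

theorem mirror_switchTag_sub_mem {k l : ℕ} (hk : 0 < k) (hl : 0 < l) (h : k + l = n) :
    lin mirror (switchTagRelator k l) - switchTagRelator l k ∈ relations n R [] [up l, up k] := by
  have h1 := Submodule.smul_mem _ (-(-1 : K) ^ (k * l))
    ((iso_mirror_tagOutSwitched hk hl h).sub_mem (R := R))
  have e : lin mirror (switchTagRelator k l) - switchTagRelator l k =
      -(-1 : K) ^ (k * l) • (dg (mirror (tagOutSwitched k l)) - dg (tagOutSwitched l k)) := by
    simp only [switchTagRelator, map_sub, map_smul, lin_dg, mul_comm l k]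
    have : mirror [⟨[], .tagOut k l, []⟩] = [⟨[], .tagOut l k, []⟩] := rfl
    rw [this, neg_smul, smul_sub]
    abel
  rwa [e]

/-- The relators of the reduced list are invariant under the two reflections. -/
theorem ReducedBase.reflect (hb : ReducedBase n x) : ∃ s t, x ∈ ExtHom n s t ∧
    lin mirror (lin (delete n .toward) x) ∈
        relations n (reduced n) (deleteRow n s).reverse (deleteRow n t).reverse ∧
      lin flip (lin (delete n .toward) x) ∈
        relations n (reduced n) (deleteRow n t) (deleteRow n s) := by
  have symm : ∀ {x s}, ReducedBase n x → x ∈ ExtHom n s s → lin flip x = x →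
      ∃ s t, x ∈ ExtHom n s t ∧ lin mirror (lin (delete n .toward) x) ∈
        relations n (reduced n) (deleteRow n s).reverse (deleteRow n t).reverse ∧
      lin flip (lin (delete n .toward) x) ∈
        relations n (reduced n) (deleteRow n t) (deleteRow n s) := by
    intro x s hb hx hf
    have h1 := lin_delete_flip_mirror_mem_reduced hb hx
    have h2 := lin_delete_mem_reduced hb hx
    rw [lin_flip_lin_mirror, hf, lin_mirror_delete] at h1
    refine ⟨s, s, hx, h1, ?_⟩
    rwa [← lin_flip_delete, hf]
  have hb' := hb
  cases hb with
  | switchTag k l hk hl h =>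
    refine ⟨[], [up k, up l], Submodule.sub_mem _ (dg_mem_ExtHom (extWeb_tagOut hk hl h))
      (Submodule.smul_mem _ _ (dg_mem_ExtHom (extWeb_tagOutSwitched hk hl h))), ?_⟩
    have hx' : switchTagRelator l k ∈ ExtHom n [] [up l, up k] :=
      Submodule.sub_mem _ (dg_mem_ExtHom (extWeb_tagOut hl hk (by omega)))
        (Submodule.smul_mem _ _ (dg_mem_ExtHom (extWeb_tagOutSwitched hl hk (by omega))))
    have hb'' : ReducedBase n (switchTagRelator l k) := .switchTag l k hl hk (by omega)
    have h1 := lin_delete_mem_reduced hb'' hx'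
    have h2 := lin_delete_flip_mirror_mem_reduced hb'' hx'
    have h3 := lin_delete_switchTag (c := .toward) hk hl h
    have h4 := lin_delete_switchTag (n := n) (c := .toward) hl hk (by omega)
    have hk' : deleteRow n [up k] = [up k] := deleteRow_of_rowOK (by simp [up]; omega)
    have hl' : deleteRow n [up l] = [up l] := deleteRow_of_rowOK (by simp [up]; omega)
    have hkl : deleteRow n [up k, up l] = [up k, up l] :=
      deleteRow_of_rowOK (by simp [up]; omega)
    have hlk : deleteRow n [up l, up k] = [up l, up k] :=
      deleteRow_of_rowOK (by simp [up]; omega)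
    have h5 := mirror_switchTag_sub_mem (R := reduced n) hk hl h
    have h6 := lin_mirror_mem_relations (R := ∅) (R' := reduced n) (by simp) (by simp)
      (mirror_switchTag_sub_mem (R := ∅) hk hl h)
    have h7 := lin_flip_mem_relations (R := ∅) (R' := reduced n) (by simp) (by simp)
      (lin_mirror_mem_relations (R := ∅) (R' := ∅) (by simp) (by simp)
        (mirror_switchTag_sub_mem (R := ∅) hk hl h))
    rw [map_sub, lin_mirror_lin_mirror, map_sub] at h7
    rw [lin_flip_delete, lin_mirror_delete] at h2
    rw [h4] at h1 h2
    change lin mirror (lin _ (switchTagRelator k l)) ∈ _ ∧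
      lin flip (lin _ (switchTagRelator k l)) ∈ _
    rw [h3, hkl]
    rw [hlk] at h1 h2
    exact ⟨(mem_relations_congr h5).2 h1, (mem_relations_congr h7).2 h2⟩
  | cancelTags k l hk hl h =>
    exact symm hb' (Submodule.sub_mem _ (dg_mem_ExtHom (extWeb_cancelTags hk hl h))
      (dg_mem_ExtHom (extWeb_nil.2 rfl))) (by rw [map_sub, lin_dg, lin_dg]; rfl)
  | iEqH k l m hk hl hm h =>
    have hx : dg (mergeI k l m) - dg (mergeH k l m) ∈ ExtHom n [up k, up l, up m]
        [up (k + l + m)] := Submodule.sub_mem _ (dg_mem_ExtHom (extWeb_mergeI h))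
      (dg_mem_ExtHom (extWeb_mergeH h))
    have hx' : dg (mergeI m l k) - dg (mergeH m l k) ∈ ExtHom n [up m, up l, up k]
        [up (m + l + k)] := Submodule.sub_mem _ (dg_mem_ExtHom (extWeb_mergeI (by omega)))
      (dg_mem_ExtHom (extWeb_mergeH (by omega)))
    have hb'' : ReducedBase n (dg (mergeI m l k) - dg (mergeH m l k)) :=
      .iEqH m l k hm hl hk (by omega)
    have e1 : ∀ k l m, mirror (mergeI k l m) = mergeH m l k := fun k l m => by
      simp [mergeI, mergeH, mirror, Gen.mirror, add_comm]
    have e2 : ∀ k l m, mirror (mergeH k l m) = mergeI m l k := fun k l m => by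
      rw [← e1, mirror_mirror]
    have e3 : lin mirror (dg (mergeI k l m) - dg (mergeH k l m)) =
        -(dg (mergeI m l k) - dg (mergeH m l k)) := by
      rw [map_sub, lin_dg, lin_dg, e1, e2]; abel
    have h1 := lin_delete_mem_reduced hb'' hx'
    have h2 := lin_delete_flip_mirror_mem_reduced hb'' hx'
    rw [← neg_eq_iff_eq_neg] at e3
    rw [← e3, map_neg] at h1
    rw [← e3, map_neg, lin_mirror_lin_mirror, map_neg, map_neg] at h2
    rw [← lin_mirror_delete, ← lin_flip_delete]
    refine ⟨_, _, hx, ?_, ?_⟩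
    · simpa [← deleteRow_reverse, show m + l + k = k + l + m by omega] using
        Submodule.neg_mem _ h1
    · simpa [← deleteRow_reverse, show m + l + k = k + l + m by omega] using
        Submodule.neg_mem _ h2
  | burstDigon k hk h =>
    exact symm hb' (Submodule.sub_mem _ (dg_mem_ExtHom (extWeb_digon (by omega)))
      (Submodule.smul_mem _ _ (dg_mem_ExtHom (extWeb_nil.2 rfl))))
      (by rw [map_sub, map_smul, lin_dg, lin_dg]; rfl)
  | burstSquare k hk h =>
    exact symm (s := [up k, up 1]) hb' (burstSquare_mem_ExtHom hk h)
      (by rw [map_sub, map_add, map_smul, lin_dg, lin_dg, lin_dg]; rfl)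

/-- Reflections of a relator with reversed arrows, in terms of the relator itself. -/
theorem lin_reflect_delete_reverse_mem (hx : x ∈ ExtHom n s t) :
    (lin flip (lin (delete n .toward) x) ∈ relations n R (deleteRow n t) (deleteRow n s) →
      lin mirror (lin (delete n .toward) (lin reverse x)) ∈ relations n R
        (dualRow (deleteRow n s)) (dualRow (deleteRow n t))) ∧
    (lin mirror (lin (delete n .toward) x) ∈
        relations n R (deleteRow n s).reverse (deleteRow n t).reverse →
      lin flip (lin (delete n .toward) (lin reverse x)) ∈ relations n R
        ((deleteRow n t).map Strand.dual) ((deleteRow n s).map Strand.dual)) := by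
  have i0 : ∀ w, ExtWeb n s w t → _ := fun w hw => iso_delete_reverse (c := .toward) hw
  constructor
  · intro h
    have h1 := lin_rotW_mem h
    rw [lin_lin, lin_lin] at h1 ⊢
    refine (lin_mem_relations_congr (P := fun w => ExtWeb n s w t) (fun w hw => ?_)
      (mem_ExtHom.1 hx)).2 h1
    have h2 := (i0 w hw).mirror
    rw [mirror_rotW, ← flip_delete, ← mirror_delete, mirror_flip, mirror_mirror] at h2
    simp only [List.reverse_reverse] at h2
    exact h2.trans (iso_rotW_rotW' hw.delete.flip).symm
  · intro h
    have h1 := lin_rotW_mem h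
    rw [lin_lin, lin_lin] at h1 ⊢
    refine (lin_mem_relations_congr (P := fun w => ExtWeb n s w t) (fun w hw => ?_)
      (mem_ExtHom.1 hx)).2 (by simpa using h1)
    have h2 := (i0 w hw).flip
    rw [flip_rotW, ← flip_delete, ← mirror_delete, flip_flip] at h2
    have h3 := (iso_rotW_rotW' (hw.delete (c := .toward)).mirror).symm
    simp only [dualRow_reverse] at h3
    exact h2.trans h3

theorem lin_mirror_mem_reduced (hx : x ∈ relations n (reduced n) s t) :
    lin mirror x ∈ relations n (reduced n) s.reverse t.reverse := by
  refine lin_mirror_mem_relations_of (fun _ => placeable_reduced) ?_ hx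
  rintro y ⟨x, hb, rfl | rfl⟩
  · obtain ⟨s, t, hx, h, -⟩ := hb.reflect
    exact ⟨_, _, lin_delete_mem_Hom hx, h⟩
  · obtain ⟨s, t, hx, -, h⟩ := hb.reflect
    exact ⟨_, _, lin_delete_reverse_mem_Hom hx, (lin_reflect_delete_reverse_mem hx).1 h⟩

theorem lin_flip_mem_reduced (hx : x ∈ relations n (reduced n) s t) :
    lin flip x ∈ relations n (reduced n) t s := by
  refine lin_flip_mem_relations_of (fun _ => placeable_reduced) ?_ hx
  rintro y ⟨x, hb, rfl | rfl⟩
  · obtain ⟨s, t, hx, -, h⟩ := hb.reflect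
    exact ⟨_, _, lin_delete_mem_Hom hx, h⟩
  · obtain ⟨s, t, hx, h, -⟩ := hb.reflect
    exact ⟨_, _, lin_delete_reverse_mem_Hom hx, (lin_reflect_delete_reverse_mem hx).2 h⟩

/-- It suffices to derive the relators of Cautis, Kamnitzer and Morrison before reflection and
arrow reversal. -/
theorem ckmWith_toward_le_reduced
    (h : ∀ x, CKMBase n x → ∃ s t, x ∈ ExtHom n s t ∧
      lin (delete n .toward) x ∈ relations n (reduced n) (deleteRow n s) (deleteRow n t))
    (s t : List Strand) :
    relations n (ckmWith n .toward) s t ≤ relations n (reduced n) s t := by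
  refine relations_le_relations (fun _ => placeable_ckmWith) ?_ s t
  rintro y ⟨x, hb, hy⟩
  obtain ⟨s, t, hx, hr⟩ := h x hb
  have hm := lin_mirror_mem_reduced hr
  rcases hy with rfl | rfl | rfl | rfl
  · exact ⟨_, _, hr⟩
  · rw [lin_mirror_delete]; exact ⟨_, _, hm⟩
  · refine ⟨_, _, (lin_delete_reverse_mem_iff hx).2 ?_⟩
    rw [lin_flip_delete, lin_mirror_delete]
    exact lin_flip_mem_reduced hm
  · refine ⟨_, _, (lin_delete_reverse_mem_iff (lin_mirror_mem_ExtHom hx)).2 ?_⟩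
    rw [lin_mirror_lin_mirror, lin_flip_delete]
    simpa using lin_flip_mem_reduced hr

end

noncomputable section

variable {n : ℕ} {R R' : Set Lin} {c : Convention} {s t : List Strand} {x : Lin}

/-! ### The reduced relations follow from those of Cautis, Kamnitzer and Morrison -/

theorem lin_delete_reverse_mem_of_eq {s' t' : List Strand} {x' : Lin} (hx : x ∈ ExtHom n s t)
    (hx' : x' ∈ ExtHom n s' t') (hs : deleteRow n s = deleteRow n s')
    (ht : deleteRow n t = deleteRow n t')
    (h : lin (delete n .toward) x = lin (delete n .toward) x')
    (hr : lin (delete n .toward) (lin reverse x') ∈ R) :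
    lin (delete n .toward) (lin reverse x) ∈
      relations n R ((deleteRow n s).map Strand.dual) ((deleteRow n t).map Strand.dual) := by
  rw [lin_delete_reverse_mem_iff hx, lin_flip_delete, lin_mirror_delete, h, hs, ht,
    ← lin_mirror_delete, ← lin_flip_delete, ← lin_delete_reverse_mem_iff hx']
  exact mem_relations_of_mem (Or.inr hr) (lin_delete_reverse_mem_Hom hx')

/-- After deletion, each relator of the reduced list is one of Cautis, Kamnitzer and Morrison's, or
a reflection of one. -/
theorem ReducedBase.exists_eq (hb : ReducedBase n x) : ∃ x' s t, x ∈ ExtHom n s t ∧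
    x' ∈ ExtHom n s t ∧ lin (delete n .toward) x = lin (delete n .toward) x' ∧
      (CKMBase n x' ∨ CKMBase n (lin mirror x')) := by
  obtain ⟨s, t, hx⟩ := hb.exists_mem_ExtHom
  cases hb with
  | switchTag k l hk hl h => exact ⟨_, s, t, hx, hx, rfl, Or.inl (.switchTag k l hk hl h)⟩
  | cancelTags k l hk hl h =>
    have e1 : lin mirror (dg [⟨[], .cup (dn l), [up k]⟩, ⟨[dn l], .merge l k, []⟩,
        ⟨[dn l], .split l k, []⟩, ⟨[], .cap (dn l), [up k]⟩] - dg []) =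
        dg [⟨[up k], .cup (up l), []⟩, ⟨[], .merge k l, [dn l]⟩, ⟨[], .split k l, [dn l]⟩,
          ⟨[up k], .cap (up l), []⟩] - qBinom ((n : ℤ) - k) l • dg [] := by
      have h2 : (n : ℤ) - k = l := by omega
      rw [h2, qBinom_self, one_smul, map_sub, lin_dg, lin_dg]
      rfl
    have h' : l + k = n := by omega
    refine ⟨dg [⟨[], .cup (dn l), [up k]⟩, ⟨[dn l], .merge l k, []⟩, ⟨[dn l], .split l k, []⟩,
      ⟨[], .cap (dn l), [up k]⟩] - dg [], [up k], [up k],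
      Submodule.sub_mem _ (dg_mem_ExtHom (extWeb_cancelTags hk hl h))
      (dg_mem_ExtHom (extWeb_nil.2 rfl)), Submodule.sub_mem _ (dg_mem_ExtHom ?_)
      (dg_mem_ExtHom (extWeb_nil.2 rfl)), ?_, Or.inr ?_⟩
    rotate_left 2
    · rw [e1]; exact .removeBigon' k l h.le
    · simp [extWeb_cons, extWeb_nil, Slice.src, Slice.tgt, Gen.src, Gen.tgt, Gen.Ext, up, dn,
        Strand.dual]
      omega
    · rw [map_sub, map_sub, lin_dg, lin_dg, lin_dg]
      congr 2
      simp [delete_cons, Gen.delete, h', hk.ne', hl.ne', Convention.inTag]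
  | iEqH k l m hk hl hm h =>
    rcases h.lt_or_eq with h' | h'
    · exact ⟨_, s, t, hx, hx, rfl, Or.inl (.iEqH k l m h')⟩
    · exact ⟨_, s, t, hx, hx, rfl, Or.inl (.migrateTag k l m hk hl hm h')⟩
  | burstDigon k hk h =>
    have h1 := CKMBase.removeBigon (n := n) (k - 1) 1 (by omega)
    rw [qBinom_one, show ((k - 1 : ℕ) : ℤ) + (1 : ℕ) = k by omega, qInt_natCast] at h1
    exact ⟨_, s, t, hx, hx, rfl, Or.inl h1⟩
  | burstSquare k hk h =>
    have hx' : switchSquareRelator n k 1 1 1 ∈ ExtHom n [up k, up 1] [up k, up 1] := by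
      have := Submodule.sub_mem _ (ladderRL_mem_ExtHom (n := n) (k := k) (l := 1) 1 1 (by omega))
        (Submodule.sum_mem (t := Finset.range (min 1 1 + 1))
          (f := fun t => qBinom ((k : ℤ) - (1 : ℕ) + (1 : ℕ) - (1 : ℕ)) t •
            ladderLR n k 1 (1 - t) (1 - t)) _ fun t ht => Submodule.smul_mem _ _
          (ladderLR_mem_ExtHom (n := n) (k := k) (l := 1) 1 1 t (by simp at ht; omega)
            (by simp at ht; omega) (by omega)))
      exact this
    refine ⟨_, _, _, burstSquare_mem_ExtHom hk h, hx', ?_,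
      Or.inl (.switchSquare k 1 1 1 (by omega) (by omega))⟩
    have h1 : ladderRL n k 1 1 1 = dg (rungR k 1 1 ++ rungL (k - 1) 2 1) := if_pos (by omega)
    have h2 : ladderLR n k 1 1 1 = dg (rungL k 1 1 ++ rungR (k + 1) 0 1) := if_pos (by omega)
    have h3 : ladderLR n k 1 0 0 = dg (rungL k 1 0 ++ rungR k 1 0) := if_pos (by omega)
    have h4 : qBinom ((k : ℤ) - (1 : ℕ) + (1 : ℕ) - (1 : ℕ)) 1 = qNat (k - 1) := by
      rw [qBinom_one, ← qInt_natCast]; congr 1; omega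
    have h5 : deleteRow n [up k] = [up k] := deleteRow_of_rowOK (by simp [up]; omega)
    have h6 : deleteRow n [up 1] = [up 1] := deleteRow_of_rowOK (by simp [up]; omega)
    have h7 : deleteRow n [up 0] = [] := by simp [deleteRow, up]
    have h8 : delete n .toward (rungL k 1 1 ++ rungR (k + 1) 0 1) =
        delete n .toward [⟨[], .merge k 1, []⟩, ⟨[], .split k 1, []⟩] := by
      simp [rungL, rungR, delete_cons, h5, h7, Gen.delete]
    have h9 : delete n .toward (rungL k 1 0 ++ rungR k 1 0) = [] := by
      simp [rungL, rungR, delete_cons, Gen.delete]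
    simp only [switchSquareRelator, map_sub, map_add, map_smul, min_self, Finset.sum_range_succ,
      Finset.sum_range_zero, Nat.sub_zero, Nat.sub_self, h1, h2, h3, h4, lin_dg, h8, h9, zero_add,
      qBinom_zero, one_smul, delete_nil]

/-- As the reduced relators are reversed but not reflected, the case in which a reflection of `x'`
is a relator is covered by the reflections of the other list. -/
theorem reduced_le_ckmWith_toward (s t : List Strand) :
    relations n (reduced n) s t ≤ relations n (ckmWith n .toward) s t := by
  refine relations_le_relations (fun _ => placeable_reduced) ?_ s t
  rintro y ⟨x, hb, hy⟩
  obtain ⟨x', s, t, hx, hx', h, hb'⟩ := hb.exists_eq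
  have h1 : lin (delete n .toward) x' ∈ ckmWith n .toward ∧
      lin (delete n .toward) (lin reverse x') ∈ ckmWith n .toward := by
    rcases hb' with hb' | hb'
    · exact ⟨⟨x', hb', Or.inl rfl⟩, ⟨x', hb', Or.inr (Or.inr (Or.inl rfl))⟩⟩
    · refine ⟨⟨_, hb', Or.inr (Or.inl ?_)⟩, ⟨_, hb', Or.inr (Or.inr (Or.inr ?_))⟩⟩ <;>
        rw [lin_mirror_lin_mirror]
  rcases hy with rfl | rfl
  · rw [h]
    exact ⟨_, _, mem_relations_of_mem (Or.inr h1.1) (lin_delete_mem_Hom hx')⟩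
  · exact ⟨_, _, lin_delete_reverse_mem_of_eq hx hx' rfl rfl h h1.2⟩

end

noncomputable section

variable {n : ℕ} {R R' : Set Lin} {c : Convention} {s t : List Strand} {x : Lin}

/-! ### Tags in the reduced calculus -/

/-- Sliding a diagram along nested minima. -/
theorem ev_cups_mul_rotW' {w : Word} (hw : IsWeb n s w t) (a b : List Strand) :
    idem n R (a ++ b) * (ev n R a (cups (dualRow t)) b * ev n R a (rotW' s t w) (t ++ b)) =
      idem n R (a ++ b) * (ev n R a (cups (dualRow s)) b * ev n R (a ++ dualRow s) w b) := by
  have hc : ∀ s, RowOK n s → IsWeb n (dualRow s ++ s) (caps s) [] := fun s hs =>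
    isWeb_iff.2 ⟨by simp [hs], slicesOK_caps hs, isPath_caps s⟩
  have hf := hw.flip
  have h1 := (hf.rotW.whisker (a := []) (b := t) (by simp) hf.1).append (hc t hf.1)
  have h2 := (hf.whisker (a := dualRow s) (b := []) (by simpa using hf.2.1) (by simp)).append
    (by simpa using hc s hf.2.1)
  have h3 : Iso n (dualRow s ++ t) [] (whisker [] (rotW t s (flip w)) t ++ caps t)
      (whisker (dualRow s) (flip w) [] ++ caps s) := by
    refine Iso.of_ev h1 (by simpa using h2) ?_
    have := ev_rotW_mul_caps (n := n) (R := ∅) hf.2.2.2 [] []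
    simpa [ev_append, ev_whisker] using this
  have h4 := h3.flip.idem_mul_ev (R := R) a b
  simpa [flip_rotW, flip_caps, ev_append, ev_whisker] using h4

section

variable (k l : ℕ) (a b : List Strand)

theorem piece_cancelTags (hk : 0 < k) (hl : 0 < l) (h : k + l = n) :
    piece n (reduced n) a (.cup (dn l)) (up k :: b) *
        (piece n (reduced n) (a ++ [dn l]) (.tagIn l k) b *
          (piece n (reduced n) (a ++ [dn l]) (.tagOut l k) b *
            piece n (reduced n) a (.cap (dn l)) (up k :: b))) =
      idem n (reduced n) (a ++ up k :: b) := by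
  have h1 := lin_delete_mem_reduced (.cancelTags k l hk hl h)
    (Submodule.sub_mem _ (dg_mem_ExtHom (extWeb_cancelTags hk hl h))
      (dg_mem_ExtHom (extWeb_nil.2 rfl)))
  have hk' : deleteRow n [up k] = [up k] := deleteRow_of_rowOK (by simp [up]; omega)
  have hl' : deleteRow n [dn l] = [dn l] := deleteRow_of_rowOK (by simp [dn]; omega)
  have h2 : 0 < l ∧ l < n := by omega
  rw [map_sub, lin_dg, lin_dg, hk'] at h1
  have h3 := idem_mul_ev_congr h1 a b
  have h4 := idem_mul_piece (n := n) (R := reduced n) (s := a ++ up k :: b) (a := a)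
    (g := .cup (dn l)) (b := up k :: b) (by simp [Gen.src])
  simp [delete_cons, Gen.delete, hk', hl', ev_cons, show (dn l).label = l from rfl, h2] at h3
  rw [← mul_assoc, h4] at h3
  exact h3

theorem isPath_tagInSwitched : IsPath [up k, up l] (tagInSwitched k l) [] := by
  simp [tagInSwitched, Slice.src, Slice.tgt, Gen.src, Gen.tgt]

/-- An outgoing vertex followed by an incoming one with its tag on the other side can be
straightened. -/
theorem tagOut_mul_tagInSwitched (hk : 0 < k) (hl : 0 < l) (h : k + l = n) :
    piece n (reduced n) (a ++ [up k]) (.tagOut l k) b *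
        ev n (reduced n) a (tagInSwitched k l) (up k :: b) =
      idem n (reduced n) (a ++ up k :: b) := by
  have h1 := piece_cancelTags k l a b hk hl h
  have h2 := piece_exchange (n := n) (R := reduced n) (.cup (dn l)) (.tagOut l k) a [up k] b
  have h3 := piece_exchange (n := n) (R := reduced n) (.tagIn l k) (.tagOut l k) (a ++ [dn l]) [] b
  simp [tagInSwitched, ev_cons, Gen.src, Gen.tgt] at h1 h2 h3 ⊢
  rw [← mul_assoc, ← h2, mul_assoc, ← mul_assoc (piece n (reduced n) _ (.tagOut l k) _), ← h3,
    mul_assoc, h1]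

theorem flip_tagOutSwitched : flip (tagOutSwitched k l) = tagInSwitched k l := by
  simp [tagOutSwitched, tagInSwitched, flip, Gen.flip]

theorem iso_mirror_tagInSwitched (hk : 0 < k) (hl : 0 < l) (h : k + l = n) :
    Iso n [up l, up k] [] (mirror (tagInSwitched k l)) (tagInSwitched l k) := by
  have := (iso_mirror_tagOutSwitched hk hl h).flip
  rwa [← mirror_flip, flip_tagOutSwitched, flip_tagOutSwitched] at this

theorem ev_mirror_congr {w w' : Word} (hw : IsWeb n s w t) (hw' : IsWeb n s w' t)
    (h : idem n (reduced n) s * ev n (reduced n) [] w [] =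
      idem n (reduced n) s * ev n (reduced n) [] w' []) (a b : List Strand) :
    idem n (reduced n) (a ++ s.reverse ++ b) * ev n (reduced n) a (mirror w) b =
      idem n (reduced n) (a ++ s.reverse ++ b) * ev n (reduced n) a (mirror w') b := by
  have h1 := lin_mirror_mem_reduced (sub_mem_relations hw hw' h)
  rw [map_sub, lin_dg, lin_dg] at h1
  exact idem_mul_ev_congr h1 a b

theorem tagOut_mul_tagInSwitched' (hk : 0 < k) (hl : 0 < l) (h : k + l = n) :
    piece n (reduced n) a (.tagOut k l) (up k :: b) *
        ev n (reduced n) (a ++ [up k]) (tagInSwitched l k) b =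
      idem n (reduced n) (a ++ up k :: b) := by
  have hw : IsWeb n [up k] (⟨[up k], .tagOut l k, []⟩ :: whisker [] (tagInSwitched k l) [up k])
      [up k] := by
    have h1 := (isWeb_tagInSwitched hk hl h).whisker (a := []) (b := [up k]) (by simp)
      (by simp [up]; omega)
    rw [isWeb_cons]
    refine ⟨by simp [Slice.src, Gen.src], ⟨by simp [up]; omega, ⟨hl, hk, by omega⟩, by simp⟩, ?_⟩
    simpa [Slice.tgt, Gen.tgt] using h1
  have h2 := tagOut_mul_tagInSwitched k l [] [] hk hl h
  have h3 := ev_mirror_congr hw (IsWeb.refl hw.1) (by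
    simp only [ev_cons, ev_whisker, ev_nil, mul_one, List.nil_append, List.append_nil] at h2 ⊢
    rw [h2, idem_mul_idem]) a b
  have h4 := (iso_mirror_tagInSwitched k l hk hl h).idem_mul_ev (R := reduced n) (a ++ [up k]) b
  have h5 := idem_mul_piece (n := n) (R := reduced n) (s := a ++ up k :: b) (a := a)
    (g := .tagOut k l) (b := up k :: b) (by simp [Gen.src])
  have h6 := piece_mul_idem (n := n) (R := reduced n) (t := a ++ up k :: up l :: up k :: b) (a := a)
    (g := .tagOut k l) (b := up k :: b) (by simp [Gen.tgt])
  have h7 : mirror (⟨[up k], .tagOut l k, []⟩ :: whisker [] (tagInSwitched k l) [up k]) =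
      ⟨[], .tagOut k l, [up k]⟩ :: whisker [up k] (mirror (tagInSwitched k l)) [] := by
    simp [mirror_cons, Gen.mirror]
  rw [h7] at h3
  simp only [ev_cons, ev_whisker, List.append_assoc, List.cons_append, List.nil_append,
    List.append_nil, List.reverse_cons, List.reverse_nil, mirror_nil, ev_nil,
    mul_one] at h3 h4 h5 h6 ⊢
  rw [← mul_assoc, h5, ← h6, mul_assoc, h4, ← mul_assoc, h6] at h3
  exact h3

/-- A loop around a diagram can be closed by a pair of tags. -/
theorem cup_mul_cap_eq_tags {w : Word} {s t : List Strand} (hw : IsPath (up k :: s) w (up k :: t))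
    (hk : 0 < k) (hl : 0 < l) (h : k + l = n) :
    piece n (reduced n) a (.cup (dn k)) (s ++ b) *
        (ev n (reduced n) (a ++ [dn k]) w b * piece n (reduced n) a (.cap (dn k)) (t ++ b)) =
      piece n (reduced n) a (.tagOut l k) (s ++ b) *
        (ev n (reduced n) (a ++ [up l]) w b * piece n (reduced n) a (.tagIn l k) (t ++ b)) := by
  have h1 := piece_cancelTags k l (a ++ [dn k]) (s ++ b) hk hl h
  have h2 := piece_mul_idem (n := n) (R := reduced n) (t := a ++ dn k :: up k :: (s ++ b)) (a := a)
    (g := .cup (dn k)) (b := s ++ b) (by simp [Gen.tgt])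
  have h3 := piece_ev_exchange (n := n) (R := reduced n) (g := .cap (dn l)) hw (a ++ [dn k]) [] b
  have hV : IsPath [] (rotW' [up l, up k] [] [⟨[], .tagIn l k, []⟩]) [dn k, dn l] :=
    (isPath_gen (.tagIn l k)).rotW'
  have h4 := ev_exchange (n := n) (R := reduced n) hV hw a [up l] b
  have h5 := ev_piece_exchange (n := n) (R := reduced n) (g := .tagOut l k) hV a [] (s ++ b)
  have h6 := ev_rotW_mul_caps (n := n) (R := reduced n) (isPath_gen (.tagIn l k)) a (t ++ b)
  have h7 := ev_rot_gen (n := n) (R := reduced n) (.tagIn l k) a (up l :: up k :: (t ++ b))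
  have h8 := idem_mul_piece (n := n) (R := reduced n) (s := a ++ up l :: up k :: (t ++ b)) (a := a)
    (g := .tagIn l k) (b := t ++ b) (by simp [Gen.src])
  have h9 := idem_mul_ev_of_ne_nil (n := n) (R := reduced n) (a := a)
    (b := up l :: up k :: (t ++ b)) hV (by simp [rotW'])
  have e1 : dualRow [up l, up k] = [dn k, dn l] := rfl
  simp only [Gen.src, Gen.tgt, List.append_assoc, List.cons_append, List.nil_append,
    List.append_nil, dual_dn] at h1 h2 h3 h4 h5 h6 h7 h8 h9 ⊢
  simp only [dualRow_nil, List.nil_append, List.append_nil, show caps [] = [] from rfl, ev_nil,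
    mul_one, ← piece_eq_ev] at h6
  rw [h8, h7, ← mul_assoc, h9] at h6
  rw [← h6, ← mul_assoc (ev n (reduced n) (a ++ [up l]) w b), ← h4]
  simp only [← mul_assoc]
  rw [← h5]
  have e2 : caps [up l, up k] = [⟨[dn k], .cap (dn l), [up k]⟩, ⟨[], .cap (dn k), []⟩] := rfl
  have e3 : ∀ c, ev n (reduced n) a (rotW' [up l, up k] [] [⟨[], .tagIn l k, []⟩]) c =
      piece n (reduced n) a (.cup (dn k)) c *
        (piece n (reduced n) (a ++ [dn k]) (.cup (dn l)) (up k :: c) *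
          piece n (reduced n) (a ++ [dn k, dn l]) (.tagIn l k) c) := by
    intro c
    simp [rotW', e1, cups, caps, ev_cons, whisker, dual_dn]
  rw [e2, e3]
  simp only [ev_cons, ev_nil, mul_one, List.cons_append, List.nil_append,
    List.append_nil]
  conv_lhs => rw [← h2, ← h1]
  simp only [mul_assoc]
  rw [← mul_assoc (piece n (reduced n) _ (.cap (dn l)) _), h3]
  simp only [mul_assoc]

end

end

noncomputable section

variable {n : ℕ} (a b : List Strand)

/-! ### Tag migration and loops in the reduced calculus -/

theorem deleteRow_singleton_up {k : ℕ} (hk : 0 < k) (h : k < n) : deleteRow n [up k] = [up k] :=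
  deleteRow_of_rowOK (by simp [up]; omega)

section

variable {k l m : ℕ}

/-- The relation `I = H` with an output labelled `n` is included in the reduced list; after
deletion of the output it moves a tag past a fusion. -/
theorem merge_mul_tagIn (hk : 0 < k) (hl : 0 < l) (hm : 0 < m) (h : k + l + m = n) :
    piece n (reduced n) (a ++ [up k]) (.merge l m) b *
        piece n (reduced n) a (.tagIn k (l + m)) b =
      piece n (reduced n) a (.merge k l) (up m :: b) *
        piece n (reduced n) a (.tagIn (k + l) m) b := by
  have h1 := lin_delete_mem_reduced (.iEqH k l m hk hl hm h.le)
    (Submodule.sub_mem _ (dg_mem_ExtHom (extWeb_mergeI h.le)) (dg_mem_ExtHom (extWeb_mergeH h.le)))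
  have hk' : deleteRow n [up k] = [up k] := deleteRow_singleton_up hk (by omega)
  have hm' : deleteRow n [up m] = [up m] := deleteRow_singleton_up hm (by omega)
  have hklm : deleteRow n [up k, up l, up m] = [up k, up l, up m] :=
    deleteRow_of_rowOK (by simp [up]; omega)
  rw [map_sub, lin_dg, lin_dg, hklm] at h1
  have h3 := idem_mul_ev_congr h1 a b
  have h4 := idem_mul_piece (n := n) (R := reduced n) (s := a ++ up k :: up l :: up m :: b)
    (a := a ++ [up k]) (g := .merge l m) (b := b) (by simp [Gen.src])
  have h5 := idem_mul_piece (n := n) (R := reduced n) (s := a ++ up k :: up l :: up m :: b)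
    (a := a) (g := .merge k l) (b := up m :: b) (by simp [Gen.src])
  have e1 : Gen.delete n .toward (.merge l m) = [⟨[], .merge l m, []⟩] := by
    rw [Gen.delete, if_neg (by omega), if_neg (by omega)]
  have e2 : Gen.delete n .toward (.merge k l) = [⟨[], .merge k l, []⟩] := by
    rw [Gen.delete, if_neg (by omega), if_neg (by omega)]
  have e3 : Gen.delete n .toward (.merge k (l + m)) = [⟨[], .tagIn k (l + m), []⟩] := by
    rw [Gen.delete, if_neg (by omega), if_pos (by omega)]; rfl
  have e4 : Gen.delete n .toward (.merge (k + l) m) = [⟨[], .tagIn (k + l) m, []⟩] := by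
    rw [Gen.delete, if_neg (by omega), if_pos (by omega)]; rfl
  simp [mergeI, mergeH, delete_cons, e1, e2, e3, e4, hk', hm', ev_cons] at h3
  rw [← mul_assoc, h4, ← mul_assoc, h5] at h3
  exact h3

/-- The reflection of `merge_mul_tagIn` in a horizontal line. -/
theorem tagOut_mul_split (hk : 0 < k) (hl : 0 < l) (hm : 0 < m) (h : k + l + m = n) :
    piece n (reduced n) a (.tagOut k (l + m)) b *
        piece n (reduced n) (a ++ [up k]) (.split l m) b =
      piece n (reduced n) a (.tagOut (k + l) m) b *
        piece n (reduced n) a (.split k l) (up m :: b) := by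
  have h1 := lin_flip_mem_reduced (lin_delete_mem_reduced (.iEqH k l m hk hl hm h.le)
    (Submodule.sub_mem _ (dg_mem_ExtHom (extWeb_mergeI h.le)) (dg_mem_ExtHom (extWeb_mergeH h.le))))
  have hk' : deleteRow n [up k] = [up k] := deleteRow_singleton_up hk (by omega)
  have hm' : deleteRow n [up m] = [up m] := deleteRow_singleton_up hm (by omega)
  have hklm : deleteRow n [up (k + l + m)] = [] := by simp [deleteRow, up]; omega
  rw [map_sub, lin_dg, lin_dg, map_sub, lin_dg, lin_dg, hklm, flip_delete, flip_delete] at h1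
  have h3 := idem_mul_ev_congr h1 a b
  have h4 := idem_mul_piece (n := n) (R := reduced n) (s := a ++ b)
    (a := a) (g := .tagOut k (l + m)) (b := b) (by simp [Gen.src])
  have h5 := idem_mul_piece (n := n) (R := reduced n) (s := a ++ b)
    (a := a) (g := .tagOut (k + l) m) (b := b) (by simp [Gen.src])
  have e1 : Gen.delete n .toward (.split l m) = [⟨[], .split l m, []⟩] := by
    rw [Gen.delete, if_neg (by omega), if_neg (by omega)]
  have e2 : Gen.delete n .toward (.split k l) = [⟨[], .split k l, []⟩] := by
    rw [Gen.delete, if_neg (by omega), if_neg (by omega)]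
  have e3 : Gen.delete n .toward (.split k (l + m)) = [⟨[], .tagOut k (l + m), []⟩] := by
    rw [Gen.delete, if_neg (by omega), if_pos (by omega)]
  have e4 : Gen.delete n .toward (.split (k + l) m) = [⟨[], .tagOut (k + l) m, []⟩] := by
    rw [Gen.delete, if_neg (by omega), if_pos (by omega)]
  simp [mergeI, mergeH, flip, Gen.flip, delete_cons, e1, e2, e3, e4, hk', hm', ev_cons] at h3
  rw [← mul_assoc, h4, ← mul_assoc, h5] at h3
  exact h3

/-- Migration of a tag from one strand of a trivalent vertex to another one. -/
theorem split_mul_tagInSwitched (hk : 0 < k) (hl : 0 < l) (hm : 0 < m) (h : k + l + m = n) :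
    piece n (reduced n) a (.split k l) (up (k + m) :: b) *
        ev n (reduced n) (a ++ [up k]) (tagInSwitched l (k + m)) b =
      piece n (reduced n) (a ++ [up (k + l)]) (.split m k) b *
        ev n (reduced n) a (tagInSwitched (k + l) m) (up k :: b) := by
  have h1 := tagOut_mul_tagInSwitched (n := n) (k + l) m a (up (k + m) :: b) (by omega) hm h
  have h2 := tagOut_mul_tagInSwitched' (n := n) (k + m) l (a ++ [up (k + l)]) b
    (by omega) hl (by omega)
  have h3 := tagOut_mul_split (n := n) (a ++ [up (k + l)]) (up (k + m) :: b) hm hk hl (by omega)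
  have h4 := ev_piece_exchange (n := n) (R := reduced n) (g := .split k l)
    (isPath_tagInSwitched (k + l) m) a [] (up (k + m) :: b)
  have h5 := ev_exchange (n := n) (R := reduced n)
    (isPath_tagInSwitched (k + l) m) (isPath_tagInSwitched l (k + m)) a [up k] b
  have h6 := piece_ev_exchange (n := n) (R := reduced n) (g := .split m k)
    (isPath_tagInSwitched l (k + m)) (a ++ [up (k + l)]) [] b
  have h7 := idem_mul_piece (n := n) (R := reduced n) (s := a ++ up (k + l) :: up (k + m) :: b)
    (a := a) (g := .split k l) (b := up (k + m) :: b) (by simp [Gen.src])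
  have h8 := idem_mul_piece (n := n) (R := reduced n) (s := a ++ up (k + l) :: up (k + m) :: b)
    (a := a ++ [up (k + l)]) (g := .split m k) (b := b) (by simp [Gen.src, add_comm])
  simp only [Gen.src, Gen.tgt, List.append_assoc, List.cons_append, List.nil_append,
    List.append_nil, add_comm m k] at h1 h2 h3 h4 h5 h6 h7 h8 ⊢
  rw [← h7, ← h1]
  simp only [mul_assoc]
  rw [← mul_assoc (ev n (reduced n) a _ _) (piece n (reduced n) a (.split k l) _), h4]
  simp only [mul_assoc]
  rw [← mul_assoc (piece n (reduced n) _ (.tagOut _ _) _) (piece n (reduced n) _ (.split k l) _),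
    h3]
  simp only [mul_assoc]
  rw [h5, ← mul_assoc (piece n (reduced n) _ (.split m k) _), h6]
  simp only [← mul_assoc]
  rw [h2, h8]

end

end

noncomputable section

variable {n : ℕ} {k l m : ℕ}

theorem mul_mul_of_mul_eq {A : Type*} [Semigroup A] {x y z : A} (h : x * y = z) (w : A) :
    x * (y * w) = z * w := by
  rw [← mul_assoc, h]

/-! ### Loops in the reduced calculus -/

/-- A loop around a strand, in terms of a digon. The strand on which the loop is attached carries
a cancelling pair of tags, which migrates away from the loop on both sides. -/
theorem loop_eq_of_digon (hk : 0 < k) (hl : 0 < l) (hm : 0 < m) (h : m + l + k = n) (c : K)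
    (hd : ∀ a b, piece n (reduced n) a (.split m l) b * piece n (reduced n) a (.merge m l) b =
      c • idem n (reduced n) (a ++ up (m + l) :: b)) (a b : List Strand) :
    piece n (reduced n) a (.cup (dn l)) (up k :: b) *
        (piece n (reduced n) (a ++ [dn l]) (.merge l k) b *
          (piece n (reduced n) (a ++ [dn l]) (.split l k) b *
            piece n (reduced n) a (.cap (dn l)) (up k :: b))) =
      c • idem n (reduced n) (a ++ up k :: b) := by
  have h0 := piece_cancelTags (n := n) (l + k) m (a ++ [dn l]) b (by omega) hm (by omega)
  have h1 := piece_mul_idem (n := n) (R := reduced n) (t := a ++ dn l :: up (l + k) :: b)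
    (a := a ++ [dn l]) (g := .merge l k) (b := b) (by simp [Gen.tgt])
  have h2 := piece_exchange (n := n) (R := reduced n) (.cup (dn m)) (.merge l k) (a ++ [dn l]) [] b
  have h3 := piece_exchange (n := n) (R := reduced n) (.cap (dn m)) (.split l k) (a ++ [dn l]) [] b
  have h4 := merge_mul_tagIn (n := n) (a ++ [dn l, dn m]) b hm hl hk h
  have h5 := tagOut_mul_split (n := n) (a ++ [dn l, dn m]) b hm hl hk h
  have h6 := ev_rotW_mul_caps (n := n) (R := reduced n) (isPath_gen (.split m l)) a (up k :: b)
  have h7 := ev_rot_gen (n := n) (R := reduced n) (.split m l) a (up (m + l) :: up k :: b)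
  have hS : IsPath [dn l, dn m] (rotW' [up (m + l)] [up m, up l] [⟨[], .split m l, []⟩])
    [dn (m + l)] := (isPath_gen (.split m l)).rotW'
  have hw : IsPath [up m, up l, up k] [⟨[], .merge m l, [up k]⟩, ⟨[], .tagIn (m + l) k, []⟩,
      ⟨[], .tagOut (m + l) k, []⟩] [up (m + l), up k] := by
    simp [Slice.src, Slice.tgt, Gen.src, Gen.tgt]
  have h8 := ev_exchange (n := n) (R := reduced n) hS hw a [] b
  have h9 := ev_cups_mul_rotW' (n := n) (R := reduced n)
    (isWeb_gen (n := n) (g := .split m l) ⟨hm, hl, by omega⟩) a (up k :: b)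
  have h10 := hd (a ++ [dn (m + l)]) (up k :: b)
  have h11 := piece_cancelTags (n := n) k (m + l) a b hk (by omega) (by omega)
  have h12 := piece_mul_idem (n := n) (R := reduced n)
    (t := a ++ dn (m + l) :: up (m + l) :: up k :: b) (a := a) (g := .cup (dn (m + l)))
    (b := up k :: b) (by simp [Gen.tgt])
  have h13 := idem_mul_piece (n := n) (R := reduced n)
    (s := a ++ up k :: b) (a := a) (g := .cup (dn (m + l)))
    (b := up k :: b) (by simp [Gen.src])
  have h14 := idem_mul_piece (n := n) (R := reduced n)
    (s := a ++ up k :: b) (a := a) (g := .cup (dn l))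
    (b := up k :: b) (by simp [Gen.src])
  have h15 := idem_mul_piece (n := n) (R := reduced n)
    (s := a ++ dn l :: dn m :: up (m + l) :: up k :: b) (a := a ++ [dn l, dn m])
    (g := .split m l) (b := up k :: b) (by simp [Gen.src])
  have h16 := idem_mul_ev_of_ne_nil (n := n) (R := reduced n) (a := a)
    (b := up (m + l) :: up k :: b) hS (by simp [rotW'])
  have e1 : dualRow [up m, up l] = [dn l, dn m] := rfl
  have e2 : dualRow [up (m + l)] = [dn (m + l)] := rfl
  have e3 : dualRow [dn l, dn m] = [up m, up l] := rfl
  have e4 : cups [dn l, dn m] = [⟨[], .cup (dn l), []⟩, ⟨[dn l], .cup (dn m), [up l]⟩] := rfl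
  have e5 : caps [up m, up l] = [⟨[dn l], .cap (dn m), [up l]⟩, ⟨[], .cap (dn l), []⟩] := rfl
  have e6 : cups [dn (m + l)] = [⟨[], .cup (dn (m + l)), []⟩] := rfl
  have e7 : caps [up (m + l)] = [⟨[], .cap (dn (m + l)), []⟩] := rfl
  simp only [Gen.src, Gen.tgt, List.append_assoc, List.cons_append, List.nil_append,
    List.append_nil, dual_dn, e1, e2, e4, e5, e6, e7, ev_cons, ev_nil, mul_one] at *
  rw [mul_mul_of_mul_eq h15, h7, mul_mul_of_mul_eq h16] at h6
  simp only [mul_assoc] at h9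
  rw [mul_mul_of_mul_eq h14, mul_mul_of_mul_eq h13] at h9
  conv_lhs => rw [← h1, ← h0]
  simp only [mul_assoc]
  rw [mul_mul_of_mul_eq h2.symm, mul_mul_of_mul_eq h3, mul_assoc, mul_mul_of_mul_eq h4,
    mul_assoc, mul_assoc, mul_mul_of_mul_eq h5, mul_assoc, ← h6]
  simp only [mul_assoc] at h8
  have h17 := congrArg (fun z => piece n (reduced n) a (.cup (dn l)) (up k :: b) *
    (piece n (reduced n) (a ++ [dn l]) (.cup (dn m)) (up l :: up k :: b) * z) *
      piece n (reduced n) a (.cap (dn (m + l))) (up k :: b)) h8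
  simp only [mul_assoc] at h17
  rw [← h17, ← mul_assoc (piece n (reduced n) _ (.cup (dn m)) _), mul_mul_of_mul_eq h9, mul_assoc,
    mul_mul_of_mul_eq h10, smul_mul_assoc, mul_smul_comm, mul_mul_of_mul_eq h12, h11]

theorem piece_digon (hk : 0 < k) (h : k + 1 < n) (a b : List Strand) :
    piece n (reduced n) a (.split k 1) b * piece n (reduced n) a (.merge k 1) b =
      qNat (k + 1) • idem n (reduced n) (a ++ up (k + 1) :: b) := by
  have h1 := lin_delete_mem_reduced (.burstDigon (k + 1) (by omega) h.le)
    (Submodule.sub_mem _ (dg_mem_ExtHom (extWeb_digon (by omega)))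
      (Submodule.smul_mem _ _ (dg_mem_ExtHom (extWeb_nil.2 rfl))))
  have hk' : deleteRow n [up (k + 1)] = [up (k + 1)] := deleteRow_singleton_up (by omega) h
  have h3 := idem_mul_evL_eq_zero h1 a b
  have e1 : Gen.delete n .toward (.split k 1) = [⟨[], .split k 1, []⟩] := by
    rw [Gen.delete, if_neg (by omega), if_neg (by omega)]
  have e2 : Gen.delete n .toward (.merge k 1) = [⟨[], .merge k 1, []⟩] := by
    rw [Gen.delete, if_neg (by omega), if_neg (by omega)]
  have h4 := idem_mul_piece (n := n) (R := reduced n) (s := a ++ up (k + 1) :: b)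
    (a := a) (g := .split k 1) (b := b) (by simp [Gen.src])
  simp [digon, lin_dg, delete_cons, e1, e2, hk', ev_cons, mul_sub] at h3
  rw [mul_mul_of_mul_eq h4, sub_eq_zero] at h3
  exact h3

/-- The relation `square` of a ladder where the strand between the two rungs on the left is
labelled `n`. -/
theorem tagOut_mul_square_mul_tagIn (h : k + 1 = n) (hk : 0 < k) (a b : List Strand) :
    piece n (reduced n) a (.tagOut k 1) (up 1 :: b) *
        (ev n (reduced n) (a ++ [up k]) (Gen.delete n .toward (.merge 1 1)) b *
          ev n (reduced n) (a ++ [up k]) (Gen.delete n .toward (.split 1 1)) b *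
            piece n (reduced n) a (.tagIn k 1) (up 1 :: b)) =
      qNat k • idem n (reduced n) (a ++ up 1 :: b) := by
  rcases Nat.eq_or_lt_of_le (show 1 ≤ k from hk) with rfl | hk2
  · subst h
    have e1 : Gen.delete 2 .toward (.merge 1 1) = [⟨[], .tagIn 1 1, []⟩] := rfl
    have e2 : Gen.delete 2 .toward (.split 1 1) = [⟨[], .tagOut 1 1, []⟩] := rfl
    have e3 : qNat 1 = 1 := by simp [qNat]
    have h1 := cup_mul_cap_eq_tags (n := 2) 1 1 a b
      (w := [⟨[], .tagIn 1 1, []⟩, ⟨[], .tagOut 1 1, []⟩])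
      (s := [up 1]) (t := [up 1]) (by simp [Slice.src, Slice.tgt, Gen.src, Gen.tgt]) hk hk rfl
    have h2 := piece_cancelTags (n := 2) 1 1 a b hk hk rfl
    simp only [e1, e2, ev_cons, ev_nil, mul_one, List.append_nil, List.nil_append,
      List.cons_append, mul_assoc] at h1 ⊢
    rw [← h1, h2, e3, one_smul]
  · obtain ⟨m, rfl⟩ : ∃ m, k = m + 1 := ⟨k - 1, by omega⟩
    have e1 : Gen.delete n .toward (.merge 1 1) = [⟨[], .merge 1 1, []⟩] := by
      rw [Gen.delete, if_neg (by omega), if_neg (by omega)]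
    have e2 : Gen.delete n .toward (.split 1 1) = [⟨[], .split 1 1, []⟩] := by
      rw [Gen.delete, if_neg (by omega), if_neg (by omega)]
    have h1 := cup_mul_cap_eq_tags (n := n) 1 (m + 1) a b
      (w := [⟨[], .merge 1 1, []⟩, ⟨[], .split 1 1, []⟩])
      (s := [up 1]) (t := [up 1]) (by simp [Slice.src, Slice.tgt, Gen.src, Gen.tgt]) (by omega) hk
      (by omega)
    have h2 := loop_eq_of_digon (k := 1) (l := 1) (m := m) (by omega) (by omega) (by omega) h _
      (piece_digon (by omega) (by omega)) a b
    simp only [e1, e2, ev_cons, ev_nil, mul_one, List.append_nil, List.nil_append,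
      List.cons_append, mul_assoc] at h1 ⊢
    rw [← h1, h2]

end

noncomputable section

variable {n : ℕ} {s t r : List Strand} {x : Lin} {u v w w' : Word}

/-! ### Webs with strands labelled `0` or `n` in the reduced calculus -/

/-- The element of the algebra of the reduced calculus given by a diagram with labels in
`0, …, n` and bottom boundary `s`. -/
def web (n : ℕ) (s : List Strand) (w : Word) : Alg n (reduced n) :=
  idem n (reduced n) (deleteRow n s) * ev n (reduced n) [] (delete n .toward w) []

theorem web_nil (s : List Strand) : web n s [] = idem n (reduced n) (deleteRow n s) := by
  simp [web]

theorem web_mul_web (h : ExtWeb n s u r) {r' : List Strand} (hr : r' = r) :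
    web n s u * web n r' v = web n s (u ++ v) := by
  subst hr
  have h1 := idem_mul_ev_comm (n := n) (R := reduced n) (a := []) (b := [])
    (h.delete (c := .toward)).2.2.2
  simp only [List.nil_append, List.append_nil] at h1
  rw [web, web, web, delete_append, ev_append, mul_assoc, ← mul_assoc (ev n (reduced n) _ _ _),
    ← h1,
    ← mul_assoc, ← mul_assoc, ← mul_assoc, idem_mul_idem]

theorem web_nil_mul_web (h : r = s) : web n r [] * web n s v = web n s v := by
  subst h
  exact web_mul_web (extWeb_nil.2 rfl) rfl

theorem web_exchange {g h : Gen} (hg : g.Ext n) (hh : h.Ext n) (a b c : List Strand)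
    {s : List Strand} :
    web n s [⟨a, g, b ++ h.src ++ c⟩, ⟨a ++ g.tgt ++ b, h, c⟩] =
      web n s [⟨a ++ g.src ++ b, h, c⟩, ⟨a, g, b ++ h.tgt ++ c⟩] := by
  have h1 := ev_exchange (n := n) (R := reduced n) (isWeb_delete_gen (c := .toward) hg).2.2.2
    (isWeb_delete_gen (c := .toward) hh).2.2.2 (deleteRow n a) (deleteRow n b) (deleteRow n c)
  rw [web, web]
  congr 1
  simpa [delete_cons, ev_append, ev_whisker] using h1

/-- The linear extension of `web` to linear combinations of diagrams between vertical strands. -/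
def webL (n : ℕ) (a s b : List Strand) : Lin →ₗ[K] Alg n (reduced n) :=
  LinearMap.mulLeft K (idem n (reduced n) (deleteRow n (a ++ s ++ b))) ∘ₗ
    evL n (reduced n) (deleteRow n a) (deleteRow n b) ∘ₗ lin (delete n .toward)

@[simp] theorem webL_dg (a s b : List Strand) (w : Word) :
    webL n a s b (dg w) = web n (a ++ s ++ b) (whisker a w b) := by
  simp [webL, web, lin_dg, ev_whisker]

theorem webL_eq_zero (h : lin (delete n .toward) x ∈
      relations n (reduced n) (deleteRow n s) (deleteRow n t)) (a b : List Strand) :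
    webL n a s b x = 0 := by
  simpa [webL] using idem_mul_evL_eq_zero h (deleteRow n a) (deleteRow n b)

theorem mem_relations_of_webL (hx : x ∈ ExtHom n s t) (h : webL n [] s [] x = 0) :
    lin (delete n .toward) x ∈ relations n (reduced n) (deleteRow n s) (deleteRow n t) := by
  refine mem_relations_of_evL (lin_delete_mem_Hom hx) ?_
  simpa [webL] using h

theorem ReducedBase.webL_eq_zero (hb : ReducedBase n x) (hx : x ∈ ExtHom n s t)
    (a b : List Strand) : webL n a s b x = 0 :=
  SLWeb.webL_eq_zero (lin_delete_mem_reduced hb hx) a b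

theorem web_of_delete_eq (hs : deleteRow n s = deleteRow n t)
    (hw : delete n .toward w = delete n .toward w') : web n s w = web n t w' := by
  rw [web, web, hs, hw]

/-! ### Ladders in the reduced calculus -/

theorem deleteRow_up_zero : deleteRow n [up 0] = [] := rfl

theorem deleteRow_up_zero_cons (s : List Strand) : deleteRow n (up 0 :: s) = deleteRow n s := by
  rw [deleteRow_cons, deleteRow_up_zero, List.nil_append]

theorem deleteRow_up_self : deleteRow n [up n] = [] := by simp [deleteRow, up]

theorem web_assoc {k l m : ℕ} (h : k + l + m ≤ n) (a b : List Strand) :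
    web n (a ++ [up k, up l, up m] ++ b) (whisker a (mergeI k l m) b) =
      web n (a ++ [up k, up l, up m] ++ b) (whisker a (mergeH k l m) b) := by
  rcases Nat.eq_zero_or_pos k with rfl | hk
  · refine web_of_delete_eq rfl ?_
    simp [mergeI, mergeH, delete_cons, deleteRow_up_zero, Gen.delete]
  rcases Nat.eq_zero_or_pos l with rfl | hl
  · refine web_of_delete_eq rfl ?_
    simp [mergeI, mergeH, delete_cons, Gen.delete]
  rcases Nat.eq_zero_or_pos m with rfl | hm
  · refine web_of_delete_eq rfl ?_
    simp [mergeI, mergeH, delete_cons, deleteRow_up_zero_cons, Gen.delete]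
  have h1 := (ReducedBase.iEqH k l m hk hl hm h).webL_eq_zero (Submodule.sub_mem _
    (dg_mem_ExtHom (extWeb_mergeI h)) (dg_mem_ExtHom (extWeb_mergeH h))) a b
  rwa [map_sub, webL_dg, webL_dg, sub_eq_zero] at h1

theorem web_coassoc {k l m : ℕ} (h : k + l + m ≤ n) (a b : List Strand) :
    web n (a ++ [up (k + l + m)] ++ b) (whisker a (flip (mergeI k l m)) b) =
      web n (a ++ [up (k + l + m)] ++ b) (whisker a (flip (mergeH k l m)) b) := by
  have h1 : lin (delete n .toward) (dg (mergeI k l m) - dg (mergeH k l m)) ∈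
      relations n (reduced n) (deleteRow n [up k, up l, up m]) (deleteRow n [up (k + l + m)]) := by
    refine mem_relations_of_webL (Submodule.sub_mem _
      (dg_mem_ExtHom (extWeb_mergeI h)) (dg_mem_ExtHom (extWeb_mergeH h))) ?_
    rw [map_sub, webL_dg, webL_dg, web_assoc h, sub_self]
  have h2 := lin_flip_mem_reduced h1
  rw [← lin_flip_delete] at h2
  have h3 := webL_eq_zero h2 a b
  simpa [lin_dg, sub_eq_zero] using h3

theorem webL_mirror (hx : x ∈ ExtHom n s t) (h : webL n [] s [] x = 0) (a b : List Strand) :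
    webL n a s.reverse b (lin mirror x) = 0 := by
  have h1 := lin_mirror_mem_reduced (mem_relations_of_webL hx h)
  rw [← lin_mirror_delete, ← deleteRow_reverse, ← deleteRow_reverse] at h1
  exact webL_eq_zero h1 a b

/-- The symmetric web with four vertices on the strands `j + 1` and `1`. -/
def squareWeb (j : ℕ) : Word := rungR (j + 1) 1 1 ++ rungL j 2 1

theorem extWeb_squareWeb {j : ℕ} (hn : 2 ≤ n) (h : j + 1 ≤ n) :
    ExtWeb n [up (j + 1), up 1] (squareWeb j) [up (j + 1), up 1] := by
  simp [squareWeb, rungR, rungL, extWeb_cons, extWeb_nil, Slice.src, Slice.tgt, Gen.src, Gen.tgt,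
    Gen.Ext]
  omega

/-- The square relation, including its two degenerate cases. For `j = 0` the square is the fusion
followed by the division. For `j + 1 = n` the fusion is absent, and the claim is
`tagOut_mul_square_mul_tagIn`. -/
theorem web_square {j : ℕ} (hn : 2 ≤ n) (h : j + 1 ≤ n) (a b : List Strand) :
    web n (a ++ [up (j + 1), up 1] ++ b) (whisker a (squareWeb j) b) =
      (if j + 2 ≤ n then web n (a ++ [up (j + 1), up 1] ++ b)
          (whisker a [⟨[], .merge (j + 1) 1, []⟩, ⟨[], .split (j + 1) 1, []⟩] b) else 0) +
        qNat j • web n (a ++ [up (j + 1), up 1] ++ b) [] := by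
  rcases Nat.eq_zero_or_pos j with rfl | hj
  · have h0 : qNat 0 = 0 := rfl
    rw [if_pos hn, h0, zero_smul, add_zero]
    refine web_of_delete_eq rfl ?_
    simp [squareWeb, rungR, rungL, delete_cons, Gen.delete, deleteRow_up_zero]
  rcases h.eq_or_lt with h1 | h1
  · have h2 := tagOut_mul_square_mul_tagIn h1 hj (deleteRow n a) (deleteRow n b)
    have e1 : Gen.delete n .toward (.split j 1) = [⟨[], .tagOut j 1, []⟩] := by
      rw [Gen.delete, if_neg (by omega), if_pos h1]
    have e2 : Gen.delete n .toward (.merge j 1) = [⟨[], .tagIn j 1, []⟩] := by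
      rw [Gen.delete, if_neg (by omega), if_pos h1]; rfl
    have e3 : deleteRow n [up 1] = [up 1] := deleteRow_singleton_up (by omega) (by omega)
    have e4 : deleteRow n [up j] = [up j] := deleteRow_singleton_up (by omega) (by omega)
    have e5 : deleteRow n (a ++ [up (j + 1), up 1] ++ b) =
        deleteRow n a ++ up 1 :: deleteRow n b := by
      rw [h1, deleteRow_append, deleteRow_append, deleteRow_cons (up n), deleteRow_up_self, e3]
      simp
    have e6 : deleteRow n (up 1 :: b) = up 1 :: deleteRow n b := by rw [deleteRow_cons, e3]; rfl
    have h3 := idem_mul_piece (n := n) (R := reduced n)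
      (s := deleteRow n a ++ up 1 :: deleteRow n b) (a := deleteRow n a) (g := .tagOut j 1)
      (b := up 1 :: deleteRow n b) (by simp [Gen.src])
    rw [if_neg (by omega), zero_add, web_nil, web, e5, ← h2]
    simp [squareWeb, rungR, rungL, delete_cons, e1, e2, e4, e6, ev_append, ev_cons, ev_whisker]
    rw [mul_mul_of_mul_eq h3]
    simp only [mul_assoc]
  · have h1 := (ReducedBase.burstSquare (j + 1) (by omega) h1).webL_eq_zero
      (burstSquare_mem_ExtHom (by omega) h1) a b
    rw [map_sub, map_add, map_smul, webL_dg, webL_dg, webL_dg, sub_eq_zero] at h1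
    rw [if_pos (by omega)]
    exact h1

/-- A vertex between upward strands with labels in `0, …, n`. -/
def vertex (n : ℕ) (g : Gen) (L R : List ℕ) : Alg n (reduced n) :=
  web n (L.map up ++ g.src ++ R.map up) [⟨L.map up, g, R.map up⟩]

theorem vertex_mul_web {g : Gen} {L R : List ℕ} (hg : g.Ext n) {r : List Strand}
    (hr : r = L.map up ++ g.tgt ++ R.map up) :
    vertex n g L R * web n r v =
      web n (L.map up ++ g.src ++ R.map up) (⟨L.map up, g, R.map up⟩ :: v) :=
  web_mul_web (by simp [extWeb_cons, extWeb_nil, hg, Slice.src, Slice.tgt]) hr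

theorem vertex_mul_vertex {g g' : Gen} {L R L' R' : List ℕ} (hg : g.Ext n)
    (hr : L'.map up ++ g'.src ++ R'.map up = L.map up ++ g.tgt ++ R.map up) :
    vertex n g L R * vertex n g' L' R' =
      web n (L.map up ++ g.src ++ R.map up)
        [⟨L.map up, g, R.map up⟩, ⟨L'.map up, g', R'.map up⟩] :=
  vertex_mul_web hg hr

/-- Diagrams built from merges and splits of upward strands form a ladder structure. -/
def reducedLadder (n : ℕ) (hn : 2 ≤ n) : Ladder n (Alg n (reduced n)) where
  e L := web n (L.map up) []
  mg L k l R := vertex n (.merge k l) L R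
  sp L k l R := vertex n (.split k l) L R
  e_mul_e L := web_mul_web (extWeb_nil.2 rfl) rfl
  e_mul_mg L k l R h := web_nil_mul_web (by simp [Gen.src])
  mg_mul_e L k l R h := vertex_mul_web (g := .merge k l) h (by simp [Gen.tgt])
  e_mul_sp L k l R h := web_nil_mul_web (by simp [Gen.src])
  sp_mul_e L k l R h := vertex_mul_web (g := .split k l) h (by simp [Gen.tgt])
  mg_mg L k l M k' l' R h h' := by
    rw [vertex_mul_vertex (g := .merge k l) h (by simp [Gen.src, Gen.tgt]),
      vertex_mul_vertex (g := .merge k' l') h' (by simp [Gen.src, Gen.tgt])]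
    have := web_exchange (g := .merge k l) (h := .merge k' l') h h' (L.map up) (M.map up) (R.map up)
      (s := L.map up ++ [up k, up l] ++ M.map up ++ [up k', up l'] ++ R.map up)
    simpa [Gen.src, Gen.tgt] using this
  mg_sp L k l M k' l' R h h' := by
    rw [vertex_mul_vertex (g := .merge k l) h (by simp [Gen.src, Gen.tgt]),
      vertex_mul_vertex (g := .split k' l') h' (by simp [Gen.src, Gen.tgt])]
    have := web_exchange (g := .merge k l) (h := .split k' l') h h' (L.map up) (M.map up) (R.map up)
      (s := L.map up ++ [up k, up l] ++ M.map up ++ [up (k' + l')] ++ R.map up)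
    simpa [Gen.src, Gen.tgt] using this
  sp_mg L k l M k' l' R h h' := by
    rw [vertex_mul_vertex (g := .split k l) h (by simp [Gen.src, Gen.tgt]),
      vertex_mul_vertex (g := .merge k' l') h' (by simp [Gen.src, Gen.tgt])]
    have := web_exchange (g := .split k l) (h := .merge k' l') h h' (L.map up) (M.map up) (R.map up)
      (s := L.map up ++ [up (k + l)] ++ M.map up ++ [up k', up l'] ++ R.map up)
    simpa [Gen.src, Gen.tgt] using this
  sp_sp L k l M k' l' R h h' := by
    rw [vertex_mul_vertex (g := .split k l) h (by simp [Gen.src, Gen.tgt]),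
      vertex_mul_vertex (g := .split k' l') h' (by simp [Gen.src, Gen.tgt])]
    have := web_exchange (g := .split k l) (h := .split k' l') h h' (L.map up) (M.map up) (R.map up)
      (s := L.map up ++ [up (k + l)] ++ M.map up ++ [up (k' + l')] ++ R.map up)
    simpa [Gen.src, Gen.tgt] using this
  assoc L k l m R h := by
    rw [vertex_mul_vertex (g := .merge l m) (show l + m ≤ n by omega) (by simp [Gen.src, Gen.tgt]),
      vertex_mul_vertex (g := .merge k l) (show k + l ≤ n by omega) (by simp [Gen.src, Gen.tgt])]
    simpa [mergeI, mergeH, whisker, Gen.src] using web_assoc h (L.map up) (R.map up)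
  coassoc L k l m R h := by
    rw [vertex_mul_vertex (g := .split k (l + m)) (show k + (l + m) ≤ n by omega)
      (by simp [Gen.src, Gen.tgt]),
      vertex_mul_vertex (g := .split (k + l) m) h (by simp [Gen.src, Gen.tgt])]
    simpa [mergeI, mergeH, whisker, flip, Gen.flip, Gen.src, add_assoc] using
      web_coassoc h (L.map up) (R.map up)
  digon_one L k R h := by
    rw [vertex_mul_vertex (g := .split k 1) h (by simp [Gen.src, Gen.tgt])]
    rcases Nat.eq_zero_or_pos k with rfl | hk
    · have h0 : qNat (0 + 1) = 1 := by simp [qNat]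
      rw [h0, one_smul]
      exact web_of_delete_eq (by simp [Gen.src]) (by simp [delete_cons, Gen.delete])
    · have h1 := (ReducedBase.burstDigon (k + 1) (by omega) h).webL_eq_zero
        (Submodule.sub_mem _ (dg_mem_ExtHom (extWeb_digon h))
          (Submodule.smul_mem _ _ (dg_mem_ExtHom (extWeb_nil.2 rfl)))) (L.map up) (R.map up)
      simpa [sub_eq_zero, digon, whisker, Gen.src] using h1
  digon_zero L k R h := by
    rw [vertex_mul_vertex (g := .split k 0) h (by simp [Gen.src, Gen.tgt])]
    exact web_of_delete_eq (by simp [Gen.src]) (by simp [delete_cons, Gen.delete])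
  digon_zero' L k R h := by
    rw [vertex_mul_vertex (g := .split 0 k) (show 0 + k ≤ n by omega) (by simp [Gen.src, Gen.tgt])]
    exact web_of_delete_eq (by simp [Gen.src]) (by simp [delete_cons, Gen.delete])
  mg_sp_zero L k R h := by
    rw [vertex_mul_vertex (g := .merge k 0) h (by simp [Gen.src, Gen.tgt])]
    exact web_of_delete_eq (by simp [Gen.src]) (by simp [delete_cons, Gen.delete])
  mg_sp_zero' L k R h := by
    rw [vertex_mul_vertex (g := .merge 0 k) (show 0 + k ≤ n by omega) (by simp [Gen.src, Gen.tgt])]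
    exact web_of_delete_eq (by simp [Gen.src]) (by simp [delete_cons, Gen.delete])
  rung_zero L k l R h h' := by
    rw [vertex_mul_vertex (g := .split k 0) h (by simp [Gen.src, Gen.tgt])]
    exact web_of_delete_eq (by simp [Gen.src]) (by simp [delete_cons, Gen.delete])
  rung_zero' L k l R h h' := by
    rw [vertex_mul_vertex (g := .split 0 l) (show 0 + l ≤ n by omega) (by simp [Gen.src, Gen.tgt])]
    exact web_of_delete_eq (by simp [Gen.src]) (by simp [delete_cons, Gen.delete])
  square L j R h := by
    rw [mul_assoc, mul_assoc (vertex n (.merge 1 1) _ _),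
      vertex_mul_vertex (g := .split 1 1) hn (by simp [Gen.src, Gen.tgt]),
      vertex_mul_web (g := .merge 1 1) hn (by simp [Gen.src, Gen.tgt]),
      vertex_mul_web (g := .split j 1) h (by simp [Gen.src, Gen.tgt])]
    have h1 := web_square hn h (L.map up) (R.map up)
    split_ifs at h1 ⊢ with h2
    · rw [vertex_mul_vertex (g := .merge (j + 1) 1) h2 (by simp [Gen.src, Gen.tgt])]
      simpa [squareWeb, rungR, rungL, whisker, Gen.src] using h1
    · simpa [squareWeb, rungR, rungL, whisker, Gen.src] using h1
  square' L j R h := by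
    rw [mul_assoc, mul_assoc (vertex n (.merge 1 1) _ _),
      vertex_mul_vertex (g := .split 1 1) hn (by simp [Gen.src, Gen.tgt]),
      vertex_mul_web (g := .merge 1 1) hn (by simp [Gen.src, Gen.tgt]),
      vertex_mul_web (g := .split 1 j) (show 1 + j ≤ n by omega)
        (by simp [Gen.src, Gen.tgt])]
    have h1 := web_square hn h [] []
    have h2 := extWeb_squareWeb hn h
    have h0 : ExtWeb n [up (j + 1), up 1] [] [up (j + 1), up 1] := extWeb_nil.2 rfl
    split_ifs at h1 ⊢ with h3
    · have h4 : ExtWeb n [up (j + 1), up 1]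
          [⟨[], .merge (j + 1) 1, []⟩, ⟨[], .split (j + 1) 1, []⟩] [up (j + 1), up 1] := by
        simp [extWeb_cons, extWeb_nil, Slice.src, Slice.tgt, Gen.src, Gen.tgt, Gen.Ext, h3]
      rw [vertex_mul_vertex (g := .merge 1 (j + 1)) (show 1 + (j + 1) ≤ n by omega)
        (by simp [Gen.src, Gen.tgt])]
      have h5 := webL_mirror (Submodule.sub_mem _ (dg_mem_ExtHom h2) (Submodule.add_mem _
        (dg_mem_ExtHom h4) (Submodule.smul_mem _ (qNat j) (dg_mem_ExtHom h0))))
        (by simpa only [map_sub, map_add, map_smul, webL_dg, sub_eq_zero, whisker_nil] using h1)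
        (L.map up) (R.map up)
      simpa [sub_eq_zero, lin_dg, squareWeb, rungR, rungL, mirror, Gen.mirror, whisker, Gen.src,
        add_comm 1 j] using h5
    · have h5 := webL_mirror (Submodule.sub_mem _ (dg_mem_ExtHom h2)
        (Submodule.smul_mem _ (qNat j) (dg_mem_ExtHom h0)))
        (by simpa only [map_sub, zero_add, map_smul, webL_dg, sub_eq_zero, whisker_nil] using h1)
        (L.map up) (R.map up)
      simpa [sub_eq_zero, lin_dg, squareWeb, rungR, rungL, mirror, Gen.mirror, whisker, Gen.src,
        add_comm 1 j] using h5

end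

noncomputable section

variable {n : ℕ} {s t r : List Strand} {x : Lin} {u v w w' : Word}

/-! ### The relations of Cautis, Kamnitzer and Morrison in the reduced calculus -/

theorem web_rungR (hn : 2 ≤ n) {k l s : ℕ} (hs : s ≤ k) (h : l + s ≤ n) (hk : k ≤ n) :
    web n [up k, up l] (rungR k l s) = (reducedLadder n hn).rungF s k l := by
  rw [Ladder.rungF, if_pos ⟨hs, h⟩]
  change _ = vertex n _ _ _ * vertex n _ _ _
  rw [vertex_mul_vertex (g := .split (k - s) s) (show k - s + s ≤ n by omega)
    (by simp [Gen.src, Gen.tgt])]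
  simp [rungR, Gen.src, Nat.sub_add_cancel hs]

theorem web_rungL (hn : 2 ≤ n) {k l r : ℕ} (hr : r ≤ l) (h : k + r ≤ n) (hl : l ≤ n) :
    web n [up k, up l] (rungL k l r) = (reducedLadder n hn).rungE r k l := by
  rw [Ladder.rungE, if_pos ⟨hr, h⟩]
  change _ = vertex n _ _ _ * vertex n _ _ _
  rw [vertex_mul_vertex (g := .split r (l - r)) (show r + (l - r) ≤ n by omega)
    (by simp [Gen.src, Gen.tgt])]
  simp [rungL, Gen.src, Nat.add_sub_cancel' hr]

theorem webL_ladderRL (hn : 2 ≤ n) {k l s r : ℕ} (hk : k ≤ n) :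
    webL n [] [up k, up l] [] (ladderRL n k l s r) =
      (reducedLadder n hn).rungF s k l * (reducedLadder n hn).rungE r (k - s) (l + s) := by
  unfold ladderRL
  split_ifs with h
  · rw [webL_dg, ← web_rungR hn h.1 h.2.1 hk, ← web_rungL hn h.2.2.1 h.2.2.2 h.2.1,
      web_mul_web (extWeb_rungR hk h.1 h.2.1) rfl]
    simp
  · rw [map_zero]
    by_cases h1 : s ≤ k ∧ l + s ≤ n
    · rw [Ladder.rungE, if_neg (by omega), mul_zero]
    · rw [Ladder.rungF, if_neg h1, zero_mul]

theorem webL_ladderLR (hn : 2 ≤ n) {k l s r : ℕ} (hl : l ≤ n) :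
    webL n [] [up k, up l] [] (ladderLR n k l r s) =
      (reducedLadder n hn).rungE r k l * (reducedLadder n hn).rungF s (k + r) (l - r) := by
  unfold ladderLR
  split_ifs with h
  · rw [webL_dg, ← web_rungL hn h.1 h.2.1 hl, ← web_rungR hn h.2.2.1 h.2.2.2 h.2.1,
      web_mul_web (extWeb_rungL hl h.1 h.2.1) rfl]
    simp
  · rw [map_zero]
    by_cases h1 : r ≤ l ∧ k + r ≤ n
    · rw [Ladder.rungF, if_neg (by omega), mul_zero]
    · rw [Ladder.rungE, if_neg h1, zero_mul]

theorem webL_switchSquare (hn : 2 ≤ n) {k l r s : ℕ} (hk : k ≤ n) (hl : l ≤ n) :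
    webL n [] [up k, up l] [] (ladderRL n k l s r) = ∑ t ∈ Finset.range (min r s + 1),
        qBinom ((k : ℤ) - l + r - s) t •
          webL n [] [up k, up l] [] (ladderLR n k l (r - t) (s - t)) := by
  rw [webL_ladderRL hn hk]
  simp only [webL_ladderLR hn hl]
  exact ((reducedLadder n hn).dividedPowers (k + l)).F_mul_E s r k l rfl hk hl

/-- A strand labelled `k` with a loop labelled `l` on its left. -/
def loop (k l : ℕ) : Word :=
  [⟨[], .cup (dn l), [up k]⟩, ⟨[dn l], .merge l k, []⟩, ⟨[dn l], .split l k, []⟩,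
    ⟨[], .cap (dn l), [up k]⟩]

theorem extWeb_loop {k l : ℕ} (h : k + l ≤ n) : ExtWeb n [up k] (loop k l) [up k] := by
  simp [loop, extWeb_cons, extWeb_nil, Slice.src, Slice.tgt, Gen.src, Gen.tgt, Gen.Ext, up, dn,
      Strand.dual]
  omega

/-- A loop labelled `l` is the ladder with two opposite rungs labelled `l` next to a strand
labelled `n`. -/
theorem web_loop_eq_ladder {k l : ℕ} (hl : 0 < l) (hln : l < n) (h : k + l ≤ n) :
    web n [up k] (loop k l) = web n [up n, up k] (rungR n k l ++ rungL (n - l) (k + l) l) := by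
  have hw : IsPath (up l :: deleteRow n [up k])
      (Gen.delete n .toward (.merge l k) ++ Gen.delete n .toward (.split l k))
      (up l :: deleteRow n [up k]) := by
    have h1 : l + k ≤ n := by omega
    have h2 : ExtWeb n [up l, up k] [⟨[], .merge l k, []⟩, ⟨[], .split l k, []⟩] [up l, up k] := by
      simp [extWeb_cons, extWeb_nil, Slice.src, Slice.tgt, Gen.src, Gen.tgt, Gen.Ext, h1]
    have h3 := (h2.delete (c := .toward)).2.2.2
    rw [deleteRow_cons (up l), deleteRow_singleton_up hl hln] at h3
    simpa [delete_cons] using h3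
  have h1 := cup_mul_cap_eq_tags (n := n) l (n - l) [] [] hw hl (by omega) (by omega)
  have e1 : Gen.delete n .toward (.split (n - l) l) = [⟨[], .tagOut (n - l) l, []⟩] := by
    rw [Gen.delete, if_neg (by omega), if_pos (by omega)]
  have e2 : Gen.delete n .toward (.merge (n - l) l) = [⟨[], .tagIn (n - l) l, []⟩] := by
    rw [Gen.delete, if_neg (by omega), if_pos (by omega)]; rfl
  have e3 : deleteRow n [up (n - l)] = [up (n - l)] :=
    deleteRow_singleton_up (by omega) (by omega)
  have e4 : deleteRow n [dn l] = [dn l] := deleteRow_of_rowOK (by simp [dn]; omega)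
  have e5 : deleteRow n [up n, up k] = deleteRow n [up k] := by
    rw [deleteRow_cons, deleteRow_up_self, List.nil_append]
  have e6 : Gen.delete n .toward (.cup (dn l)) = [⟨[], .cup (dn l), []⟩] := if_pos ⟨hl, hln⟩
  have e7 : Gen.delete n .toward (.cap (dn l)) = [⟨[], .cap (dn l), []⟩] := if_pos ⟨hl, hln⟩
  rw [web, web, e5]
  congr 1
  simpa [loop, rungR, rungL, delete_cons, e1, e2, e3, e4, e6, e7, ev_cons, ev_append,
    ev_whisker, mul_assoc] using h1

/-- Square switching on the strands `n` and `k`: all terms except `t = l` contain a strand with a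
label greater than `n`. -/
theorem web_loop (hn : 2 ≤ n) {k l : ℕ} (h : k + l ≤ n) :
    web n [up k] (loop k l) = qBinom ((n : ℤ) - k) l • web n [up k] [] := by
  rcases Nat.eq_zero_or_pos l with rfl | hl
  · rw [qBinom_zero, one_smul]
    exact web_of_delete_eq rfl (by simp [loop, delete_cons, Gen.delete, dn])
  rcases (show l ≤ n by omega).eq_or_lt with rfl | hln
  · obtain rfl : k = 0 := by omega
    rw [Nat.cast_zero, sub_zero, qBinom_self, one_smul]
    exact web_of_delete_eq rfl (by simp [loop, delete_cons, Gen.delete, dn])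
  rw [web_loop_eq_ladder hl hln h]
  have h1 := webL_switchSquare hn (r := l) (s := l) le_rfl (show k ≤ n by omega)
  rw [min_self, Finset.sum_eq_single_of_mem l (by simp)] at h1
  · simp only [ladderRL, ladderLR, Nat.sub_self] at h1
    rw [if_pos (by omega), if_pos (by omega)] at h1
    rw [webL_dg, webL_dg] at h1
    have h2 : web n ([] ++ [up n, up k] ++ [])
        (whisker [] (rungL n k 0 ++ rungR (n + 0) (k - 0) 0) []) = web n [up k] [] :=
      web_of_delete_eq (by rw [List.nil_append, List.append_nil, deleteRow_cons,
        deleteRow_up_self, List.nil_append])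
        (by simp [rungL, rungR, delete_cons, Gen.delete])
    rw [h2, show (n : ℤ) - k + l - l = n - k by ring] at h1
    simpa using h1
  · intro t ht htl
    rw [Finset.mem_range] at ht
    rw [ladderLR, if_neg (by omega), map_zero, smul_zero]

theorem deleteRow_dn_self : deleteRow n [dn n] = [] := by simp [deleteRow, dn]

theorem delete_mergeDown {k l : ℕ} (hk : 0 < k) (hl : 0 < l) (h : k + l = n) :
    delete n .toward (mergeDown k l) = tagInSwitched k l := by
  have e1 : deleteRow n [dn l] = [dn l] := deleteRow_of_rowOK (by simp [dn]; omega)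
  have e4 : deleteRow n [up l] = [up l] := deleteRow_singleton_up hl (by omega)
  have e3 : deleteRow n [dn (k + l), up l] = [up l] := by
    rw [h, deleteRow_cons, deleteRow_dn_self, e4, List.nil_append]
  have e2 : deleteRow n [up k, dn (k + l), up l] = [up k, up l] := by
    rw [deleteRow_cons, e3, deleteRow_singleton_up hk (by omega)]; rfl
  have e5 : Gen.delete n .toward (.merge l k) = [⟨[], .tagIn l k, []⟩] := by
    rw [Gen.delete, if_neg (by omega), if_pos (by omega)]; rfl
  have e6 : Gen.delete n .toward (.cup (dn l)) = [⟨[], .cup (dn l), []⟩] :=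
    if_pos ⟨hl, show l < n by omega⟩
  have e7 : Gen.delete n .toward (.cap (dn l)) = [⟨[], .cap (dn l), []⟩] :=
    if_pos ⟨hl, show l < n by omega⟩
  have e8 : Gen.delete n .toward (.cap (up (l + k))) = [] :=
    if_neg (by simp only [up]; omega)
  simp [mergeDown, tagInSwitched, delete_cons, e1, e2, e3, e4, e5, e6, e7, e8]

theorem web_migrateTag {k l m : ℕ} (hk : 0 < k) (hl : 0 < l) (hm : 0 < m) (h : k + l + m = n) :
    web n [up (k + l), dn n, up (k + m)]
        (⟨[], .split k l, [dn n, up (k + m)]⟩ :: whisker [up k] (mergeDown l (k + m)) []) =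
      web n [up (k + l), dn n, up (k + m)]
        (⟨[up (k + l), dn n], .split m k, []⟩ :: whisker [] (mergeDown (k + l) m) [up k]) := by
  have h1 := split_mul_tagInSwitched (n := n) [] [] hk hl hm h
  have e1 : Gen.delete n .toward (.split k l) = [⟨[], .split k l, []⟩] := by
    rw [Gen.delete, if_neg (by omega), if_neg (by omega)]
  have e2 : Gen.delete n .toward (.split m k) = [⟨[], .split m k, []⟩] := by
    rw [Gen.delete, if_neg (by omega), if_neg (by omega)]
  have e3 : deleteRow n [up k] = [up k] := deleteRow_singleton_up hk (by omega)
  have e4 : deleteRow n [dn n, up (k + m)] = [up (k + m)] := by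
    rw [deleteRow_cons, deleteRow_dn_self, deleteRow_singleton_up (by omega) (by omega)]; rfl
  have e5 : deleteRow n [up (k + l), dn n] = [up (k + l)] := by
    rw [deleteRow_cons, deleteRow_dn_self, deleteRow_singleton_up (by omega) (by omega)]; rfl
  rw [web, web]
  congr 1
  simpa [delete_cons, e1, e2, e3, e4, e5, ev_cons, ev_whisker,
    delete_mergeDown hl (show 0 < k + m by omega) (show l + (k + m) = n by omega),
    delete_mergeDown (show 0 < k + l by omega) hm h] using h1

/-- Every relator of Cautis, Kamnitzer and Morrison follows from the reduced ones: `I = H` and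
digons hold in the ladder algebra, and the relations of squares are relations of divided powers. -/
theorem CKMBase.mem_reduced (hn : 2 ≤ n) (hb : CKMBase n x) : ∃ s t, x ∈ ExtHom n s t ∧
    lin (delete n .toward) x ∈ relations n (reduced n) (deleteRow n s) (deleteRow n t) := by
  suffices h : ∃ s t, x ∈ ExtHom n s t ∧ webL n [] s [] x = 0 by
    obtain ⟨s, t, hx, h⟩ := h
    exact ⟨s, t, hx, mem_relations_of_webL hx h⟩
  cases hb with
  | switchTag k l hk hl h =>
    have h1 := Submodule.sub_mem _ (dg_mem_ExtHom (extWeb_tagOut hk hl h))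
      (Submodule.smul_mem _ ((-1 : K) ^ (k * l)) (dg_mem_ExtHom (extWeb_tagOutSwitched hk hl h)))
    exact ⟨_, _, h1, (ReducedBase.switchTag k l hk hl h).webL_eq_zero h1 [] []⟩
  | removeBigon k l h =>
    refine ⟨_, _, Submodule.sub_mem _ (dg_mem_ExtHom (extWeb_digon h))
      (Submodule.smul_mem _ _ (dg_mem_ExtHom (extWeb_nil.2 rfl))), ?_⟩
    have h1 := (reducedLadder n hn).digon [] k l [] h
    change vertex n _ _ _ * vertex n _ _ _ = _ • web n _ _ at h1
    rw [vertex_mul_vertex (g := .split k l) h (by simp [Gen.src, Gen.tgt])] at h1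
    simpa [sub_eq_zero, digon, Gen.src] using h1
  | removeBigon' k l h =>
    refine ⟨_, _, Submodule.sub_mem _ (dg_mem_ExtHom (extWeb_loopRight h))
      (Submodule.smul_mem _ _ (dg_mem_ExtHom (extWeb_nil.2 rfl))), ?_⟩
    have h1 := web_loop hn h
    have h2 := webL_mirror (Submodule.sub_mem _ (dg_mem_ExtHom (extWeb_loop h))
      (Submodule.smul_mem _ (qBinom ((n : ℤ) - k) l)
        (dg_mem_ExtHom (extWeb_nil (n := n) (s := [up k]) |>.2 rfl))))
      (by simpa [sub_eq_zero] using h1) [] []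
    simpa [lin_dg, loop, mirror, Gen.mirror] using h2
  | iEqH k l m h =>
    refine ⟨_, _, Submodule.sub_mem _ (dg_mem_ExtHom (extWeb_mergeI h.le))
      (dg_mem_ExtHom (extWeb_mergeH h.le)), ?_⟩
    rw [map_sub, webL_dg, webL_dg, web_assoc h.le, sub_self]
  | migrateTag k l m hk hl hm h =>
    refine ⟨_, _, Submodule.sub_mem _ (dg_mem_ExtHom (extWeb_mergeI h.le))
      (dg_mem_ExtHom (extWeb_mergeH h.le)), ?_⟩
    rw [map_sub, webL_dg, webL_dg, web_assoc h.le, sub_self]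
  | migrateTag' k l m hk hl hm h =>
    refine ⟨_, _, Submodule.sub_mem _ (dg_mem_ExtHom (extWeb_migrateTag_left h))
      (dg_mem_ExtHom (extWeb_migrateTag_right h)), ?_⟩
    have h1 := web_migrateTag hk hl hm h
    rw [map_sub, webL_dg, webL_dg, sub_eq_zero]
    simpa using h1
  | removeSquare k l r s hk hrs h =>
    refine ⟨_, _, Submodule.sub_mem _ (dg_mem_ExtHom (extWeb_rungR_rungR hk hrs h))
      (Submodule.smul_mem _ _ (dg_mem_ExtHom (extWeb_rungR hk hrs h))), ?_⟩
    have h1 := (reducedLadder n hn).rungF_mul_rungF r s k l hk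
    rw [← web_rungR hn (by omega) (by omega) hk, ← web_rungR hn (by omega) (by omega) (by omega),
      ← web_rungR hn hrs h hk, web_mul_web (extWeb_rungR hk (by omega) (by omega)) rfl] at h1
    simpa [sub_eq_zero] using h1
  | switchSquare k l r s hk hl =>
    refine ⟨_, _, Submodule.sub_mem _ (ladderRL_mem_ExtHom r s hk)
      (Submodule.sum_mem _ fun t ht => Submodule.smul_mem _ _ (ladderLR_mem_ExtHom r s t ?_ ?_ hl)),
      ?_⟩
    · simp only [Finset.mem_range] at ht; omega
    · simp only [Finset.mem_range] at ht; omega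
    · simp only [map_sub, map_sum, map_smul]
      rw [webL_switchSquare hn hk hl, sub_self]

/-- If the tag of a deleted strand is always placed on the side of that strand, the two lists have
the same consequences. -/
theorem relations_reduced_eq_ckmWith_toward (hn : 2 ≤ n) (s t : List Strand) :
    relations n (reduced n) s t = relations n (ckmWith n .toward) s t :=
  le_antisymm (reduced_le_ckmWith_toward s t)
    (ckmWith_toward_le_reduced (fun _ hb => hb.mem_reduced hn) s t)

end

noncomputable section

variable {n : ℕ} {R R' : Set Lin} {c c' : Convention} {s t : List Strand} {x y : Lin}

/-! ### The change of tag convention -/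

/-- The change of tag convention on a single diagram. -/
def retagW (w : Word) : Word := subst id Gen.retag w

theorem retag_eq : retag = lin retagW := rfl

@[simp] theorem retag_dg (w : Word) : retag (dg w) = dg (retagW w) := lin_dg ..

@[simp] theorem retagW_nil : retagW [] = [] := rfl

theorem retagW_cons (σ : Slice) (w : Word) :
    retagW (σ :: w) = whisker σ.left σ.gen.retag σ.right ++ retagW w := rfl

@[simp] theorem retagW_append (u v : Word) : retagW (u ++ v) = retagW u ++ retagW v :=
  subst_append ..

@[simp] theorem retagW_whisker (a b : List Strand) (w : Word) :
    retagW (whisker a w b) = whisker a (retagW w) b := subst_whisker (fun _ _ => rfl) ..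

/-- Diagrams without incoming bivalent vertices. -/
def NoTagIn (w : Word) : Prop := ∀ σ ∈ w, ∀ k l, σ.gen ≠ .tagIn k l

theorem Gen.retag_of_ne {g : Gen} (h : ∀ k l, g ≠ .tagIn k l) : g.retag = [⟨[], g, []⟩] := by
  cases g <;> simp_all [Gen.retag]

theorem retagW_of_noTagIn {w : Word} (h : NoTagIn w) : retagW w = w := by
  induction w with
  | nil => rfl
  | cons σ w ih =>
    rw [NoTagIn, List.forall_mem_cons] at h
    rw [retagW_cons, ih h.2, Gen.retag_of_ne h.1]
    simp

theorem noTagIn_cups (s : List Strand) : NoTagIn (cups s) := by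
  induction s with
  | nil => simp [NoTagIn, cups]
  | cons x s ih =>
    simp only [NoTagIn, cups, whisker, List.forall_mem_cons, List.forall_mem_map] at ih ⊢
    exact ⟨by simp, ih⟩

theorem noTagIn_caps (s : List Strand) : NoTagIn (caps s) := by
  induction s with
  | nil => simp [NoTagIn, caps]
  | cons x s ih =>
    simp only [NoTagIn, caps, List.forall_mem_cons] at ih ⊢
    exact ⟨by simp, ih⟩

theorem retagW_rotW (s t : List Strand) (w : Word) : retagW (rotW s t w) = rotW s t (retagW w) := by
  simp [rotW, retagW_of_noTagIn (noTagIn_cups _), retagW_of_noTagIn (noTagIn_caps _)]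

theorem retagW_rotW' (s t : List Strand) (w : Word) :
    retagW (rotW' s t w) = rotW' s t (retagW w) := by
  simp [rotW', retagW_of_noTagIn (noTagIn_cups _), retagW_of_noTagIn (noTagIn_caps _)]

theorem isPath_retag (g : Gen) : IsPath g.src g.retag g.tgt := by
  cases g <;> first | exact isPath_tagInSwitched _ _ | exact isPath_gen _

theorem isWeb_retag {g : Gen} (h : g.OK n) : IsWeb n g.src g.retag g.tgt := by
  cases g with
  | tagIn k l => exact isWeb_tagInSwitched h.1 h.2.1 h.2.2
  | _ => exact isWeb_gen h

theorem IsWeb.retagW {w : Word} (h : IsWeb n s w t) : IsWeb n s (retagW w) t := by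
  induction w generalizing s with
  | nil => exact h
  | cons σ w ih =>
    rw [isWeb_cons] at h
    obtain ⟨rfl, hσ, h⟩ := h
    exact ((isWeb_retag hσ.2.1).whisker hσ.1 hσ.2.2).append (ih h)

theorem retag_mem_Hom (hx : x ∈ Hom n s t) : retag x ∈ Hom n s t :=
  lmapDomain_mem_Hom (fun _ h => h.retagW) hx

theorem retag_insert (u v : Word) (a b : List Strand) (x : Lin) :
    retag (insert u v a b x) = insert (retagW u) (retagW v) a b (retag x) := by
  have : ∀ u v a b, insert u v a b = lin (fun w => u ++ whisker a w b ++ v) := fun _ _ _ _ => rfl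
  rw [retag_eq, this, this, lin_lin, lin_lin]
  congr 2
  funext w
  simp

/-- The two half turns of an elementary piece with its new tag agree. -/
theorem ev_rot_retag (g : Gen) (a b : List Strand) :
    ev n R a (rotW g.src g.tgt g.retag) b = ev n R a (rotW' g.src g.tgt g.retag) b := by
  cases g with
  | tagIn k l =>
    have p1 := (isPath_retag (.tagIn k l)).rotW
    have p2 := (isPath_retag (.tagIn k l)).rotW'
    have n1 : rotW (Gen.tagIn k l).src (Gen.tagIn k l).tgt (Gen.tagIn k l).retag ≠ [] := by
      simp [rotW, Gen.retag, tagInSwitched]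
    have n2 : rotW' (Gen.tagIn k l).src (Gen.tagIn k l).tgt (Gen.tagIn k l).retag ≠ [] := by
      simp [rotW', Gen.retag, tagInSwitched]
    rw [← idem_mul_ev_of_ne_nil p1 n1, ← idem_mul_ev_of_ne_nil p2 n2]
    by_cases H : (Gen.tagIn k l).OK n
    · exact (iso_rotW_rotW' (isWeb_retag H)).idem_mul_ev a b
    · have e : ∀ c d, ev n R c (Gen.tagIn k l).retag d = 0 := fun c d => by
        simp only [Gen.retag, tagInSwitched, ev_cons]
        rw [piece_eq_zero (g := .tagIn l k) (by simp only [Gen.OK] at H ⊢; omega)]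
        simp
      simp only [rotW, rotW', ev_append, ev_whisker, e, mul_zero, zero_mul]
  | _ => exact ev_rot_gen _ a b

theorem Isotopy.retag_mem (hx : Isotopy x) (hH : x ∈ Hom n s t) : retag x ∈ relations n R s t := by
  refine relations_mono (Set.empty_subset R) s t ?_
  have key := mem_relations_of_mem (R := (∅ : Set Lin)) (Or.inl hx) hH
  refine mem_relations_of_evL (retag_mem_Hom hH) ?_
  have h0 := idem_mul_evL_eq_zero key [] []
  cases hx with
  | exchange g h b =>
    have h1 := ev_exchange (n := n) (R := ∅) (isPath_retag g) (isPath_retag h) [] b []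
    simp only [map_sub, retag_dg, evL_dg, retagW_cons, retagW_nil, ev_append, ev_whisker,
      List.nil_append, List.append_nil] at h1 ⊢
    rw [h1, sub_self, mul_zero]
  | zigzag x => simpa [retagW_cons, Gen.retag] using h0
  | zigzag' x => simpa [retagW_cons, Gen.retag] using h0
  | rotate g =>
    rw [Gen.rot_eq, Gen.rot'_eq, map_sub, retag_dg, retag_dg, retagW_rotW, retagW_rotW']
    simp only [retagW_cons, retagW_nil, List.append_nil, whisker_empty, map_sub, evL_dg]
    rw [ev_rot_retag, sub_self, mul_zero]

theorem retag_mem_relations (hR : ∀ x ∈ R, Placeable n x)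
    (h : ∀ x ∈ R, ∃ s t, x ∈ Hom n s t ∧ retag x ∈ relations n R' s t)
    (hx : x ∈ relations n R s t) : retag x ∈ relations n R' s t := by
  refine relations_le (N := (relations n R' s t).comap retag) hR ?_ hx
  intro u v a b x s' t' hx hH hu hv
  rw [Submodule.mem_comap, retag_insert]
  refine insert_mem_relations ?_ hu.retagW hv.retagW
  rcases hx with hx | hx
  · exact hx.retag_mem hH
  · obtain ⟨s₀, t₀, h₀, h₁⟩ := h x hx
    rcases (hR x hx).hom_unique h₀ hH with rfl | ⟨rfl, rfl⟩
    · simp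
    · exact h₁

/-- Switching the side of a tag twice is a full turn of the vertex. -/
theorem ev_retagW_tagInSwitched {k l : ℕ} (hk : 0 < k) (hl : 0 < l) (h : k + l = n)
    (a b : List Strand) :
    ev n R a (retagW (tagInSwitched k l)) b = piece n R a (.tagIn k l) b := by
  have p1 := (isPath_tagInSwitched k l).mirror
  have p2 := isPath_tagInSwitched l k
  have h1 := (iso_mirror_tagInSwitched k l hk hl h).idem_mul_ev (R := R) (a ++ [dn l]) (up l :: b)
  have h2 := idem_mul_ev_of_ne_nil (n := n) (R := R) (a := a ++ [dn l]) (b := up l :: b) p1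
    (by simp [tagInSwitched, mirror])
  have h3 := idem_mul_ev_of_ne_nil (n := n) (R := R) (a := a ++ [dn l]) (b := up l :: b) p2
    (by simp [tagInSwitched])
  simp only [List.reverse_cons, List.reverse_nil, List.nil_append, List.cons_append] at h2
  rw [h2, h3] at h1
  have hw : IsPath [up k, up l] [⟨[up k], .cup (up l), [up l]⟩, ⟨[], .tagIn k l, [dn l, up l]⟩]
      [dn l, up l] := by simp [Slice.src, Slice.tgt, Gen.src, Gen.tgt]
  have h4 := piece_ev_exchange (n := n) (R := R) (g := .cup (dn l)) hw a [] b
  have h5 := cup_mul_cap (n := n) (R := R) (dn l) a (up l :: b)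
  have h6 := idem_mul_piece (n := n) (R := R) (s := a ++ dn l :: up l :: b) (a := a)
    (g := .cap (dn l)) (b := b) (by simp [Gen.src])
  have h7 := piece_exchange (n := n) (R := R) (.tagIn k l) (.cap (dn l)) a [] b
  have h8 := cup_mul_cap (n := n) (R := R) (up l) (a ++ [up k]) b
  have h9 := idem_mul_piece (n := n) (R := R) (s := a ++ up k :: up l :: b) (a := a)
    (g := .tagIn k l) (b := b) (by simp [Gen.src])
  have e1 : retagW (tagInSwitched k l) = ⟨[], .cup (dn l), [up k, up l]⟩ ::
      (whisker [dn l] (tagInSwitched l k) [up l] ++ [⟨[], .cap (dn l), []⟩]) := by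
    simp [tagInSwitched, retagW_cons, Gen.retag]
  have e2 : mirror (tagInSwitched k l) = [⟨[up l, up k], .cup (up l), []⟩,
      ⟨[up l], .tagIn k l, [dn l]⟩, ⟨[], .cap (up l), []⟩] := by
    simp [tagInSwitched, mirror, Gen.mirror]
  rw [e2] at h1
  simp only [e1, ev_cons, ev_append, ev_whisker, ev_nil, mul_one, Gen.src, Gen.tgt, dual_dn,
    dual_up, List.append_assoc, List.cons_append, List.nil_append, List.append_nil] at *
  rw [← h1]
  simp only [mul_assoc] at h4 ⊢
  rw [← mul_assoc (piece n R _ (.cup (up l)) _), ← mul_assoc (piece n R _ (.cup (dn l)) _), h4]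
  simp only [mul_assoc]
  rw [mul_mul_of_mul_eq h5, h6, h7, mul_mul_of_mul_eq h8, h9]

theorem iso_retagW_retagW {w : Word} (hw : IsWeb n s w t) :
    Iso n s t (retagW (retagW w)) w := by
  refine Iso.of_ev hw.retagW.retagW hw ?_
  congr 1
  suffices h : ∀ a b, ev n ∅ a (retagW (retagW w)) b = ev n ∅ a w b from h [] []
  intro a b
  induction w generalizing s with
  | nil => rfl
  | cons σ w ih =>
    rw [isWeb_cons] at hw
    rw [retagW_cons, retagW_append, retagW_whisker, ev_append, ih hw.2.2, ev_cons, ev_whisker]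
    congr 1
    obtain ⟨l, g, r⟩ := σ
    cases g with
    | tagIn k l => exact ev_retagW_tagInSwitched hw.2.1.2.1.1 hw.2.1.2.1.2.1 hw.2.1.2.1.2.2 _ _
    | _ => simp [Gen.retag, retagW_cons, ev_cons]

theorem retag_retag_sub_mem (hx : x ∈ Hom n s t) : retag (retag x) - x ∈ relations n R s t := by
  have h1 := lin_sub_lin_mem (R := R) (f := retagW ∘ retagW) (g := id)
    (fun _ h => iso_retagW_retagW h) (mem_Hom.1 hx)
  have h2 : lin id x = x := by simp [lin]
  rwa [h2, ← lin_lin] at h1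

/-! ### The two conventions for the tags of deleted strands -/

/-- Diagrams without bivalent vertices. -/
def NoTag (w : Word) : Prop := ∀ σ ∈ w, ∀ k l, σ.gen ≠ .tagIn k l ∧ σ.gen ≠ .tagOut k l

theorem Gen.retagW_delete {g : Gen} (h : ∀ k l, g ≠ .tagIn k l) :
    SLWeb.retagW (g.delete n .toward) = g.delete n .ckm := by
  cases g <;> simp only [Gen.delete] <;> (try split_ifs) <;>
    first | rfl | (simp [retagW_cons, Gen.retag]; done) | simp at h

theorem retagW_delete {w : Word} (h : NoTagIn w) :
    retagW (delete n .toward w) = delete n .ckm w := by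
  induction w with
  | nil => rfl
  | cons σ w ih =>
    rw [NoTagIn, List.forall_mem_cons] at h
    rw [delete_cons, retagW_append, retagW_whisker, ih h.2, Gen.retagW_delete h.1, delete_cons]

theorem NoTag.noTagIn {w : Word} (h : NoTag w) : NoTagIn w := fun σ hσ k l => (h σ hσ k l).1

theorem NoTag.mirror {w : Word} (h : NoTag w) : NoTag (mirror w) := by
  intro σ hσ k l
  simp only [SLWeb.mirror, List.mem_map] at hσ
  obtain ⟨τ, hτ, rfl⟩ := hσ
  have := h τ hτ l k
  cases hg : τ.gen <;> simp_all [Gen.mirror] <;> tauto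

theorem noTagIn_append {u v : Word} : NoTagIn (u ++ v) ↔ NoTagIn u ∧ NoTagIn v := by
  simp only [NoTagIn, List.forall_mem_append]

theorem noTagIn_whisker {a b : List Strand} {w : Word} : NoTagIn (whisker a w b) ↔ NoTagIn w := by
  simp only [NoTagIn, whisker, List.forall_mem_map]

theorem noTagIn_rot {g : Gen} (h : ∀ k l, g ≠ .tagIn k l) : NoTagIn g.rot := by
  rw [Gen.rot_eq, rotW]
  simp only [noTagIn_append, noTagIn_whisker, noTagIn_cups, noTagIn_caps, true_and, and_true]
  simpa [NoTagIn] using h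

theorem NoTag.noTagIn_reverse {w : Word} (h : NoTag w) : NoTagIn (reverse w) := by
  induction w with
  | nil => simp [NoTagIn, reverse]
  | cons σ w ih =>
    rw [NoTag, List.forall_mem_cons] at h
    rw [reverse_cons, noTagIn_append, noTagIn_whisker]
    refine ⟨?_, ih h.2⟩
    have h1 := h.1
    cases hg : σ.gen <;> rw [hg] at h1 <;> simp only [Gen.reverse]
    · simp [NoTagIn]
    · simp [NoTagIn]
    · exact noTagIn_rot (by simp)
    · exact noTagIn_rot (by simp)
    · simp at h1
    · simp at h1

theorem apply_ne_zero_imp {P : Word → Prop} (h : x ∈ Finsupp.supported K K {w | P w}) (w : Word)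
    (hw : x w ≠ 0) : P w :=
  (Finsupp.mem_supported K x).1 h (Finsupp.mem_support_iff.2 hw)

/-- Apart from the relation that switches a tag, the relators contain no bivalent vertices. -/
theorem CKMBase.noTag (hb : CKMBase n x) : (∃ k l, 0 < k ∧ 0 < l ∧ k + l = n ∧
    x = switchTagRelator k l) ∨ ∀ w, x w ≠ 0 → NoTag w := by
  have dg' : ∀ {w : Word}, NoTag w → dg w ∈ Finsupp.supported K K {w | NoTag w} :=
    fun {w} h => Finsupp.single_mem_supported K _ h
  have nil : NoTag [] := by simp [NoTag]
  have app : ∀ {u v}, NoTag u → NoTag v → NoTag (u ++ v) := fun {u v} hu hv => by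
    simp only [NoTag, List.forall_mem_append] at *; exact ⟨hu, hv⟩
  have rR : ∀ k l s, NoTag (rungR k l s) := fun k l s => by simp [NoTag, rungR]
  have rL : ∀ k l s, NoTag (rungL k l s) := fun k l s => by simp [NoTag, rungL]
  have I : ∀ k l m, NoTag (mergeI k l m) := fun k l s => by simp [NoTag, mergeI]
  have H : ∀ k l m, NoTag (mergeH k l m) := fun k l s => by simp [NoTag, mergeH]
  cases hb with
  | switchTag k l hk hl h => exact Or.inl ⟨k, l, hk, hl, h, rfl⟩
  | removeBigon k l h =>
    exact Or.inr (apply_ne_zero_imp (Submodule.sub_mem _ (dg' (by simp [NoTag, digon]))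
      (Submodule.smul_mem _ _ (dg' nil))))
  | removeBigon' k l h =>
    exact Or.inr (apply_ne_zero_imp (Submodule.sub_mem _ (dg' (by simp [NoTag]))
      (Submodule.smul_mem _ _ (dg' nil))))
  | iEqH k l m h =>
    exact Or.inr (apply_ne_zero_imp (Submodule.sub_mem _ (dg' (I _ _ _)) (dg' (H _ _ _))))
  | migrateTag k l m hk hl hm h =>
    exact Or.inr (apply_ne_zero_imp (Submodule.sub_mem _ (dg' (I _ _ _)) (dg' (H _ _ _))))
  | migrateTag' k l m hk hl hm h =>
    exact Or.inr (apply_ne_zero_imp (Submodule.sub_mem _ (dg' (by simp [NoTag, mergeDown]))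
      (dg' (by simp [NoTag, mergeDown]))))
  | removeSquare k l r s hk hrs h =>
    exact Or.inr (apply_ne_zero_imp (Submodule.sub_mem _ (dg' (app (rR _ _ _) (rR _ _ _)))
      (Submodule.smul_mem _ _ (dg' (rR _ _ _)))))
  | switchSquare k l r s hk hl =>
    refine Or.inr (apply_ne_zero_imp (Submodule.sub_mem _ ?_
      (Submodule.sum_mem _ fun t _ => Submodule.smul_mem _ _ ?_)))
    · unfold ladderRL
      split_ifs
      · exact dg' (app (rR _ _ _) (rL _ _ _))
      · exact Submodule.zero_mem _
    · unfold ladderLR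
      split_ifs
      · exact dg' (app (rL _ _ _) (rR _ _ _))
      · exact Submodule.zero_mem _

theorem CKMBase.noTagIn (hb : CKMBase n x) (w : Word) (hw : x w ≠ 0) :
    NoTagIn w ∧ NoTagIn (mirror w) := by
  rcases hb.noTag with ⟨k, l, -, -, -, rfl⟩ | h
  · refine apply_ne_zero_imp (P := fun w => NoTagIn w ∧ NoTagIn (mirror w))
      (Submodule.sub_mem _ (Finsupp.single_mem_supported K _ ?_)
        (Submodule.smul_mem _ _ (Finsupp.single_mem_supported K _ ?_))) w hw <;>
    simp [NoTagIn, mirror, Gen.mirror, tagOutSwitched]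
  · exact ⟨(h w hw).noTagIn, (h w hw).mirror.noTagIn⟩

/-- The other convention. -/
def Convention.other : Convention → Convention
  | toward => ckm
  | ckm => toward

/-- A relator without bivalent vertices in one convention is carried to the same relator in the
other convention. -/
theorem retag_lin_delete_mem {f : Word → Word} (hf : ∀ w, x w ≠ 0 → NoTagIn (f w))
    (hH : ∀ c, lin (delete n c) (lin f x) ∈ Hom n s t)
    (hR : lin (delete n c.other) (lin f x) ∈ R) :
    retag (lin (delete n c) (lin f x)) ∈ relations n R s t := by
  have h1 : retag (lin (delete n .toward) (lin f x)) = lin (delete n .ckm) (lin f x) := by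
    rw [retag_eq, lin_lin, lin_lin, lin_lin]
    exact lin_congr (P := fun w => NoTagIn (f w)) (fun w hw => retagW_delete hw) hf
  have h2 := mem_relations_of_mem (Or.inr hR) (hH c.other)
  cases c with
  | toward => rw [h1]; exact h2
  | ckm =>
    rw [← h1]
    exact (mem_relations_congr (retag_retag_sub_mem (hH .toward))).2 h2

/-- The relation that changes the side of the tag of an incoming vertex, rotated by half a
turn. -/
def switchTagInRelator (k l : ℕ) : Lin :=
  dg (rotW [up k, up l] [] [⟨[], .tagIn k l, []⟩]) -
    (-1 : K) ^ (k * l) • dg (rotW [up k, up l] [] (tagInSwitched k l))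

theorem retag_switchTagInRelator {k l : ℕ} (hk : 0 < k) (hl : 0 < l) (h : k + l = n) :
    retag (switchTagInRelator k l) + (-1 : K) ^ (k * l) • switchTagInRelator k l ∈
      relations n R [] [dn l, dn k] := by
  have h1 := (iso_retagW_retagW (isWeb_gen (g := .tagIn k l) ⟨hk, hl, h⟩)).rotW.sub_mem (R := R)
  have h2 : (-1 : K) ^ (k * l) * (-1 : K) ^ (k * l) = 1 := by
    rw [← mul_pow]; simp
  have e1 : retagW [⟨[], .tagIn k l, []⟩] = tagInSwitched k l := by simp [retagW_cons, Gen.retag]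
  rw [e1] at h1
  have e2 : retag (switchTagInRelator k l) + (-1 : K) ^ (k * l) • switchTagInRelator k l =
      -(-1 : K) ^ (k * l) • (dg (rotW [up k, up l] [] (retagW (tagInSwitched k l))) -
        dg (rotW [up k, up l] [] [⟨[], .tagIn k l, []⟩])) := by
    simp only [switchTagInRelator, map_sub, map_smul, retag_dg, retagW_rotW, e1, smul_sub,
      smul_smul, h2, one_smul, neg_smul]
    abel
  rw [e2]
  exact Submodule.smul_mem _ _ h1

theorem IsWeb.extWeb {w : Word} (h : IsWeb n s w t) : ExtWeb n s w t := by
  induction w generalizing s with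
  | nil => exact extWeb_nil.2 (isWeb_nil.1 h).2
  | cons σ w ih =>
    rw [isWeb_cons] at h
    refine extWeb_cons.2 ⟨h.1, ?_, ih h.2.2⟩
    have h1 := h.2.1.2.1
    cases hg : σ.gen <;> rw [hg] at h1 <;> simp only [Gen.OK] at h1 <;> simp only [Gen.Ext] <;>
      omega

theorem iso_delete_reverse_vertex {w w' : Word} (hw : IsWeb n [] w t)
    (h : Iso n t.reverse [] (flip (mirror w)) w') :
    Iso n [] (t.map Strand.dual) (delete n c (reverse w)) (rotW t.reverse [] w') := by
  have h1 := iso_delete_reverse (c := c) hw.extWeb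
  rw [delete_of_slicesOK (isWeb_iff.1 h.1).2.1, deleteRow_of_rowOK hw.2.1] at h1
  refine h1.trans ?_
  have h2 := h.rotW
  rwa [dualRow_reverse] at h2

theorem sub_smul_sub_mem {S : Submodule K Lin} {a a' b b' : Lin} (c : K) (h : a - a' ∈ S)
    (h' : b - b' ∈ S) : a - c • b - (a' - c • b') ∈ S := by
  have e : a - c • b - (a' - c • b') = a - a' - c • (b - b') := by rw [smul_sub]; abel
  rw [e]
  exact S.sub_mem h (S.smul_mem c h')

theorem lin_delete_reverse_switchTag {k l : ℕ} (hk : 0 < k) (hl : 0 < l) (h : k + l = n) :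
    lin (delete n c) (lin reverse (switchTagRelator k l)) - switchTagInRelator l k ∈
      relations n R [] [dn k, dn l] := by
  have h1 := (iso_delete_reverse_vertex (c := c) (isWeb_gen (g := .tagOut k l) ⟨hk, hl, h⟩)
    (Iso.refl (isWeb_gen (g := .tagIn l k) ⟨hl, hk, by omega⟩))).sub_mem (R := R)
  have h2 := (iso_mirror_tagOutSwitched hk hl h).flip
  rw [flip_tagOutSwitched] at h2
  have h3 := (iso_delete_reverse_vertex (c := c) (isWeb_tagOutSwitched hk hl h) h2).sub_mem (R := R)
  simp only [switchTagRelator, switchTagInRelator, map_sub, map_smul, lin_dg, mul_comm l k]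
  exact sub_smul_sub_mem _ h1 h3

theorem lin_delete_reverse_mirror_switchTag {k l : ℕ} (hk : 0 < k) (hl : 0 < l) (h : k + l = n) :
    lin (delete n c) (lin reverse (lin mirror (switchTagRelator k l))) - switchTagInRelator k l ∈
      relations n R [] [dn l, dn k] := by
  have h1 := (iso_delete_reverse_vertex (c := c) (isWeb_gen (g := .tagOut l k) ⟨hl, hk, by omega⟩)
    (Iso.refl (isWeb_gen (g := .tagIn k l) ⟨hk, hl, h⟩))).sub_mem (R := R)
  have h2 := Iso.refl (isWeb_tagInSwitched hk hl h)
  rw [← flip_tagOutSwitched] at h2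
  have h3 := (iso_delete_reverse_vertex (c := c) (isWeb_tagOutSwitched hk hl h).mirror
    (by rw [mirror_mirror]; exact h2)).sub_mem (R := R)
  rw [flip_tagOutSwitched] at h3
  simp only [switchTagRelator, switchTagInRelator, map_sub, map_smul, lin_dg]
  exact sub_smul_sub_mem _ h1 h3

/-- A relator that changes the side of the tag of an incoming vertex is multiplied by a sign. -/
theorem retag_mem_of_switchTagIn {k l : ℕ} (hk : 0 < k) (hl : 0 < l) (h : k + l = n)
    (h1 : x - switchTagInRelator k l ∈ relations n ∅ [] [dn l, dn k])
    (h2 : y - switchTagInRelator k l ∈ relations n ∅ [] [dn l, dn k])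
    (hy : y ∈ relations n R [] [dn l, dn k]) : retag x ∈ relations n R [] [dn l, dn k] := by
  have h3 := retag_mem_relations (R' := R) (by simp) (by simp) h1
  rw [map_sub] at h3
  rw [mem_relations_congr h3]
  have h4 := (mem_relations_congr (relations_mono (Set.empty_subset R) _ _ h2)).1 hy
  have h5 := Submodule.sub_mem _ (retag_switchTagInRelator (R := R) hk hl h)
    (Submodule.smul_mem _ ((-1 : K) ^ (k * l)) h4)
  simpa using h5

/-- The change of tag convention exchanges the two versions of the relations. -/
theorem retag_mem_ckmWith (hx : x ∈ relations n (ckmWith n c) s t) :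
    retag x ∈ relations n (ckmWith n c.other) s t := by
  refine retag_mem_relations (fun _ => placeable_ckmWith) ?_ hx
  rintro y ⟨x, hb, hy⟩
  obtain ⟨s, t, hE⟩ := hb.exists_mem_ExtHom
  have hH := fun c => lin_delete_mem_Hom (c := c) hE
  have hmH := fun c => lin_delete_mem_Hom (c := c) (lin_mirror_mem_ExtHom hE)
  have hrH := fun c => lin_delete_reverse_mem_Hom (c := c) hE
  have hrmH := fun c => lin_delete_reverse_mem_Hom (c := c) (lin_mirror_mem_ExtHom hE)
  have hf := hb.noTagIn
  rcases hy with rfl | rfl | rfl | rfl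
  · refine ⟨_, _, hH c, ?_⟩
    have e : lin id x = x := by simp [lin]
    rw [← e]
    exact retag_lin_delete_mem (fun w hw => (hf w hw).1) (by simpa [e] using hH)
      ⟨x, hb, Or.inl (by rw [e])⟩
  · exact ⟨_, _, hmH c, retag_lin_delete_mem (fun w hw => (hf w hw).2) hmH
      ⟨x, hb, Or.inr (Or.inl rfl)⟩⟩
  · rcases hb.noTag with ⟨k, l, hk, hl, h, rfl⟩ | hx
    · have hE' : switchTagRelator k l ∈ ExtHom n [] [up k, up l] :=
        Submodule.sub_mem _ (dg_mem_ExtHom (extWeb_tagOut hk hl h))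
          (Submodule.smul_mem _ _ (dg_mem_ExtHom (extWeb_tagOutSwitched hk hl h)))
      have h0 : deleteRow n [up k, up l] = [up k, up l] :=
        deleteRow_of_rowOK (by simp [up]; omega)
      have hrH' : ∀ c, lin (delete n c) (lin reverse (switchTagRelator k l)) ∈
          Hom n [] [dn k, dn l] := fun c => by
        have h1 := lin_delete_reverse_mem_Hom (c := c) hE'
        rw [h0] at h1
        exact h1
      exact ⟨_, _, hrH' c, retag_mem_of_switchTagIn hl hk (by omega)
        (lin_delete_reverse_switchTag hk hl h) (lin_delete_reverse_switchTag hk hl h)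
        (mem_relations_of_mem (Or.inr ⟨_, hb, Or.inr (Or.inr (Or.inl rfl))⟩) (hrH' c.other))⟩
    · exact ⟨_, _, hrH c, retag_lin_delete_mem (fun w hw => (hx w hw).noTagIn_reverse) hrH
        ⟨x, hb, Or.inr (Or.inr (Or.inl rfl))⟩⟩
  · rcases hb.noTag with ⟨k, l, hk, hl, h, rfl⟩ | hx
    · have hE' : switchTagRelator k l ∈ ExtHom n [] [up k, up l] :=
        Submodule.sub_mem _ (dg_mem_ExtHom (extWeb_tagOut hk hl h))
          (Submodule.smul_mem _ _ (dg_mem_ExtHom (extWeb_tagOutSwitched hk hl h)))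
      have h0 : deleteRow n [up k, up l] = [up k, up l] :=
        deleteRow_of_rowOK (by simp [up]; omega)
      have hrH' : ∀ c, lin (delete n c) (lin reverse (lin mirror (switchTagRelator k l))) ∈
          Hom n [] [dn l, dn k] := fun c => by
        have h1 := lin_delete_reverse_mem_Hom (c := c) (lin_mirror_mem_ExtHom hE')
        rw [deleteRow_reverse, deleteRow_reverse, h0] at h1
        exact h1
      exact ⟨_, _, hrH' c, retag_mem_of_switchTagIn hk hl h
        (lin_delete_reverse_mirror_switchTag hk hl h) (lin_delete_reverse_mirror_switchTag hk hl h)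
        (mem_relations_of_mem (Or.inr ⟨_, hb, Or.inr (Or.inr (Or.inr rfl))⟩) (hrH' c.other))⟩
    · refine ⟨_, _, hrmH c, ?_⟩
      have hm := retag_lin_delete_mem (x := x) (f := reverse ∘ mirror) (R := ckmWith n c.other)
        (s := (deleteRow n s.reverse).map Strand.dual)
        (t := (deleteRow n t.reverse).map Strand.dual)
        (c := c) (fun w hw => (hx w hw).mirror.noTagIn_reverse)
        (by simpa only [← lin_lin] using hrmH) ⟨x, hb, Or.inr (Or.inr (Or.inr (by rw [← lin_lin])))⟩
      rwa [← lin_lin] at hm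

/-- The converse holds since the change of tag convention is an involution up to isotopy. -/
theorem mem_ckmWith_iff (hx : x ∈ Hom n s t) :
    x ∈ relations n (ckmWith n c) s t ↔ retag x ∈ relations n (ckmWith n c.other) s t := by
  refine ⟨retag_mem_ckmWith, fun h => (mem_relations_congr (retag_retag_sub_mem hx)).1 ?_⟩
  have h1 := retag_mem_ckmWith h
  cases c <;> exact h1

end

end SLWeb

theorem proposition2p1 (n : ℕ) (hn : 2 ≤ n) (s t : List SLWeb.Strand) (x : SLWeb.Lin)
    (hx : x ∈ SLWeb.Hom n s t) :
    (x ∈ SLWeb.relations n (SLWeb.reduced n) s t ↔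
      SLWeb.retag x ∈ SLWeb.relations n (SLWeb.ckm n) s t) ∧
    (x ∈ SLWeb.relations n (SLWeb.ckm n) s t ↔
      SLWeb.retag x ∈ SLWeb.relations n (SLWeb.reduced n) s t) := by
  rw [SLWeb.relations_reduced_eq_ckmWith_toward hn]
  exact ⟨SLWeb.mem_ckmWith_iff (c := .toward) hx, SLWeb.mem_ckmWith_iff (c := .ckm) hx⟩
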